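/- **Proposition 5.2** (Propagation of the weighted $C^1$ bounds). Let $\gamma\in(-3,0]$, $s\in(0,1/2)$ and $m_1>3+\gamma+2s$. Functions on $\mathbb T^3\times\mathbb R^3$ ($\mathbb T^3=\mathbb R^3/\mathbb Z^3$) are identified with functions on $\mathbb R^3\times\mathbb R^3$ that are periodic in $x$, and $\langle v\rangle=(1+|v|^2)^{1/2}$. *Collision operator.* Let $\tilde b:[-1,1]\to(0,\infty)$ be measurable and bounded, and for $g,f:\mathbb R^3\to\mathbb R$ let $$Q(g,f)(v)=\int_{\mathbb R^3}\int_{\mathbb S^2}|v-v_*|^{\gamma}\,\theta^{-2-2s}\,\tilde b(\cos\theta)\,\big(g(v_*')f(v')-g(v_*)f(v)\big)\,d\omega\,dv_*,$$ where $\cos\theta=\omega\cdot\frac{v-v_*}{|v-v_*|}$, $v'=\frac{v+v_*}2+\omega\frac{|v-v_*|}2$ and $v_*'=\frac{v+v_*}2-\omega\frac{|v-v_*|}2$. *Regularization.* Let $\psi:\mathbb R^3\to[0,1]$ be smooth with $\psi=1$ on $B_{1/2}$, $\psi=0$ off $B_1$ and $\int\psi=1$. For $\epsilon>0$ let $\phi^\epsilon(x,v)=\epsilon^{-6}\iint\psi(\frac{x-y}\epsilon)\psi(\frac{v-w}\epsilon)\phi(y,w)\,dy\,dw$,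 and $\phi^0=\phi$. For $\epsilon,\delta\ge0$ let $$Q_{\epsilon,\delta}(g,f)(x,v)=\psi(\delta v)\,Q\big(g^\epsilon(x,\cdot),\psi(\delta\,\cdot)f(x,\cdot)\big)(v).$$ *Spaces.* $\tilde X^{m_0,m_1}$ is the space of $\phi\in C^1(\mathbb T^3\times\mathbb R^3)$ with $$\|\phi\|_{\tilde X^{m_0,m_1}}=\sup\langle v\rangle^{m_0}|\phi|+\sup\langle v\rangle^{m_1}|\nabla_{x,v}\phi|<\infty ,$$ where $|\nabla_{x,v}\phi|=|\nabla_x\phi|+|\nabla_v\phi|$, and $\tilde Y_T^{m_0,m_1}=L^\infty([0,T];\tilde X^{m_0,m_1})$, with the essential supremum norm; of measurability in time only that of $t\mapsto f(t,x,v)$ for each $(x,v)$ is required. *Equation.* For $T>0$ and $\sigma\in[0,1]$ consider $$\begin{cases}\partial_tf+\sigma\psi(\delta v)\,v\cdot\nabla_xf-(\epsilon+1-\sigma)\Delta_{x,v}f-\sigma Q_{\epsilon,\delta}(g,f)=R&\text{in }(0,T)\times\mathbb T^3\times\mathbb R^3,\\ f(0,\cdot,\cdot)=f_{\rm in}.\end{cases}\tag{1}$$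 A solution of (1) in $\tilde Y^{m_0,m_1}_T$ is an $f\in\tilde Y_T^{m_0,m_1}$ that is continuous on $[0,T]\times\mathbb T^3\times\mathbb R^3$ with $f(0,\cdot,\cdot)=f_{\rm in}$, such that $t\mapsto f(t,x,v)$ is locally Lipschitz on $(0,T)$ for each $(x,v)$, such that $f(t)$ is of class $C^2$ in $(x,v)$ for a.e. $t\in(0,T)$ if $\epsilon+1-\sigma>0$, and such that for a.e. $t\in(0,T)$ the derivative $\partial_tf(t,x,v)$ exists and the equation holds at every $(x,v)$. *Claim.* There is $M=M(\gamma,s,m_1)$ such that for all $m_0\ge M$, all $\tilde b$ and $\psi$ as above and all $\Lambda>0$ there is a constant $C>0$, depending only on $\gamma,s,m_0,m_1,\tilde b,\psi,\Lambda$, with the following property. For all $\sigma\in[0,1]$, $\epsilon,\delta\in[0,\Lambda]$ and $T>0$, all $f_{\rm in}\in\tilde X^{m_0,m_1}$ and $g,R\in\tilde Y^{m_0,m_1}_T$ with $g\ge0$, every solution $f\in\tilde Y^{m_0,m_1}_T$ of (1) satisfies $$\|f\|_{\tilde Y_T^{m_0,m_1}}\le C\exp\Big\{C\int_0^T\big(1+\|g(t)\|_{\tilde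 X^{m_0,m_1}}\big)\,dt\Big\}\Big(\|f_{\rm in}\|_{\tilde X^{m_0,m_1}}+T\,\|R\|_{\tilde Y_T^{m_0,m_1}}\Big).$$ In particular, for $T\le T_0$ this is $\|f\|_{\tilde Y_T}\lesssim\exp\{C\int_0^T\|g(t)\|_{\tilde X}dt\}\,(\|f_{\rm in}\|_{\tilde X}+T\|R\|_{\tilde Y_T})$, with implied constant depending also on $T_0$. -/

import Mathlib

open MeasureTheory
open scoped ENNReal

noncomputable section

namespace Boltzmann

/-- The velocity space `ℝ³`; also the universal cover of the torus `𝕋³ = ℝ³ / ℤ³`.  Functions on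
`𝕋³ × ℝ³` are functions on `E3 × E3` that are periodic in the first variable. -/
abbrev E3 : Type := EuclideanSpace ℝ (Fin 3)

/-- `ℤ³`-periodicity in the space variable `x`. -/
def PeriodicX (φ : E3 × E3 → ℝ) : Prop :=
  ∀ (i : Fin 3) (x v : E3), φ (x + EuclideanSpace.single i (1 : ℝ), v) = φ (x, v)

/-- The Japanese bracket `⟨v⟩ = (1 + |v|²)^{1/2}`. -/
def jap (v : E3) : ℝ := Real.sqrt (1 + ‖v‖ ^ 2)

/-- The norm `‖⟨v⟩^{m₀} φ‖_{L^∞} + ‖⟨v⟩^{m₁} ∇_{x,v} φ‖_{L^∞}` (possibly infinite).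
The operator norm of the total derivative of `φ` is `|∇_x φ| + |∇_v φ|`. -/
def normX (m₀ m₁ : ℝ) (φ : E3 × E3 → ℝ) : ℝ≥0∞ :=
  (⨆ z : E3 × E3, ENNReal.ofReal (jap z.2 ^ m₀ * |φ z|)) +
    ⨆ z : E3 × E3, ENNReal.ofReal (jap z.2 ^ m₁ * ‖fderiv ℝ φ z‖)

/-- The weighted `C¹` space on `𝕋³ × ℝ³`. -/
structure MemX (m₀ m₁ : ℝ) (φ : E3 × E3 → ℝ) : Prop where
  periodic : PeriodicX φ
  contDiff : ContDiff ℝ 1 φ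
  finite : normX m₀ m₁ φ < ∞

/-- The norm of `L^∞([0,T]; X)`, where `X` is the weighted `C¹` space. -/
def normY (m₀ m₁ T : ℝ) (f : ℝ → E3 × E3 → ℝ) : ℝ≥0∞ :=
  essSup (fun t => normX m₀ m₁ (f t)) (volume.restrict (Set.Icc 0 T))

/-- The space `L^∞([0,T]; X)`, where `X` is the weighted `C¹` space. Of measurability in time
only the pointwise one is asked. -/
structure MemY (m₀ m₁ T : ℝ) (f : ℝ → E3 × E3 → ℝ) : Prop where
  aemeasurable : ∀ z, AEMeasurable (fun t => f t z) (volume.restrict (Set.Icc 0 T))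
  memX : ∀ᵐ t ∂(volume.restrict (Set.Icc 0 T)), MemX m₀ m₁ (f t)
  finite : normY m₀ m₁ T f < ∞

/-- The collision kernel `B(u, ω) = |u|^γ θ^{-2-2s} b(cos θ)`, with `θ ∈ [0, π]` the angle between
the relative velocity `u` and `ω ∈ 𝕊²`. -/
def kernelB (γ s : ℝ) (b : ℝ → ℝ) (u ω : E3) : ℝ :=
  ‖u‖ ^ γ * InnerProductGeometry.angle u ω ^ (-2 - 2 * s) *
    b (Real.cos (InnerProductGeometry.angle u ω))

/-- The post-collisional velocity `v' = (v + v_*)/2 + ω |v - v_*|/2`. -/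
def postV (v vs ω : E3) : E3 := (1 / 2 : ℝ) • (v + vs) + (‖v - vs‖ / 2) • ω

/-- The post-collisional velocity `v_*' = (v + v_*)/2 - ω |v - v_*|/2`. -/
def postVs (v vs ω : E3) : E3 := (1 / 2 : ℝ) • (v + vs) - (‖v - vs‖ / 2) • ω

/-- The (bilinear) collision operator
`Q(g,f)(v) = ∫_{ℝ³} ∫_{𝕊²} B(v - v_*, ω) (g(v_*') f(v') - g(v_*) f(v)) dω dv_*`,
with `dω` the surface measure of the unit sphere.  For `s < 1/2` and `g`, `f` continuously
differentiable and suitably decaying the integral converges absolutely. -/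
def collisionQ (γ s : ℝ) (b : ℝ → ℝ) (g f : E3 → ℝ) (v : E3) : ℝ :=
  ∫ p : E3 × Metric.sphere (0 : E3) 1,
    kernelB γ s b (v - p.1) p.2 *
      (g (postVs v p.1 p.2) * f (postV v p.1 p.2) - g p.1 * f v)
    ∂((volume : Measure E3).prod (volume : Measure E3).toSphere)

/-- The smooth cut-off functions used in the regularization. -/
structure IsCutoff (ψ : E3 → ℝ) : Prop where
  smooth : ContDiff ℝ (⊤ : ℕ∞) ψ
  nonneg : ∀ v, 0 ≤ ψ v
  le_one : ∀ v, ψ v ≤ 1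
  integral_eq_one : ∫ v, ψ v = 1
  eq_one : ∀ v, ‖v‖ < 1 / 2 → ψ v = 1
  eq_zero : ∀ v, 1 ≤ ‖v‖ → ψ v = 0

/-- The mollification `φ^ε(x,v) = ε^{-6} ∫ ψ((x-y)/ε) ψ((v-w)/ε) φ(y,w) dy dw` (with `φ⁰ = φ`); a
function on `𝕋³ × ℝ³` is convolved through its periodic extension. -/
def mollify (ψ : E3 → ℝ) (ε : ℝ) (φ : E3 × E3 → ℝ) (z : E3 × E3) : ℝ :=
  if ε = 0 then φ z
  else (ε ^ 6)⁻¹ *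
    ∫ q : E3 × E3, ψ (ε⁻¹ • (z.1 - q.1)) * ψ (ε⁻¹ • (z.2 - q.2)) * φ q

/-- The regularized collision operator
`Q_{ε,δ}(g,f)(x,v) = ψ(δv) Q(g^ε(x,·), ψ(δ·) f(x,·))(v)`. -/
def collisionReg (γ s : ℝ) (b : ℝ → ℝ) (ψ : E3 → ℝ) (ε δ : ℝ)
    (g f : E3 × E3 → ℝ) (z : E3 × E3) : ℝ :=
  ψ (δ • z.2) *
    collisionQ γ s b (fun w => mollify ψ ε g (z.1, w)) (fun w => ψ (δ • w) * f (z.1, w)) z.2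

/-- The Laplacian `Δ_{x,v}` in all six variables. -/
def laplXV (φ : E3 × E3 → ℝ) (z : E3 × E3) : ℝ :=
  Laplacian.laplacian (fun x : E3 => φ (x, z.2)) z.1 +
    Laplacian.laplacian (fun v : E3 => φ (z.1, v)) z.2

/-- The regularized linear operator
`∂_t f + σ ψ(δv) v·∇_x f - (ε + (1-σ)) Δ_{x,v} f - σ Q_{ε,δ}(g,f)`, at `(t,z)`, `z = (x,v)`. -/
def linOp (γ s : ℝ) (b : ℝ → ℝ) (ψ : E3 → ℝ) (σ ε δ : ℝ)
    (g f : ℝ → E3 × E3 → ℝ) (t : ℝ) (z : E3 × E3) : ℝ :=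
  deriv (fun τ => f τ z) t
    + σ * ψ (δ • z.2) * fderiv ℝ (f t) z (z.2, 0)
    - (ε + (1 - σ)) * laplXV (f t) z
    - σ * collisionReg γ s b ψ ε δ (g t) (f t) z

/-- `f` is a strong solution on `[0,T]` of the regularized linear equation with data `f_in`, `R`.
As `g` and `R` are merely bounded in time, `f` is locally Lipschitz in time and the equation holds
pointwise in `(x,v)` at almost every time.  Where the Laplacian is present, `f(t)` is `C²`. -/
structure IsSolution (γ s : ℝ) (b : ℝ → ℝ) (ψ : E3 → ℝ) (σ ε δ T : ℝ)
    (fin : E3 × E3 → ℝ) (g R f : ℝ → E3 × E3 → ℝ) : Prop where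
  continuousOn : ContinuousOn (fun p : ℝ × (E3 × E3) => f p.1 p.2) (Set.Icc 0 T ×ˢ Set.univ)
  lipschitz : ∀ z, LocallyLipschitzOn (Set.Ioo 0 T) (fun t => f t z)
  contDiff : 0 < ε + (1 - σ) → ∀ᵐ t ∂(volume.restrict (Set.Ioo 0 T)), ContDiff ℝ 2 (f t)
  initial : ∀ z, f 0 z = fin z
  equation : ∀ᵐ t ∂(volume.restrict (Set.Ioo 0 T)), ∀ z,
    DifferentiableAt ℝ (fun τ => f τ z) t ∧ linOp γ s b ψ σ ε δ g f t z = R t z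

end Boltzmann

end

/-!
The estimate is a maximum principle for `±f` and for all difference quotients
`c (f(z + k) - f(z))` with `|k| < 1` and `|c| |k| ≤ 1`, compared with multiples `N q` of the weight
`q = ⟨v⟩^{-m} + η ⟨v⟩^{-m+2s}`, where `m = m₀` for `f` and `m = m₁` for the quotients.  The second
term of the weight makes the smallest admissible `N` attained, and `η → 0` in the end
(`max_principle`, `wLip_of_touch`).  At a point where one of these functions touches `N q` from below:

* its `x`-gradient vanishes, as `q` depends on `v` only, so the transport term contributes only
  through the difference quotient of the Lipschitz field `ψ(δv) v`;
* its Laplacian is at most `N Δq ≤ C N q`;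
* `Q(G, ·)` with `G ≥ 0` respects the order of functions which touch at the point, so that it may be
  evaluated at the truncated weight instead of the function (`collision_touch`).  The
  regularity of the function enters only in the convergence of `Q`, not in the bound, which is why
  no derivative is lost.

When the difference quotient falls on `g` or on a cut-off instead of `f`, one has to estimate
`Q(G, H)` with only the size `⟨v⟩^{-m₁}` of `G` available, and with `H` Lipschitz.  Since `2s < 1`, a
Hölder modulus of `H` of some order `a > 2s` is enough, and interpolation with the decay
`⟨v⟩^{-m₀}` makes it decay fast if `m₀` is large (`collision_lip`, `collisionReg_diff_le`).

All of this rests on one weighted bound for `Q(G, H)(v)`, `collision_bound`.  At grazing angles the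
integrand is `G_*' (H' - H) + H (G_*' - G_*)`: the Hölder modulus of `H` cancels the singularity of
the first part, and the second one is the subject of the cancellation lemma (`cancellation`), in
which the change of variables `v_* ↦ v_*'` leaves only the angular factor
`cos(θ/2)^{-γ-3} - 1 = O(θ)`.  The changes of variables `v_* ↦ v_*'` and `v_* ↦ v'` are not
carried out for fixed `ω` but after averaging over the orthogonal group: in mean over rotations the
vectors `v - v_*'` and `v - v'` are distributed like vectors of length `|v - v_*| cos(θ/2)` and
`|v - v_*| sin(θ/2)`, so that a scaling in the radius suffices (`lintegral_halfSum`,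
`lintegral_halfDiff`).

The resulting inequalities (`touch_bound`) bound the smallest constant `wnorm` of the weighted
Lipschitz estimate `WLip` for `f(t)` by an integral in time, to which Grönwall's inequality applies
(`gronwall_integral`, `exists_wLip_bound`).  The constant `wnorm` is comparable with `normX` on `C¹`
functions; being a countable supremum of expressions in values at fixed points it is visibly
measurable in time.
-/

noncomputable section

namespace Boltzmann

open Set Filter Topology
open scoped Pointwise
open InnerProductGeometry (angle)

/-! ### Rotations and the surface measure -/

/-- The unit sphere of `ℝ³`. -/
abbrev S2 : Type := Metric.sphere (0 : E3) 1

/-- The surface measure of the unit sphere. -/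
abbrev sphMeas : Measure S2 := (volume : Measure E3).toSphere

/-- The measure `du dω` on pairs (relative velocity, scattering direction). -/
abbrev pairMeas : Measure (E3 × S2) := (volume : Measure E3).prod sphMeas

instance : SFinite pairMeas := Measure.prod.instSFinite

/-- The action of a linear isometry on the unit sphere. -/
def sphereMap (R : E3 ≃ₗᵢ[ℝ] E3) (ω : S2) : S2 := ⟨R ω, by simp⟩

lemma continuous_sphereMap (R : E3 ≃ₗᵢ[ℝ] E3) : Continuous (sphereMap R) :=
  Continuous.subtype_mk (R.continuous.comp continuous_subtype_val) _

lemma measurePreserving_sphereMap (R : E3 ≃ₗᵢ[ℝ] E3) :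
    MeasurePreserving (sphereMap R) sphMeas sphMeas := by
  refine ⟨(continuous_sphereMap R).measurable, ?_⟩
  ext s hs
  rw [Measure.map_apply (continuous_sphereMap R).measurable hs, Measure.toSphere_apply' _ hs,
    Measure.toSphere_apply' _ ((continuous_sphereMap R).measurable hs)]
  congr 1
  have : Ioo (0 : ℝ) 1 • ((↑) '' (sphereMap R ⁻¹' s) : Set E3)
      = R ⁻¹' (Ioo (0 : ℝ) 1 • ((↑) '' s)) := by
    ext x
    simp only [Set.mem_smul, Set.mem_image, Set.mem_preimage]
    constructor
    · rintro ⟨r, hr, _, ⟨ω, hω, rfl⟩, rfl⟩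
      exact ⟨r, hr, R ω, ⟨_, hω, rfl⟩, by simp⟩
    · rintro ⟨r, hr, _, ⟨ω, hω, rfl⟩, h⟩
      refine ⟨r, hr, R.symm ω, ⟨sphereMap R.symm ω, ?_, rfl⟩, ?_⟩
      · convert hω using 1
        ext1
        simp [sphereMap]
      · apply R.injective
        simp [← h]
  rw [this, R.measurePreserving.measure_preimage_emb R.toHomeomorph.measurableEmbedding]

lemma measurePreserving_rotate (R : E3 ≃ₗᵢ[ℝ] E3) :
    MeasurePreserving (fun p : E3 × S2 => (R p.1, sphereMap R p.2)) pairMeas pairMeas :=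
  R.measurePreserving.prod (measurePreserving_sphereMap R)

lemma exists_isometry_map {x y : E3} (h : ‖x‖ = ‖y‖) : ∃ R : E3 ≃ₗᵢ[ℝ] E3, R x = y :=
  ⟨_, Submodule.reflection_sub h⟩

/-- A reference unit vector. -/
def e0 : E3 := EuclideanSpace.single 0 1

@[simp] lemma norm_e0 : ‖e0‖ = 1 := by simp [e0]

/-- The orthogonal group of `ℝ³`. -/
abbrev O3 : Type := unitary (E3 →L[ℝ] E3)

instance : SecondCountableTopology (E3 →L[ℝ] E3) :=
  haveI : ProperSpace (E3 →L[ℝ] E3) := FiniteDimensional.proper ℝ _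
  inferInstance

instance : ContinuousStar (E3 →L[ℝ] E3) :=
  ⟨(ContinuousLinearMap.adjoint (𝕜 := ℝ) (E := E3) (F := E3)).continuous⟩

instance : CompactSpace O3 := by
  have : ProperSpace (E3 →L[ℝ] E3) := FiniteDimensional.proper ℝ _
  refine isCompact_iff_compactSpace.mp ?_
  refine Metric.isCompact_of_isClosed_isBounded (isClosed_unitary) ?_
  refine (Metric.isBounded_closedBall (x := (0 : E3 →L[ℝ] E3)) (r := 1)).subset ?_
  intro U hU
  rw [mem_closedBall_zero_iff]
  exact CStarRing.norm_of_mem_unitary hU |>.le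

/-- The normalised Haar measure of the orthogonal group. -/
def haarO : Measure O3 := Measure.haarMeasure ⊤

instance : IsProbabilityMeasure haarO := ⟨by
  simpa [haarO] using Measure.haarMeasure_self (K₀ := (⊤ : TopologicalSpace.PositiveCompacts O3))⟩

instance : haarO.IsMulLeftInvariant := by unfold haarO; infer_instance

/-- The average of `G` over all rotations and reflections. -/
def rotAvg (G : E3 → ℝ≥0∞) (x : E3) : ℝ≥0∞ := ∫⁻ A : O3, G (((A⁻¹ : O3) : E3 →L[ℝ] E3) x) ∂haarO

lemma measurable_rot : Measurable fun p : O3 × E3 => ((p.1⁻¹ : O3) : E3 →L[ℝ] E3) p.2 := by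
  apply Continuous.measurable
  have h1 : Continuous fun p : O3 × E3 => ((p.1⁻¹ : O3) : E3 →L[ℝ] E3) :=
    continuous_subtype_val.comp (continuous_inv.comp continuous_fst)
  exact h1.clm_apply continuous_snd

lemma measurable_rotAvg {G : E3 → ℝ≥0∞} (hG : Measurable G) : Measurable (rotAvg G) :=
  Measurable.lintegral_prod_left' (f := fun p : O3 × E3 => G (((p.1⁻¹ : O3) : E3 →L[ℝ] E3) p.2))
    (hG.comp measurable_rot)

lemma rotAvg_map (G : E3 → ℝ≥0∞) (R : E3 ≃ₗᵢ[ℝ] E3) (x : E3) : rotAvg G (R x) = rotAvg G x := by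
  set B : O3 := Unitary.linearIsometryEquiv.symm R with hB
  have hBx : ∀ x, ((B : O3) : E3 →L[ℝ] E3) x = R x := fun x => by simp [hB]
  unfold rotAvg
  rw [← lintegral_mul_left_eq_self (μ := haarO) (fun A : O3 => G (((A⁻¹ : O3) : E3 →L[ℝ] E3) (R x))) B]
  congr 1
  ext A
  congr 1
  have : ((B * A)⁻¹ : O3) = A⁻¹ * B⁻¹ := mul_inv_rev _ _
  rw [this, ← hBx]
  have h2 : (((A⁻¹ * B⁻¹ : O3)) : E3 →L[ℝ] E3) (((B : O3) : E3 →L[ℝ] E3) x)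
    = ((A⁻¹ * B⁻¹ * B : O3) : E3 →L[ℝ] E3) x := rfl
  rw [h2]
  simp

lemma rotAvg_eq_norm (G : E3 → ℝ≥0∞) (x : E3) : rotAvg G x = rotAvg G (‖x‖ • e0) := by
  obtain ⟨R, hR⟩ := exists_isometry_map (x := x) (y := ‖x‖ • e0) (by simp [norm_smul])
  rw [← hR, rotAvg_map]

lemma linearIsometryEquiv_apply (A : O3) (x : E3) :
    Unitary.linearIsometryEquiv A x = (A : E3 →L[ℝ] E3) x := rfl

/-- Averaging over the orthogonal group: for a rotation-invariant density `K`
and an equivariant map `τ`, only the rotational average of `G` matters. -/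
lemma lintegral_rotAvg {K : E3 × S2 → ℝ≥0∞} (hK : Measurable K)
    (hKR : ∀ (R : E3 ≃ₗᵢ[ℝ] E3) p, K (R p.1, sphereMap R p.2) = K p)
    {τ : E3 × S2 → E3} (hτ : Measurable τ)
    (hτR : ∀ (R : E3 ≃ₗᵢ[ℝ] E3) p, τ (R p.1, sphereMap R p.2) = R (τ p))
    {G : E3 → ℝ≥0∞} (hG : Measurable G) :
    ∫⁻ p, K p * G (τ p) ∂pairMeas = ∫⁻ p, K p * rotAvg G (τ p) ∂pairMeas := by
  have h1 : ∀ A : O3, ∫⁻ p, K p * G (τ p) ∂pairMeas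
      = ∫⁻ p, K p * G (((A⁻¹ : O3) : E3 →L[ℝ] E3) (τ p)) ∂pairMeas := by
    intro A
    have := (measurePreserving_rotate (Unitary.linearIsometryEquiv A⁻¹)).lintegral_comp
      (f := fun p => K p * G (τ p)) (hK.mul (hG.comp hτ))
    rw [← this]
    refine lintegral_congr fun p => ?_
    rw [hKR, hτR, linearIsometryEquiv_apply]
  have hm : Measurable fun q : O3 × (E3 × S2) =>
      (((q.1⁻¹ : O3) : E3 →L[ℝ] E3) (τ q.2)) :=
    measurable_rot.comp (f := fun q : O3 × (E3 × S2) => (q.1, τ q.2))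
      (measurable_fst.prodMk (hτ.comp measurable_snd))
  have hm' : ∀ p, Measurable fun A : O3 => (((A⁻¹ : O3) : E3 →L[ℝ] E3) (τ p)) := fun p =>
    measurable_rot.comp (f := fun A : O3 => (A, τ p)) (measurable_id.prodMk measurable_const)
  calc ∫⁻ p, K p * G (τ p) ∂pairMeas = ∫⁻ _A : O3, ∫⁻ p, K p * G (τ p) ∂pairMeas ∂haarO := by simp
    _ = ∫⁻ A : O3, ∫⁻ p, K p * G (((A⁻¹ : O3) : E3 →L[ℝ] E3) (τ p)) ∂pairMeas ∂haarO :=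
        lintegral_congr h1
    _ = ∫⁻ p, ∫⁻ A : O3, K p * G (((A⁻¹ : O3) : E3 →L[ℝ] E3) (τ p)) ∂haarO ∂pairMeas := by
        apply lintegral_lintegral_swap
        exact ((hK.comp measurable_snd).mul (hG.comp hm)).aemeasurable
    _ = _ := by
        refine lintegral_congr fun p => ?_
        exact lintegral_const_mul _ (hG.comp (hm' p))

/-! ### The post-collisional velocities -/

/-- The half-sum `(u + |u| ω) / 2`; thus `v_*' = v - halfSum (v - v_*) ω`. -/
def halfSum (u : E3) (ω : E3) : E3 := (1 / 2 : ℝ) • (u + ‖u‖ • ω)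

/-- The half-difference `(u - |u| ω) / 2`; thus `v' = v - halfDiff (v - v_*) ω`. -/
def halfDiff (u : E3) (ω : E3) : E3 := (1 / 2 : ℝ) • (u - ‖u‖ • ω)

lemma norm_sphere (ω : S2) : ‖(ω : E3)‖ = 1 := by simp

lemma halfSum_add_halfDiff (u ω : E3) : halfSum u ω + halfDiff u ω = u := by
  unfold halfSum halfDiff; module

lemma halfDiff_neg (u ω : E3) : halfDiff u (-ω) = halfSum u ω := by
  unfold halfSum halfDiff; module

lemma norm_halfSum (u : E3) (ω : S2) : ‖halfSum u ω‖ = ‖u‖ * Real.cos (angle u (ω : E3) / 2) := by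
  have hω := norm_sphere ω
  have hc : 0 ≤ Real.cos (angle u (ω : E3) / 2) :=
    Real.cos_nonneg_of_mem_Icc ⟨by linarith [InnerProductGeometry.angle_nonneg u (ω : E3), Real.pi_pos],
      by linarith [InnerProductGeometry.angle_le_pi u (ω : E3)]⟩
  rw [← sq_eq_sq₀ (norm_nonneg _) (by positivity), halfSum, norm_smul, mul_pow, norm_add_sq_real,
    inner_smul_right, norm_smul, hω, mul_pow ‖u‖ (Real.cos _), Real.cos_sq, mul_div_cancel₀ _ two_ne_zero,
    ← InnerProductGeometry.cos_angle_mul_norm_mul_norm u (ω : E3), hω]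
  simp only [Real.norm_eq_abs]
  norm_num
  ring

lemma angle_neg_right_sphere (u : E3) (ω : S2) :
    angle u (((-ω : S2)) : E3) = Real.pi - angle u (ω : E3) := by
  rw [show (((-ω : S2)) : E3) = -(ω : E3) from rfl, InnerProductGeometry.angle_neg_right]

lemma norm_halfDiff (u : E3) (ω : S2) : ‖halfDiff u ω‖ = ‖u‖ * Real.sin (angle u (ω : E3) / 2) := by
  have h := norm_halfSum u (-ω)
  rw [angle_neg_right_sphere, ← halfDiff_neg, show -(((-ω : S2)) : E3) = (ω : E3) from neg_neg _] at h
  rw [h, ← Real.cos_pi_div_two_sub]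
  congr 2
  ring

lemma halfSum_map (R : E3 ≃ₗᵢ[ℝ] E3) (u : E3) (ω : S2) :
    halfSum (R u) (sphereMap R ω) = R (halfSum u ω) := by
  simp [halfSum, sphereMap]

lemma angle_map_sphere (R : E3 ≃ₗᵢ[ℝ] E3) (u : E3) (ω : S2) :
    angle (R u) (sphereMap R ω : E3) = angle u (ω : E3) :=
  R.toLinearIsometry.angle_map u ω

lemma measurable_angle : Measurable fun p : E3 × S2 => angle p.1 (p.2 : E3) := by
  unfold InnerProductGeometry.angle
  apply Real.continuous_arccos.measurable.comp
  apply Measurable.div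
  · exact (continuous_fst.inner (continuous_subtype_val.comp continuous_snd)).measurable
  · exact (continuous_fst.norm.mul (continuous_subtype_val.comp continuous_snd).norm).measurable

lemma measurable_angle_right (u : E3) : Measurable fun ω : S2 => angle u (ω : E3) :=
  Measurable.comp (g := fun p : E3 × S2 => angle p.1 (p.2 : E3)) (f := fun ω : S2 => (u, ω))
    measurable_angle (measurable_const.prodMk measurable_id)

lemma continuous_halfSum : Continuous fun p : E3 × S2 => halfSum p.1 p.2 := by
  unfold halfSum; fun_prop

lemma continuous_halfDiff : Continuous fun p : E3 × S2 => halfDiff p.1 p.2 := by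
  unfold halfDiff; fun_prop

/-! ### Change of variables and angular integrals -/

/-- The integral over the unit sphere of a function of the angle with a fixed axis. -/
def angMean (Θ : ℝ → ℝ≥0∞) : ℝ≥0∞ := ∫⁻ ω : S2, Θ (angle e0 (ω : E3)) ∂sphMeas

lemma lintegral_angle {Θ : ℝ → ℝ≥0∞} (hΘ : Measurable Θ) {u : E3} (hu : u ≠ 0) :
    ∫⁻ ω : S2, Θ (angle u (ω : E3)) ∂sphMeas = angMean Θ := by
  obtain ⟨R, hR⟩ := exists_isometry_map (x := u) (y := ‖u‖ • e0) (by simp [norm_smul])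
  unfold angMean
  rw [← (measurePreserving_sphereMap R).lintegral_comp (f := fun ω : S2 => Θ (angle e0 (ω : E3)))
    (hΘ.comp (measurable_angle_right e0))]
  refine lintegral_congr fun ω => ?_
  rw [← angle_map_sphere R u, hR, InnerProductGeometry.angle_smul_left_of_pos _ _ (norm_pos_iff.2 hu)]

lemma angMean_mono {Θ Θ' : ℝ → ℝ≥0∞} (h : ∀ θ, 0 ≤ θ → θ ≤ Real.pi → Θ θ ≤ Θ' θ) :
    angMean Θ ≤ angMean Θ' :=
  lintegral_mono fun _ => h _ (InnerProductGeometry.angle_nonneg _ _) (InnerProductGeometry.angle_le_pi _ _)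

lemma angMean_const_mul (c : ℝ≥0∞) {Θ : ℝ → ℝ≥0∞} (hΘ : Measurable Θ) :
    angMean (fun θ => c * Θ θ) = c * angMean Θ :=
  lintegral_const_mul _ (hΘ.comp (measurable_angle_right e0))

lemma sphMeas_singleton (ω : S2) : sphMeas {ω} = 0 := by
  rw [Measure.toSphere_apply' _ (measurableSet_singleton _)]
  have h : (Ioo (0 : ℝ) 1 • ((↑) '' ({ω} : Set S2)) : Set E3) ⊆ (ℝ ∙ (ω : E3) : Submodule ℝ E3) := by
    rintro _ ⟨r, -, _, ⟨_, rfl, rfl⟩, rfl⟩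
    exact Submodule.smul_mem _ _ (Submodule.mem_span_singleton_self _)
  have h2 : volume ((ℝ ∙ (ω : E3) : Submodule ℝ E3) : Set E3) = 0 := by
    apply Measure.addHaar_submodule
    intro htop
    have h3 := finrank_span_singleton (K := ℝ) (v := (ω : E3)) (by
      intro h0; have := norm_sphere ω; rw [h0] at this; simp at this)
    rw [htop] at h3
    simp at h3
  rw [measure_mono_null h h2, mul_zero]

instance : NullSingletonClass sphMeas := ⟨sphMeas_singleton⟩

lemma ae_angle_ne {θ₀ : ℝ} (h : θ₀ = 0 ∨ θ₀ = Real.pi) : ∀ᵐ ω : S2 ∂sphMeas, angle e0 (ω : E3) ≠ θ₀ := by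
  have h1 : {ω : S2 | ¬ angle e0 (ω : E3) ≠ θ₀} ⊆
      {⟨e0, by simp⟩, ⟨-e0, by simp⟩} := by
    intro ω hω
    simp only [ne_eq, not_not, mem_ofPred_eq] at hω
    have hω1 := norm_sphere ω
    rcases h with rfl | rfl
    · left
      rw [InnerProductGeometry.angle_eq_zero_iff] at hω
      obtain ⟨-, r, hr, h2⟩ := hω
      rw [h2, norm_smul, norm_e0, mul_one, Real.norm_eq_abs, abs_of_pos hr] at hω1
      ext1; simpa [hω1] using h2
    · right
      rw [InnerProductGeometry.angle_eq_pi_iff] at hω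
      obtain ⟨-, r, hr, h2⟩ := hω
      rw [h2, norm_smul, norm_e0, mul_one, Real.norm_eq_abs, abs_of_neg hr] at hω1
      have : r = -1 := by linarith
      simp only [mem_singleton_iff]
      ext1; simpa [this] using h2
  exact measure_mono_null h1 ((Set.toFinite _).measure_zero _)

lemma lintegral_norm_scale (q : ℝ) {g : ℝ → ℝ≥0∞} (hg : Measurable g) {c : ℝ} (hc : 0 < c) :
    ∫⁻ u : E3, ENNReal.ofReal (‖u‖ ^ q) * g (‖u‖ * c)
      = ENNReal.ofReal (c ^ (-q - 3)) * ∫⁻ u : E3, ENNReal.ofReal (‖u‖ ^ q) * g ‖u‖ := by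
  have h1 := Measure.map_addHaar_smul (volume : Measure E3) hc.ne'
  have h2 : ∫⁻ u : E3, ENNReal.ofReal (‖c • u‖ ^ q) * g ‖c • u‖
      = ENNReal.ofReal (c ^ (-3 : ℝ)) * ∫⁻ u : E3, ENNReal.ofReal (‖u‖ ^ q) * g ‖u‖ := by
    rw [← lintegral_map (f := fun u : E3 => ENNReal.ofReal (‖u‖ ^ q) * g ‖u‖) (g := fun u => c • u)
      (by fun_prop) (by fun_prop), h1,
      lintegral_smul_measure, smul_eq_mul]
    congr 2
    simp only [finrank_euclideanSpace, Fintype.card_fin]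
    rw [abs_of_pos (by positivity), Real.rpow_neg hc.le]
    norm_cast
  have h3 : ∀ u : E3, ENNReal.ofReal (‖u‖ ^ q) * g (‖u‖ * c)
      = ENNReal.ofReal (c ^ (-q)) * (ENNReal.ofReal (‖c • u‖ ^ q) * g ‖c • u‖) := by
    intro u
    rw [norm_smul, Real.norm_eq_abs, abs_of_pos hc, ← mul_assoc, ← ENNReal.ofReal_mul (by positivity),
      Real.mul_rpow hc.le (norm_nonneg _), ← mul_assoc, ← Real.rpow_add hc]
    simp [mul_comm]
  rw [lintegral_congr h3, lintegral_const_mul _ (by fun_prop), h2, ← mul_assoc,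
    ← ENNReal.ofReal_mul (by positivity), ← Real.rpow_add hc]
  ring_nf

lemma lintegral_norm_angle {F : ℝ → ℝ → ℝ≥0∞} (hF : Measurable (Function.uncurry F)) :
    ∫⁻ p : E3 × S2, F ‖p.1‖ (angle p.1 (p.2 : E3)) ∂pairMeas
      = ∫⁻ ω : S2, (∫⁻ u : E3, F ‖u‖ (angle e0 (ω : E3))) ∂sphMeas := by
  have hm : Measurable fun p : E3 × S2 => F ‖p.1‖ (angle p.1 (p.2 : E3)) :=
    hF.comp (measurable_fst.norm.prodMk measurable_angle)
  rw [lintegral_prod _ hm.aemeasurable]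
  have h1 : ∀ᵐ u : E3, u ≠ 0 := by
    simp [ae_iff]
  rw [lintegral_congr_ae (g := fun u : E3 => ∫⁻ ω : S2, F ‖u‖ (angle e0 (ω : E3)) ∂sphMeas)]
  · rw [lintegral_lintegral_swap]
    apply Measurable.aemeasurable
    exact hF.comp ((measurable_fst.norm).prodMk ((measurable_angle_right e0).comp measurable_snd))
  · filter_upwards [h1] with u hu
    exact lintegral_angle (hF.comp (measurable_const.prodMk measurable_id)) hu

/-- The change of variables `v_* ↦ v_*'`.  After averaging `G` over rotations only
`|v - v_*'| = |u| cos (θ / 2)` matters, and the remaining integral is rescaled. -/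
lemma lintegral_halfSum (q : ℝ) {Θ : ℝ → ℝ≥0∞} (hΘ : Measurable Θ) {G : E3 → ℝ≥0∞}
    (hG : Measurable G) :
    ∫⁻ p : E3 × S2, ENNReal.ofReal (‖p.1‖ ^ q) * Θ (angle p.1 (p.2 : E3)) * G (halfSum p.1 p.2)
        ∂pairMeas
      = angMean (fun θ => ENNReal.ofReal (Real.cos (θ / 2) ^ (-q - 3)) * Θ θ) *
        ∫⁻ u : E3, ENNReal.ofReal (‖u‖ ^ q) * G u := by
  have hK : Measurable fun p : E3 × S2 => ENNReal.ofReal (‖p.1‖ ^ q) * Θ (angle p.1 (p.2 : E3)) :=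
    (by fun_prop : Measurable fun p : E3 × S2 => ENNReal.ofReal (‖p.1‖ ^ q)).mul
      (hΘ.comp measurable_angle)
  have hr : Measurable fun x : ℝ => rotAvg G (x • e0) :=
    (measurable_rotAvg hG).comp (by fun_prop)
  rw [lintegral_rotAvg hK (fun R p => by simp only [angle_map_sphere, LinearIsometryEquiv.norm_map])
    continuous_halfSum.measurable (fun R p => halfSum_map R _ _) hG]
  have h2 : ∀ p : E3 × S2, rotAvg G (halfSum p.1 p.2)
      = rotAvg G ((‖p.1‖ * Real.cos (angle p.1 (p.2 : E3) / 2)) • e0) := fun p => by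
    rw [rotAvg_eq_norm, norm_halfSum]
  simp only [h2]
  rw [lintegral_norm_angle (F := fun r θ => ENNReal.ofReal (r ^ q) * Θ θ *
    rotAvg G ((r * Real.cos (θ / 2)) • e0))]
  swap
  · apply Measurable.mul
    · exact (by fun_prop : Measurable fun p : ℝ × ℝ => ENNReal.ofReal (p.1 ^ q)).mul
        (hΘ.comp measurable_snd)
    · exact hr.comp (by fun_prop : Measurable fun p : ℝ × ℝ => p.1 * Real.cos (p.2 / 2))
  have h3 : ∫⁻ u : E3, ENNReal.ofReal (‖u‖ ^ q) * G u
      = ∫⁻ u : E3, ENNReal.ofReal (‖u‖ ^ q) * rotAvg G (‖u‖ • e0) := by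
    have hs : sphMeas univ ≠ 0 :=
      Measure.measure_univ_ne_zero.2 (Measure.toSphere_ne_zero volume)
    have h4 := lintegral_rotAvg (K := fun p => ENNReal.ofReal (‖p.1‖ ^ q)) (by fun_prop)
      (fun R p => by simp) (τ := fun p => p.1) measurable_fst (fun R p => rfl) hG
    rw [lintegral_prod _ (by fun_prop), lintegral_prod _ ((by
      have := measurable_rotAvg hG
      fun_prop))] at h4
    simp only [lintegral_const] at h4
    rw [lintegral_mul_const _ (by fun_prop), lintegral_mul_const _ (by
      have := measurable_rotAvg hG
      fun_prop)] at h4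
    rw [ENNReal.mul_left_inj hs (measure_ne_top _ _)] at h4
    rw [h4]
    exact lintegral_congr fun u => by rw [rotAvg_eq_norm]
  rw [h3, angMean, ← lintegral_mul_const]
  · refine lintegral_congr_ae ?_
    filter_upwards [ae_angle_ne (Or.inr rfl)] with ω hω
    have hc : 0 < Real.cos (angle e0 (ω : E3) / 2) := Real.cos_pos_of_mem_Ioo
      ⟨by linarith [InnerProductGeometry.angle_nonneg e0 (ω : E3), Real.pi_pos],
        by linarith [lt_of_le_of_ne (InnerProductGeometry.angle_le_pi e0 (ω : E3)) hω]⟩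
    have h5 := lintegral_norm_scale q hr hc
    simp only [mul_assoc, mul_left_comm _ (Θ _)] at *
    have hm : Measurable fun u : E3 => ENNReal.ofReal (‖u‖ ^ q) *
        rotAvg G ((‖u‖ * Real.cos (angle e0 (ω : E3) / 2)) • e0) :=
      (by fun_prop : Measurable fun u : E3 => ENNReal.ofReal (‖u‖ ^ q)).mul
        (hr.comp (by fun_prop : Measurable fun u : E3 => ‖u‖ * Real.cos (angle e0 (ω : E3) / 2)))
    rw [lintegral_const_mul _ hm, h5]
  · exact (by fun_prop : Measurable fun θ : ℝ => ENNReal.ofReal (Real.cos (θ / 2) ^ (-q - 3))).mul hΘ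
      |>.comp (measurable_angle_right e0)

lemma lintegral_norm_angle_self (q : ℝ) {Θ : ℝ → ℝ≥0∞} (hΘ : Measurable Θ) {G : E3 → ℝ≥0∞}
    (hG : Measurable G) :
    ∫⁻ p : E3 × S2, ENNReal.ofReal (‖p.1‖ ^ q) * Θ (angle p.1 (p.2 : E3)) * G p.1 ∂pairMeas
      = angMean Θ * ∫⁻ u : E3, ENNReal.ofReal (‖u‖ ^ q) * G u := by
  have hm : Measurable fun p : E3 × S2 =>
      ENNReal.ofReal (‖p.1‖ ^ q) * Θ (angle p.1 (p.2 : E3)) * G p.1 :=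
    ((by fun_prop : Measurable fun p : E3 × S2 => ENNReal.ofReal (‖p.1‖ ^ q)).mul
      (hΘ.comp measurable_angle)).mul (hG.comp measurable_fst)
  rw [lintegral_prod _ hm.aemeasurable, ← lintegral_const_mul _ (by fun_prop)]
  refine lintegral_congr_ae ?_
  have h1 : ∀ᵐ u : E3, u ≠ 0 := by simp [ae_iff]
  filter_upwards [h1] with u hu
  have hmu : Measurable fun ω : S2 => Θ (angle u (ω : E3)) := hΘ.comp (measurable_angle_right u)
  rw [← lintegral_angle hΘ hu, ← lintegral_mul_const _ hmu]
  exact lintegral_congr fun ω => by ring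

lemma sphereMap_neg (ω : S2) : sphereMap (LinearIsometryEquiv.neg ℝ) ω = -ω := rfl

lemma angMean_pi_sub {Θ : ℝ → ℝ≥0∞} (hΘ : Measurable Θ) :
    angMean (fun θ => Θ (Real.pi - θ)) = angMean Θ := by
  unfold angMean
  rw [← (measurePreserving_sphereMap (LinearIsometryEquiv.neg ℝ)).lintegral_comp
    (f := fun ω : S2 => Θ (angle e0 (ω : E3))) (hΘ.comp (measurable_angle_right e0))]
  refine lintegral_congr fun ω => ?_
  rw [sphereMap_neg, angle_neg_right_sphere]

/-- The change of variables `v_* ↦ v'`, obtained from `v_* ↦ v_*'` by the reflection `ω ↦ -ω`. -/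
lemma lintegral_halfDiff (q : ℝ) {Θ : ℝ → ℝ≥0∞} (hΘ : Measurable Θ) {G : E3 → ℝ≥0∞}
    (hG : Measurable G) :
    ∫⁻ p : E3 × S2, ENNReal.ofReal (‖p.1‖ ^ q) * Θ (angle p.1 (p.2 : E3)) * G (halfDiff p.1 p.2)
        ∂pairMeas
      = angMean (fun θ => ENNReal.ofReal (Real.sin (θ / 2) ^ (-q - 3)) * Θ θ) *
        ∫⁻ u : E3, ENNReal.ofReal (‖u‖ ^ q) * G u := by
  have hΘ' : Measurable fun θ => Θ (Real.pi - θ) := hΘ.comp (by fun_prop)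
  have h1 := (MeasurePreserving.id (volume : Measure E3)).prod
    (measurePreserving_sphereMap (LinearIsometryEquiv.neg ℝ))
  have hm : Measurable fun p : E3 × S2 =>
      ENNReal.ofReal (‖p.1‖ ^ q) * Θ (angle p.1 (p.2 : E3)) * G (halfDiff p.1 p.2) :=
    ((by fun_prop : Measurable fun p : E3 × S2 => ENNReal.ofReal (‖p.1‖ ^ q)).mul
      (hΘ.comp measurable_angle)).mul (hG.comp continuous_halfDiff.measurable)
  rw [← h1.lintegral_comp hm]
  have h2 := lintegral_halfSum q hΘ' hG
  have hms : Measurable fun θ : ℝ => ENNReal.ofReal (Real.sin (θ / 2) ^ (-q - 3)) * Θ θ := by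
    fun_prop
  rw [← angMean_pi_sub hms]
  convert h2 using 2
  · funext p
    simp only [Prod.map_fst, Prod.map_snd, id_eq, sphereMap_neg]
    rw [angle_neg_right_sphere, show (((-p.2 : S2)) : E3) = -(p.2 : E3) from rfl, halfDiff_neg]
  · congr 1
    ext θ
    rw [← Real.cos_pi_div_two_sub]
    congr 5
    ring

lemma volume_coord_eq_zero (i : Fin 3) : volume {u : E3 | u i = 0} = 0 := by
  have h := Measure.addHaar_submodule (volume : Measure E3)
    (LinearMap.ker (EuclideanSpace.proj i : E3 →L[ℝ] ℝ).toLinearMap) (by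
      intro h
      have h1 : (EuclideanSpace.single i (1 : ℝ) : E3) ∈
        LinearMap.ker (EuclideanSpace.proj i : E3 →L[ℝ] ℝ).toLinearMap := by rw [h]; trivial
      simp at h1)
  exact h

lemma integrable_indicator_abs_rpow {r : ℝ} (hr : -1 < r) :
    Integrable ((Icc (-1 : ℝ) 1).indicator fun t => |t| ^ r) := by
  rw [integrable_indicator_iff measurableSet_Icc]
  have h1 : IntegrableOn (fun t : ℝ => |t| ^ r) (Ioc 0 1) := by
    have := (intervalIntegral.intervalIntegrable_rpow' (a := 0) (b := 1) hr).1
    refine this.congr_fun (fun t ht => ?_) measurableSet_Ioc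
    simp only [abs_of_pos ht.1]
  have h2 : IntegrableOn (fun t : ℝ => |t| ^ r) (Ico (-1) 0) := by
    have h3 := (MeasurePreserving.integrableOn_comp_preimage (Measure.measurePreserving_neg (volume : Measure ℝ))
      (Homeomorph.neg ℝ).measurableEmbedding).2 h1
    simpa [Function.comp_def] using h3
  have h3 : IntegrableOn (fun t : ℝ => |t| ^ r) {0} := by
    rw [IntegrableOn, Measure.restrict_eq_zero.2 (by simp)]
    exact integrable_zero_measure
  refine ((h1.union h2).union h3).mono_set ?_
  intro t ht
  rcases lt_trichotomy t 0 with h | h | h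
  · exact Or.inl (Or.inr ⟨ht.1, h⟩)
  · exact Or.inr h
  · exact Or.inl (Or.inl ⟨h, ht.2⟩)

lemma abs_coord_mul_le_sq_angle {u : E3} (hu1 : ‖u‖ ≤ 1) :
    |u 1| * |u 2| ≤ angle u e0 ^ 2 := by
  have h1 := InnerProductGeometry.cos_angle_mul_norm_mul_norm u e0
  have h2 : inner ℝ u e0 = u 0 := by simp [e0, EuclideanSpace.inner_single_right]
  rw [h2, norm_e0, mul_one] at h1
  have h3 := EuclideanSpace.norm_sq_eq u
  simp only [Fin.sum_univ_three, Real.norm_eq_abs, sq_abs] at h3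
  have h4 := Real.sin_sq_add_cos_sq (angle u e0)
  have h5 : Real.sin (angle u e0) ^ 2 ≤ angle u e0 ^ 2 := by
    apply pow_le_pow_left₀ (InnerProductGeometry.sin_angle_nonneg _ _)
    exact Real.sin_le (InnerProductGeometry.angle_nonneg _ _)
  have h6 : Real.sin (angle u e0) ^ 2 * ‖u‖ ^ 2 = u 1 ^ 2 + u 2 ^ 2 := by
    rw [← h1] at h3
    nlinarith
  have h7 : ‖u‖ ^ 2 ≤ 1 := pow_le_one₀ (norm_nonneg _) hu1
  have h8 : u 1 ^ 2 + u 2 ^ 2 ≤ Real.sin (angle u e0) ^ 2 := by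
    rw [← h6]; exact mul_le_of_le_one_right (sq_nonneg _) h7
  have h9 : |u 1| * |u 2| ≤ u 1 ^ 2 + u 2 ^ 2 := by
    rw [← sq_abs (u 1), ← sq_abs (u 2)]
    nlinarith [sq_nonneg (|u 1| - |u 2|), sq_nonneg (|u 1|), sq_nonneg (|u 2|)]
  linarith

/-- Near the axis the surface measure behaves like `θ dθ`, so that powers of the angle above `-2`
are integrable. -/
lemma angMean_rpow_lt_top {p : ℝ} (hp0 : 0 ≤ p) (hp : p < 2) :
    angMean (fun θ => ENNReal.ofReal (θ ^ (-p))) < ∞ := by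
  have hΘ : Measurable fun θ : ℝ => ENNReal.ofReal (θ ^ (-p)) := by fun_prop
  set B : E3 → ℝ≥0∞ := (Metric.ball (0 : E3) 1).indicator 1 with hB
  have hBm : Measurable B := measurable_one.indicator measurableSet_ball
  have h1 := lintegral_norm_angle_self 0 hΘ hBm
  have hint : ∫⁻ u : E3, ENNReal.ofReal (‖u‖ ^ (0 : ℝ)) * B u = volume (Metric.ball (0 : E3) 1) := by
    simp only [Real.rpow_zero, ENNReal.ofReal_one, one_mul, hB]
    rw [lintegral_indicator_one measurableSet_ball]
  have hm : Measurable fun p' : E3 × S2 => ENNReal.ofReal (‖p'.1‖ ^ (0 : ℝ)) *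
      ENNReal.ofReal (angle p'.1 (p'.2 : E3) ^ (-p)) * B p'.1 :=
    ((by fun_prop : Measurable fun p : E3 × S2 => ENNReal.ofReal (‖p.1‖ ^ (0 : ℝ))).mul
      (hΘ.comp measurable_angle)).mul (hBm.comp measurable_fst)
  set I : ℝ≥0∞ := ∫⁻ u : E3, ENNReal.ofReal (angle u e0 ^ (-p)) * B u with hI
  have hIω : ∀ ω : S2, ∫⁻ u : E3, ENNReal.ofReal (‖u‖ ^ (0 : ℝ)) *
      ENNReal.ofReal (angle u (ω : E3) ^ (-p)) * B u = I := by
    intro ω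
    obtain ⟨R, hR⟩ := exists_isometry_map (x := (ω : E3)) (y := e0) (by simp)
    have hm2 : Measurable fun u : E3 => ENNReal.ofReal (angle u e0 ^ (-p)) * B u :=
      (hΘ.comp (Measurable.comp (g := fun p : E3 × S2 => angle p.1 (p.2 : E3))
        (f := fun u : E3 => (u, (⟨e0, by simp⟩ : S2))) measurable_angle
        (measurable_id.prodMk measurable_const))).mul hBm
    rw [hI, ← R.measurePreserving.lintegral_comp hm2]
    refine lintegral_congr fun u => ?_
    have h2 : angle (R u) e0 = angle u (ω : E3) := by
      rw [← hR]; exact R.toLinearIsometry.angle_map u ω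
    rw [h2]
    simp [hB, Set.indicator]
  have hfin : I < ∞ := by
    set f : Fin 3 → ℝ → ℝ := fun i => (Icc (-1 : ℝ) 1).indicator fun t =>
      |t| ^ (if i = 0 then (0 : ℝ) else -(p / 2)) with hf
    have hfi : Integrable fun x : Fin 3 → ℝ => ∏ i, f i (x i) := by
      apply Integrable.fintype_prod
      intro i
      apply integrable_indicator_abs_rpow
      split_ifs <;> linarith
    have hfE : Integrable fun u : E3 => ∏ i, f i (u i) :=
      ((EuclideanSpace.volume_preserving_symm_measurableEquiv_toLp (Fin 3)).integrable_comp_emb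
        (MeasurableEquiv.measurableEmbedding _)).2 hfi
    refine lt_of_le_of_lt (lintegral_mono_ae ?_) hfE.lintegral_lt_top
    have hz : ∀ i : Fin 3, ∀ᵐ u : E3, u i ≠ 0 := fun i => by
      rw [ae_iff]; simpa using volume_coord_eq_zero i
    filter_upwards [hz 1, hz 2] with u hu1 hu2
    by_cases hub : u ∈ Metric.ball (0 : E3) 1
    swap
    · simp [hB, hub]
    have hu1' : ‖u‖ < 1 := by simpa using hub
    have hc : ∀ i, u i ∈ Icc (-1 : ℝ) 1 := fun i => by
      have := (EuclideanSpace.norm_eq u ▸ PiLp.norm_apply_le u i : ‖u i‖ ≤ _)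
      rw [← EuclideanSpace.norm_eq, Real.norm_eq_abs] at this
      exact abs_le.1 (this.trans hu1'.le)
    have h3 := abs_coord_mul_le_sq_angle hu1'.le
    have h4 : 0 < |u 1| * |u 2| := by positivity
    simp only [hB, Set.indicator_of_mem hub, Pi.one_apply, mul_one]
    apply ENNReal.ofReal_le_ofReal
    simp only [hf, Fin.prod_univ_three, Set.indicator_of_mem (hc _)]
    simp only [↓reduceIte, Fin.isValue, Real.rpow_zero, one_mul]
    rw [if_neg (by decide), if_neg (by decide), ← Real.mul_rpow (abs_nonneg _) (abs_nonneg _)]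
    calc angle u e0 ^ (-p) = (angle u e0 ^ 2) ^ (-(p / 2)) := by
          rw [← Real.rpow_natCast, ← Real.rpow_mul (InnerProductGeometry.angle_nonneg _ _)]
          congr 1; push_cast; ring
      _ ≤ _ := Real.rpow_le_rpow_of_nonpos h4 h3 (by linarith)
  rw [lintegral_prod_symm' _ hm, hint] at h1
  simp only [hIω, lintegral_const] at h1
  have h5 : angMean (fun θ => ENNReal.ofReal (θ ^ (-p))) * volume (Metric.ball (0 : E3) 1) < ∞ := by
    rw [← h1]
    exact ENNReal.mul_lt_top hfin (measure_lt_top _ _)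
  by_contra h6
  rw [not_lt, top_le_iff] at h6
  rw [h6, ENNReal.top_mul (Metric.measure_ball_pos _ _ one_pos).ne'] at h5
  exact lt_irrefl _ h5

/-! ### The Japanese bracket -/

lemma one_le_jap (v : E3) : 1 ≤ jap v := by
  rw [jap, Real.one_le_sqrt]; nlinarith [sq_nonneg ‖v‖]

lemma jap_pos (v : E3) : 0 < jap v := one_pos.trans_le (one_le_jap v)

lemma sq_jap (v : E3) : jap v ^ 2 = 1 + ‖v‖ ^ 2 := Real.sq_sqrt (by positivity)

lemma norm_le_jap (v : E3) : ‖v‖ ≤ jap v :=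
  Real.le_sqrt_of_sq_le (by linarith)

lemma jap_le_one_add_norm (v : E3) : jap v ≤ 1 + ‖v‖ := by
  rw [jap, Real.sqrt_le_left (by positivity)]; nlinarith [norm_nonneg v]

lemma continuous_jap : Continuous jap := by unfold jap; fun_prop

lemma jap_le_add (v w : E3) : jap v ≤ jap w + ‖v - w‖ := by
  have h0 : 0 ≤ jap w + ‖v - w‖ := add_nonneg (jap_pos w).le (norm_nonneg _)
  rw [show jap v = Real.sqrt (1 + ‖v‖ ^ 2) from rfl, Real.sqrt_le_left h0]
  have h1 : ‖v‖ ≤ ‖w‖ + ‖v - w‖ := by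
    have := norm_add_le w (v - w); rwa [add_sub_cancel] at this
  nlinarith [sq_jap w, norm_le_jap w, norm_nonneg (v - w), norm_nonneg v, norm_nonneg w,
    mul_le_mul_of_nonneg_right (norm_le_jap w) (norm_nonneg (v - w)),
    pow_le_pow_left₀ (norm_nonneg v) h1 2]

lemma jap_le_two_mul {v w : E3} (h : ‖v - w‖ ≤ 1) : jap v ≤ 2 * jap w := by
  linarith [jap_le_add v w, one_le_jap w]

lemma jap_rpow_pos (v : E3) (r : ℝ) : 0 < jap v ^ r := Real.rpow_pos_of_pos (jap_pos v) r

lemma jap_rpow_le {r r' : ℝ} (v : E3) (h : r ≤ r') : jap v ^ r ≤ jap v ^ r' :=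
  Real.rpow_le_rpow_of_exponent_le (one_le_jap v) h

lemma jap_rpow_add (v : E3) (r r' : ℝ) : jap v ^ (r + r') = jap v ^ r * jap v ^ r' :=
  Real.rpow_add (jap_pos v) r r'

lemma jap_rpow_le_one {r : ℝ} (v : E3) (h : r ≤ 0) : jap v ^ r ≤ 1 :=
  Real.rpow_le_one_of_one_le_of_nonpos (one_le_jap v) h

/-- Decaying powers of the bracket are comparable at points whose brackets are. -/
lemma jap_rpow_neg_le {v w : E3} {c r : ℝ} (hc : 0 < c) (hr : 0 ≤ r) (h : jap v ≤ c * jap w) :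
    jap w ^ (-r) ≤ c ^ r * jap v ^ (-r) := by
  have h1 : (c * jap w) ^ (-r) ≤ jap v ^ (-r) :=
    Real.rpow_le_rpow_of_nonpos (jap_pos v) h (by linarith)
  rw [Real.mul_rpow hc.le (jap_pos w).le] at h1
  calc jap w ^ (-r) = c ^ r * (c ^ (-r) * jap w ^ (-r)) := by
        rw [← mul_assoc, ← Real.rpow_add hc]; simp
    _ ≤ _ := by gcongr

lemma continuous_jap_rpow (r : ℝ) : Continuous fun v => jap v ^ r :=
  continuous_jap.rpow_const fun v => Or.inl (jap_pos v).ne'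

@[fun_prop]
lemma measurable_jap : Measurable jap := continuous_jap.measurable

lemma integrable_jap_rpow {r : ℝ} (hr : 3 < r) : Integrable fun v : E3 => jap v ^ (-r) := by
  have h := integrable_rpow_neg_one_add_norm_sq (E := E3) (μ := volume) (r := r) (by simpa using hr)
  refine h.congr (Eventually.of_forall fun v => ?_)
  simp only [jap]
  rw [Real.sqrt_eq_rpow, ← Real.rpow_mul (by positivity)]
  congr 1; ring

lemma integrableOn_norm_rpow_ball {p : ℝ} (hp : -3 < p) :
    IntegrableOn (fun y : E3 => ‖y‖ ^ p) (Metric.ball 0 1) := by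
  rw [integrableOn_fun_norm_addHaar (μ := (volume : Measure E3)) (f := fun y => y ^ p)]
  have h := (intervalIntegral.intervalIntegrable_rpow' (a := 0) (b := 1) (r := p + 2) (by linarith)).1
  refine (h.mono_set Ioo_subset_Ioc_self).congr_fun (fun y hy => ?_) measurableSet_Ioo
  have hd : Module.finrank ℝ E3 - 1 = 2 := by simp
  simp only [hd, smul_eq_mul]
  rw [Real.rpow_add hy.1, mul_comm]
  norm_cast

/-- `|y|^p` convolved with a decaying power of the bracket. -/
lemma lintegral_norm_rpow_jap_le {p l : ℝ} (hp : -3 < p) (hpl : 3 + p < l) :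
    ∃ C : ℝ, 0 ≤ C ∧ ∀ v : E3,
      ∫⁻ y : E3, ENNReal.ofReal (‖y‖ ^ p) * ENNReal.ofReal (jap (v - y) ^ (-l))
        ≤ ENNReal.ofReal (C * jap v ^ (max p 0)) := by
  have hJ := (integrable_jap_rpow (r := l - p) (by linarith)).lintegral_lt_top
  set J := ∫⁻ y : E3, ENNReal.ofReal (jap y ^ (-(l - p))) with hJd
  have hJv : ∀ v : E3, ∫⁻ y : E3, ENNReal.ofReal (jap (v - y) ^ (-(l - p))) = J := fun v =>
    lintegral_sub_left_eq_self (fun y : E3 => ENNReal.ofReal (jap y ^ (-(l - p)))) v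
  rcases le_or_gt p 0 with hp0 | hp0
  · have hI := (integrableOn_norm_rpow_ball hp).lintegral_lt_top
    set I := ∫⁻ y in Metric.ball (0 : E3) 1, ENNReal.ofReal (‖y‖ ^ p) with hId
    refine ⟨(I + ENNReal.ofReal (2 ^ (-p)) * (J + J)).toReal, ENNReal.toReal_nonneg, fun v => ?_⟩
    have hfin : I + ENNReal.ofReal (2 ^ (-p)) * (J + J) ≠ ∞ :=
      (ENNReal.add_lt_top.2 ⟨hI, ENNReal.mul_lt_top ENNReal.ofReal_lt_top
        (ENNReal.add_lt_top.2 ⟨hJ, hJ⟩)⟩).ne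
    rw [max_eq_right hp0, Real.rpow_zero, mul_one, ENNReal.ofReal_toReal hfin, hId,
      ← lintegral_indicator measurableSet_ball]
    nth_rewrite 2 [← hJv v]
    rw [hJd, ← lintegral_add_left (by fun_prop), ← lintegral_const_mul _ (by fun_prop),
      ← lintegral_add_left ((by fun_prop : Measurable fun y : E3 => ENNReal.ofReal (‖y‖ ^ p)).indicator
        measurableSet_ball)]
    refine lintegral_mono fun y => ?_
    by_cases hy : y ∈ Metric.ball (0 : E3) 1
    · rw [Set.indicator_of_mem hy]
      refine le_add_right ?_
      refine mul_le_of_le_one_right' ?_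
      rw [ENNReal.ofReal_le_one]
      exact jap_rpow_le_one _ (by linarith)
    · rw [Set.indicator_of_notMem hy, zero_add, ← ENNReal.ofReal_add (jap_rpow_pos _ _).le
        (jap_rpow_pos _ _).le, ← ENNReal.ofReal_mul (by positivity), ← ENNReal.ofReal_mul (by positivity)]
      apply ENNReal.ofReal_le_ofReal
      have hy1 : 1 ≤ ‖y‖ := by simpa using hy
      have h1 : jap y ≤ 2 * ‖y‖ := by linarith [jap_le_one_add_norm y]
      have h2 : ‖y‖ ^ p ≤ 2 ^ (-p) * jap y ^ p := by
        have h3 : (2 * ‖y‖) ^ p ≤ jap y ^ p := Real.rpow_le_rpow_of_nonpos (jap_pos y) h1 hp0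
        rw [Real.mul_rpow (by norm_num) (by positivity)] at h3
        calc ‖y‖ ^ p = 2 ^ (-p) * (2 ^ p * ‖y‖ ^ p) := by
              rw [← mul_assoc, ← Real.rpow_add two_pos]; simp
          _ ≤ _ := by gcongr
      refine (mul_le_mul_of_nonneg_right h2 (jap_rpow_pos _ _).le).trans ?_
      rw [mul_assoc]
      refine mul_le_mul_of_nonneg_left ?_ (by positivity)
      rcases le_total (jap y) (jap (v - y)) with h | h
      · refine le_add_of_le_of_nonneg ?_ (jap_rpow_pos _ _).le
        rw [show -(l - p) = p + -l by ring, jap_rpow_add]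
        exact mul_le_mul_of_nonneg_left (Real.rpow_le_rpow_of_nonpos (jap_pos y) h (by linarith))
          (jap_rpow_pos _ _).le
      · refine le_add_of_nonneg_of_le (jap_rpow_pos _ _).le ?_
        rw [show -(l - p) = p + -l by ring, jap_rpow_add]
        exact mul_le_mul_of_nonneg_right (Real.rpow_le_rpow_of_nonpos (jap_pos _) h hp0)
          (jap_rpow_pos _ _).le
  · refine ⟨2 ^ p * J.toReal, by positivity, fun v => ?_⟩
    rw [max_eq_left hp0.le]
    have h1 : ENNReal.ofReal (2 ^ p * J.toReal * jap v ^ p)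
        = ∫⁻ y : E3, ENNReal.ofReal (2 ^ p * jap v ^ p) * ENNReal.ofReal (jap (v - y) ^ (-(l - p))) := by
      rw [lintegral_const_mul _ (by fun_prop), hJv, mul_right_comm, ENNReal.ofReal_mul
        (mul_nonneg (by positivity) (jap_rpow_pos _ _).le), ENNReal.ofReal_toReal hJ.ne]
    rw [h1]
    refine lintegral_mono fun y => ?_
    rw [← ENNReal.ofReal_mul (by positivity), ← ENNReal.ofReal_mul
      (mul_nonneg (by positivity) (jap_rpow_pos _ _).le)]
    apply ENNReal.ofReal_le_ofReal
    rw [show -(l - p) = p + -l by ring, jap_rpow_add, ← mul_assoc]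
    refine mul_le_mul_of_nonneg_right ?_ (jap_rpow_pos _ _).le
    rw [← Real.mul_rpow (by norm_num) (jap_pos _).le, ← Real.mul_rpow
      (mul_nonneg (by norm_num) (jap_pos _).le) (jap_pos _).le]
    refine Real.rpow_le_rpow (norm_nonneg _) ?_ hp0.le
    have h3 : ‖y‖ ≤ ‖v‖ + ‖v - y‖ := by
      have := norm_sub_le v (v - y); rwa [sub_sub_cancel] at this
    nlinarith [norm_le_jap v, norm_le_jap (v - y), one_le_jap v, one_le_jap (v - y)]

/-! ### Assumptions on the kernel -/

/-- The standing assumptions on the collision kernel; `β` bounds the angular factor. -/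
structure KernelHyp (γ s : ℝ) (b : ℝ → ℝ) (β : ℝ) : Prop where
  neg_three_lt : -3 < γ
  nonpos : γ ≤ 0
  s_pos : 0 < s
  s_lt : s < 1 / 2
  measurable : Measurable b
  nonneg : ∀ c ∈ Icc (-1 : ℝ) 1, 0 ≤ b c
  le : ∀ c ∈ Icc (-1 : ℝ) 1, b c ≤ β

lemma KernelHyp.beta_nonneg {γ s : ℝ} {b : ℝ → ℝ} {β : ℝ} (h : KernelHyp γ s b β) : 0 ≤ β :=
  (h.nonneg 0 (by norm_num)).trans (h.le 0 (by norm_num))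

/-! ### Integrals with a weight depending on the relative velocity -/

lemma angMean_lt_top {Θ : ℝ → ℝ≥0∞} {c p : ℝ} (hp0 : 0 ≤ p) (hp : p < 2)
    (h : ∀ θ, 0 < θ → θ ≤ Real.pi → Θ θ ≤ ENNReal.ofReal (c * θ ^ (-p))) : angMean Θ < ∞ := by
  have h1 : angMean Θ ≤ ENNReal.ofReal c * angMean (fun θ => ENNReal.ofReal (θ ^ (-p))) := by
    rw [← angMean_const_mul _ (by fun_prop)]
    refine lintegral_mono_ae ?_
    filter_upwards [ae_angle_ne (Or.inl rfl)] with ω hω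
    have h0 := InnerProductGeometry.angle_nonneg e0 (ω : E3)
    refine (h _ (lt_of_le_of_ne h0 hω.symm) (InnerProductGeometry.angle_le_pi _ _)).trans ?_
    rw [ENNReal.ofReal_mul' (by positivity)]
  exact h1.trans_lt (ENNReal.mul_lt_top ENNReal.ofReal_lt_top (angMean_rpow_lt_top hp0 hp))

/-- From a lower Lebesgue integral with product structure to a Bochner integral. -/
lemma integrable_of_lintegral_eq {q l : ℝ} {t : ℝ → ℝ} (ht : Measurable t)
    (ht0 : ∀ θ, 0 ≤ θ → θ ≤ Real.pi → 0 ≤ t θ) {τ : E3 × S2 → E3} (hτ : Measurable τ)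
    (hq : -3 < q) (hl : 3 + q < l) {Ψ : ℝ → ℝ≥0∞} (hΨ : angMean Ψ < ∞)
    (h : ∀ G : E3 → ℝ≥0∞, Measurable G → ∫⁻ p : E3 × S2, ENNReal.ofReal (‖p.1‖ ^ q) *
        ENNReal.ofReal (t (angle p.1 (p.2 : E3))) * G (τ p) ∂pairMeas
      = angMean Ψ * ∫⁻ u : E3, ENNReal.ofReal (‖u‖ ^ q) * G u) :
    ∃ C : ℝ, 0 ≤ C ∧ ∀ v : E3,
      Integrable (fun p : E3 × S2 => ‖p.1‖ ^ q * t (angle p.1 (p.2 : E3)) * jap (v - τ p) ^ (-l))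
        pairMeas ∧
      ∫ p : E3 × S2, ‖p.1‖ ^ q * t (angle p.1 (p.2 : E3)) * jap (v - τ p) ^ (-l) ∂pairMeas
        ≤ C * jap v ^ (max q 0) := by
  obtain ⟨C, hC0, hC⟩ := lintegral_norm_rpow_jap_le hq hl
  refine ⟨(angMean Ψ).toReal * C, by positivity, fun v => ?_⟩
  have hm : Measurable fun p : E3 × S2 =>
      ‖p.1‖ ^ q * t (angle p.1 (p.2 : E3)) * jap (v - τ p) ^ (-l) :=
    ((by fun_prop : Measurable fun p : E3 × S2 => ‖p.1‖ ^ q).mul (ht.comp measurable_angle)).mul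
      (by fun_prop)
  have hn : ∀ p : E3 × S2, 0 ≤ ‖p.1‖ ^ q * t (angle p.1 (p.2 : E3)) * jap (v - τ p) ^ (-l) := fun p =>
    mul_nonneg (mul_nonneg (by positivity) (ht0 _ (InnerProductGeometry.angle_nonneg _ _)
      (InnerProductGeometry.angle_le_pi _ _))) (jap_rpow_pos _ _).le
  have h1 : ∫⁻ p : E3 × S2, ENNReal.ofReal
      (‖p.1‖ ^ q * t (angle p.1 (p.2 : E3)) * jap (v - τ p) ^ (-l)) ∂pairMeas
      ≤ ENNReal.ofReal ((angMean Ψ).toReal * C * jap v ^ (max q 0)) := by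
    have h2 := h (fun u => ENNReal.ofReal (jap (v - u) ^ (-l))) (by fun_prop)
    rw [mul_assoc, ENNReal.ofReal_mul ENNReal.toReal_nonneg, ENNReal.ofReal_toReal hΨ.ne]
    refine le_trans (le_of_eq ?_) (mul_le_mul_right (hC v) _)
    rw [← h2]
    refine lintegral_congr fun p => ?_
    rw [ENNReal.ofReal_mul' (jap_rpow_pos _ _).le, ENNReal.ofReal_mul (by positivity)]
  constructor
  · refine ⟨hm.aestronglyMeasurable, ?_⟩
    rw [hasFiniteIntegral_iff_ofReal (Eventually.of_forall hn)]
    exact h1.trans_lt ENNReal.ofReal_lt_top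
  · rw [integral_eq_lintegral_of_nonneg_ae (Eventually.of_forall hn) hm.aestronglyMeasurable]
    refine ENNReal.toReal_le_of_le_ofReal ?_ h1
    exact mul_nonneg (by positivity) (jap_rpow_pos _ _).le

/-- Kernel integrals against a decaying function of `v_*'`.  The angular singularity `p < 2` is
measured after the change of variables, whose Jacobian is `cos(θ/2)^{-q-3}`. -/
lemma integral_halfSum_le {q l : ℝ} {t : ℝ → ℝ} (ht : Measurable t)
    (ht0 : ∀ θ, 0 ≤ θ → θ ≤ Real.pi → 0 ≤ t θ) (hq : -3 < q) (hl : 3 + q < l)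
    {c p : ℝ} (hp0 : 0 ≤ p) (hp : p < 2)
    (h : ∀ θ, 0 < θ → θ ≤ Real.pi → Real.cos (θ / 2) ^ (-q - 3) * t θ ≤ c * θ ^ (-p)) :
    ∃ C : ℝ, 0 ≤ C ∧ ∀ v : E3,
      Integrable (fun p : E3 × S2 =>
        ‖p.1‖ ^ q * t (angle p.1 (p.2 : E3)) * jap (v - halfSum p.1 p.2) ^ (-l)) pairMeas ∧
      ∫ p : E3 × S2, ‖p.1‖ ^ q * t (angle p.1 (p.2 : E3)) * jap (v - halfSum p.1 p.2) ^ (-l) ∂pairMeas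
        ≤ C * jap v ^ (max q 0) := by
  refine integrable_of_lintegral_eq ht ht0 continuous_halfSum.measurable hq hl ?_
    (fun G hG => lintegral_halfSum q (Θ := fun θ => ENNReal.ofReal (t θ)) (by fun_prop) hG)
  refine angMean_lt_top (c := c) hp0 hp fun θ h1 h2 => ?_
  rw [← ENNReal.ofReal_mul' (ht0 _ h1.le h2)]
  exact ENNReal.ofReal_le_ofReal (h θ h1 h2)

/-- Kernel integrals against a decaying function of `v'`.  The Jacobian `sin(θ/2)^{-q-3}` of the
change of variables is singular at grazing angles and has to be compensated by `t`. -/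
lemma integral_halfDiff_le {q l : ℝ} {t : ℝ → ℝ} (ht : Measurable t)
    (ht0 : ∀ θ, 0 ≤ θ → θ ≤ Real.pi → 0 ≤ t θ) (hq : -3 < q) (hl : 3 + q < l)
    {c p : ℝ} (hp0 : 0 ≤ p) (hp : p < 2)
    (h : ∀ θ, 0 < θ → θ ≤ Real.pi → Real.sin (θ / 2) ^ (-q - 3) * t θ ≤ c * θ ^ (-p)) :
    ∃ C : ℝ, 0 ≤ C ∧ ∀ v : E3,
      Integrable (fun p : E3 × S2 =>
        ‖p.1‖ ^ q * t (angle p.1 (p.2 : E3)) * jap (v - halfDiff p.1 p.2) ^ (-l)) pairMeas ∧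
      ∫ p : E3 × S2, ‖p.1‖ ^ q * t (angle p.1 (p.2 : E3)) * jap (v - halfDiff p.1 p.2) ^ (-l) ∂pairMeas
        ≤ C * jap v ^ (max q 0) := by
  refine integrable_of_lintegral_eq ht ht0 continuous_halfDiff.measurable hq hl ?_
    (fun G hG => lintegral_halfDiff q (Θ := fun θ => ENNReal.ofReal (t θ)) (by fun_prop) hG)
  refine angMean_lt_top (c := c) hp0 hp fun θ h1 h2 => ?_
  rw [← ENNReal.ofReal_mul' (ht0 _ h1.le h2)]
  exact ENNReal.ofReal_le_ofReal (h θ h1 h2)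

/-- Kernel integrals against a decaying function of `v_*`. -/
lemma integral_self_le {q l : ℝ} {t : ℝ → ℝ} (ht : Measurable t)
    (ht0 : ∀ θ, 0 ≤ θ → θ ≤ Real.pi → 0 ≤ t θ) (hq : -3 < q) (hl : 3 + q < l)
    {c p : ℝ} (hp0 : 0 ≤ p) (hp : p < 2)
    (h : ∀ θ, 0 < θ → θ ≤ Real.pi → t θ ≤ c * θ ^ (-p)) :
    ∃ C : ℝ, 0 ≤ C ∧ ∀ v : E3,
      Integrable (fun p : E3 × S2 =>
        ‖p.1‖ ^ q * t (angle p.1 (p.2 : E3)) * jap (v - p.1) ^ (-l)) pairMeas ∧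
      ∫ p : E3 × S2, ‖p.1‖ ^ q * t (angle p.1 (p.2 : E3)) * jap (v - p.1) ^ (-l) ∂pairMeas
        ≤ C * jap v ^ (max q 0) := by
  refine integrable_of_lintegral_eq (τ := fun p => p.1) ht ht0 measurable_fst hq hl ?_
    (fun G hG => lintegral_norm_angle_self q (Θ := fun θ => ENNReal.ofReal (t θ)) (by fun_prop) hG)
  exact angMean_lt_top (c := c) hp0 hp fun θ h1 h2 => ENNReal.ofReal_le_ofReal (h θ h1 h2)

/-! ### Geometry of a collision -/

lemma sin_half_nonneg (u : E3) (ω : S2) : 0 ≤ Real.sin (angle u (ω : E3) / 2) :=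
  Real.sin_nonneg_of_nonneg_of_le_pi (by linarith [InnerProductGeometry.angle_nonneg u (ω : E3)])
    (by linarith [InnerProductGeometry.angle_nonneg u (ω : E3),
      InnerProductGeometry.angle_le_pi u (ω : E3)])

lemma cos_half_nonneg (u : E3) (ω : S2) : 0 ≤ Real.cos (angle u (ω : E3) / 2) :=
  Real.cos_nonneg_of_mem_Icc ⟨by linarith [InnerProductGeometry.angle_nonneg u (ω : E3), Real.pi_pos],
    by linarith [InnerProductGeometry.angle_le_pi u (ω : E3)]⟩

lemma norm_halfDiff_le (u : E3) (ω : S2) : ‖halfDiff u ω‖ ≤ ‖u‖ * angle u (ω : E3) := by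
  rw [norm_halfDiff]
  gcongr
  have h := InnerProductGeometry.angle_nonneg u (ω : E3)
  exact (Real.sin_le (by linarith)).trans (by linarith)

/-- Conservation of energy. -/
lemma energy_identity (v u : E3) (ω : S2) :
    jap (v - halfDiff u ω) ^ 2 + jap (v - halfSum u ω) ^ 2 = jap v ^ 2 + jap (v - u) ^ 2 := by
  have h1 : ‖halfSum u ω‖ ^ 2 + ‖halfDiff u ω‖ ^ 2 = ‖u‖ ^ 2 := by
    rw [norm_halfSum, norm_halfDiff, mul_pow, mul_pow, ← mul_add, Real.cos_sq_add_sin_sq, mul_one]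
  have h2 : inner ℝ v (halfSum u ω) + inner ℝ v (halfDiff u ω) = inner ℝ v u := by
    rw [← inner_add_right, halfSum_add_halfDiff]
  simp only [sq_jap, norm_sub_sq_real]
  linarith

/-- If one outgoing velocity `w₁` is much smaller than `v`, the other one carries the energy. -/
lemma jap_le_of_far {v vs w₁ w₂ : E3} {x : ℝ} (hx : 0 ≤ x)
    (hE : jap w₁ ^ 2 + jap w₂ ^ 2 = jap v ^ 2 + jap vs ^ 2)
    (hd : ‖v - w₁‖ = ‖v - vs‖ * x) (hfar : 4 * jap w₁ < jap v) : jap v ≤ 3 * x * jap w₂ := by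
  have h1 := jap_le_add v w₁
  have h2 : 3 * jap v ≤ 4 * (‖v - vs‖ * x) := by rw [← hd]; linarith
  have h3 : ‖v - vs‖ ^ 2 ≤ 2 * (‖v‖ ^ 2 + ‖vs‖ ^ 2) := by
    have := parallelogram_law_with_norm ℝ v vs
    nlinarith [norm_nonneg (v + vs), sq_nonneg ‖v + vs‖]
  have h4 : 16 * jap w₁ ^ 2 ≤ jap v ^ 2 := by nlinarith [jap_pos w₁]
  have h5 : ‖v - vs‖ ≤ 2 * jap w₂ := by
    refine abs_le_of_sq_le_sq' ?_ (by linarith [jap_pos w₂]) |>.2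
    nlinarith [sq_jap v, sq_jap vs, sq_jap w₁]
  have h6 := mul_le_mul_of_nonneg_right h5 hx
  nlinarith [jap_pos w₂, mul_nonneg hx (jap_pos w₂).le]

lemma sub_sub_halfSum (u : E3) (ω : E3) (v : E3) : (v - halfSum u ω) - (v - u) = halfDiff u ω := by
  nth_rewrite 2 [← halfSum_add_halfDiff u ω]; abel

lemma half_le_cos {θ : ℝ} (h0 : 0 ≤ θ) (h : θ ≤ Real.pi / 2) : 1 / 2 ≤ Real.cos (θ / 2) := by
  rw [← Real.cos_pi_div_three]
  exact Real.cos_le_cos_of_nonneg_of_le_pi (by linarith) (by linarith [Real.pi_pos])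
    (by linarith [Real.pi_pos])

lemma half_le_sin {θ : ℝ} (h0 : Real.pi / 2 ≤ θ) (h : θ ≤ Real.pi) : 1 / 2 ≤ Real.sin (θ / 2) := by
  rw [← Real.cos_pi_div_two_sub, ← Real.cos_pi_div_three]
  exact Real.cos_le_cos_of_nonneg_of_le_pi (by linarith) (by linarith [Real.pi_pos])
    (by linarith [Real.pi_pos])

/-! ### The kernel and the integrand -/

/-- The integrand of the collision operator in the variables `u = v - v_*` and `ω`. -/
def collInt (γ s : ℝ) (b : ℝ → ℝ) (G H : E3 → ℝ) (v : E3) (p : E3 × S2) : ℝ :=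
  kernelB γ s b p.1 p.2 *
    (G (v - halfSum p.1 p.2) * H (v - halfDiff p.1 p.2) - G (v - p.1) * H v)

lemma collisionQ_eq (γ s : ℝ) (b : ℝ → ℝ) (G H : E3 → ℝ) (v : E3) :
    collisionQ γ s b G H v = ∫ p, collInt γ s b G H v p ∂pairMeas := by
  have h1 : MeasurePreserving (fun p : E3 × S2 => (v - p.1, p.2)) pairMeas pairMeas :=
    (Measure.measurePreserving_sub_left volume v).prod (MeasurePreserving.id sphMeas)
  have h2 : MeasurableEmbedding (fun p : E3 × S2 => (v - p.1, p.2)) :=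
    ((Homeomorph.subLeft v).prodCongr (Homeomorph.refl S2)).measurableEmbedding
  unfold collisionQ
  rw [← h1.integral_comp h2]
  refine integral_congr_ae (Eventually.of_forall fun p => ?_)
  have h3 : postVs v (v - p.1) p.2 = v - halfSum p.1 p.2 := by
    simp only [postVs, halfSum, sub_sub_cancel]; module
  have h4 : postV v (v - p.1) p.2 = v - halfDiff p.1 p.2 := by
    simp only [postV, halfDiff, sub_sub_cancel]; module
  simp only [collInt, h3, h4, sub_sub_cancel]

lemma measurable_kernelB {γ s : ℝ} {b : ℝ → ℝ} (hb : Measurable b) :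
    Measurable fun p : E3 × S2 => kernelB γ s b p.1 p.2 := by
  unfold kernelB
  have h := measurable_angle
  exact ((by fun_prop : Measurable fun p : E3 × S2 => ‖p.1‖ ^ γ).mul (h.pow_const _)).mul
    (hb.comp (Real.measurable_cos.comp h))

lemma KernelHyp.kernelB_nonneg {γ s : ℝ} {b : ℝ → ℝ} {β : ℝ} (h : KernelHyp γ s b β) (u ω : E3) :
    0 ≤ kernelB γ s b u ω :=
  mul_nonneg (mul_nonneg (by positivity)
    (Real.rpow_nonneg (InnerProductGeometry.angle_nonneg _ _) _))
    (h.nonneg _ ⟨Real.neg_one_le_cos _, Real.cos_le_one _⟩)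

lemma KernelHyp.kernelB_le {γ s : ℝ} {b : ℝ → ℝ} {β : ℝ} (h : KernelHyp γ s b β) (u ω : E3) :
    kernelB γ s b u ω ≤ β * (‖u‖ ^ γ * angle u ω ^ (-2 - 2 * s)) := by
  rw [mul_comm β]
  exact mul_le_mul_of_nonneg_left (h.le _ ⟨Real.neg_one_le_cos _, Real.cos_le_one _⟩)
    (mul_nonneg (by positivity) (Real.rpow_nonneg (InnerProductGeometry.angle_nonneg _ _) _))

/-! ### Cancellation -/

lemma abs_rpow_neg_sub_le {x y z m : ℝ} (hz : 0 < z) (hx : z ≤ x) (hy : z ≤ y) (hm : 0 ≤ m) :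
    |x ^ (-m) - y ^ (-m)| ≤ m * z ^ (-m - 1) * |x - y| := by
  have h := Convex.norm_image_sub_le_of_norm_hasDerivWithin_le (f := fun t : ℝ => t ^ (-m))
    (f' := fun t => -m * t ^ (-m - 1)) (s := Ici z) (C := m * z ^ (-m - 1)) (x := y) (y := x)
    (fun t ht => (Real.hasDerivAt_rpow_const (Or.inl (hz.trans_le ht).ne')).hasDerivWithinAt)
    (fun t ht => by
      have ht' : z ≤ t := ht
      rw [norm_mul, norm_neg, Real.norm_of_nonneg hm,
        Real.norm_of_nonneg (Real.rpow_nonneg (hz.le.trans ht') _)]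
      exact mul_le_mul_of_nonneg_left (Real.rpow_le_rpow_of_nonpos hz ht' (by linarith)) hm)
    (convex_Ici z) hy hx
  simpa [Real.norm_eq_abs] using h

/-- The angular factor of the kernel, restricted to `κ < θ < π / 2`. -/
def truncAng (s : ℝ) (b : ℝ → ℝ) (κ θ : ℝ) : ℝ :=
  if κ < θ ∧ θ < Real.pi / 2 then θ ^ (-2 - 2 * s) * b (Real.cos θ) else 0

lemma measurable_truncAng {s : ℝ} {b : ℝ → ℝ} (hb : Measurable b) (κ : ℝ) :
    Measurable (truncAng s b κ) := by
  refine Measurable.ite ?_ (by fun_prop) measurable_const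
  exact measurableSet_Ioo (a := κ) (b := Real.pi / 2)

section
variable {γ s : ℝ} {b : ℝ → ℝ} {β : ℝ}

lemma truncAng_nonneg (h : KernelHyp γ s b β) (κ : ℝ) {θ : ℝ} (hθ : 0 ≤ θ) : 0 ≤ truncAng s b κ θ := by
  unfold truncAng
  split_ifs
  · exact mul_nonneg (by positivity) (h.nonneg _ ⟨Real.neg_one_le_cos _, Real.cos_le_one _⟩)
  · exact le_rfl

lemma truncAng_le (h : KernelHyp γ s b β) (κ : ℝ) {θ : ℝ} (hθ : 0 ≤ θ) :
    truncAng s b κ θ ≤ θ ^ (-2 - 2 * s) * β := by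
  unfold truncAng
  split_ifs
  · exact mul_le_mul_of_nonneg_left (h.le _ ⟨Real.neg_one_le_cos _, Real.cos_le_one _⟩) (by positivity)
  · exact mul_nonneg (by positivity) h.beta_nonneg

lemma truncAng_le_const (h : KernelHyp γ s b β) {κ : ℝ} (hκ : 0 < κ) (θ : ℝ) :
    truncAng s b κ θ ≤ κ ^ (-2 - 2 * s) * β := by
  unfold truncAng
  have hs := h.s_pos
  split_ifs with h1
  · exact mul_le_mul (Real.rpow_le_rpow_of_nonpos hκ h1.1.le (by linarith))
      (h.le _ ⟨Real.neg_one_le_cos _, Real.cos_le_one _⟩)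
      (h.nonneg _ ⟨Real.neg_one_le_cos _, Real.cos_le_one _⟩) (by positivity)
  · exact mul_nonneg (by positivity) h.beta_nonneg

lemma cos_rpow_le {r θ : ℝ} (hr : 0 ≤ r) (h0 : 0 ≤ θ) (h : θ ≤ Real.pi / 2) :
    Real.cos (θ / 2) ^ (-r) ≤ 2 ^ r := by
  have h1 := half_le_cos h0 h
  calc Real.cos (θ / 2) ^ (-r) ≤ (1 / 2 : ℝ) ^ (-r) :=
        Real.rpow_le_rpow_of_nonpos (by norm_num) h1 (by linarith)
    _ = 2 ^ r := by rw [one_div, Real.inv_rpow (by norm_num), Real.rpow_neg (by norm_num), inv_inv]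

lemma sin_rpow_le {r θ : ℝ} (hr : 0 ≤ r) (h0 : Real.pi / 2 ≤ θ) (h : θ ≤ Real.pi) :
    Real.sin (θ / 2) ^ (-r) ≤ 2 ^ r := by
  have h1 := half_le_sin h0 h
  calc Real.sin (θ / 2) ^ (-r) ≤ (1 / 2 : ℝ) ^ (-r) :=
        Real.rpow_le_rpow_of_nonpos (by norm_num) h1 (by linarith)
    _ = 2 ^ r := by rw [one_div, Real.inv_rpow (by norm_num), Real.rpow_neg (by norm_num), inv_inv]

lemma cos_rpow_sub_one_le {r θ : ℝ} (hr : 0 ≤ r) (h0 : 0 ≤ θ) (h : θ ≤ Real.pi / 2) :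
    Real.cos (θ / 2) ^ (-r) - 1 ≤ r * (1 / 2) ^ (-r - 1) * θ := by
  have h1 := abs_rpow_neg_sub_le (x := Real.cos (θ / 2)) (y := 1) (z := 1 / 2) (by norm_num)
    (half_le_cos h0 h) (by norm_num) hr
  rw [Real.one_rpow] at h1
  refine (le_abs_self _).trans (h1.trans ?_)
  refine mul_le_mul_of_nonneg_left ?_ (by positivity)
  rw [abs_sub_comm, abs_of_nonneg (by linarith [Real.cos_le_one (θ / 2)])]
  have h2 := Real.one_sub_sq_div_two_le_cos (x := θ / 2)
  nlinarith [Real.pi_le_four]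

/-- The cancellation lemma for a truncated kernel and a nonnegative function: after the change of
variables `v_* ↦ v_*'` only the angular factor `cos (θ/2) ^ (-γ-3) - 1 = O(θ)` survives. -/
lemma cancellation_nonneg (h : KernelHyp γ s b β) {l : ℝ} (hl : 3 + γ < l) :
    ∃ C : ℝ, 0 ≤ C ∧ ∀ (F : E3 → ℝ) (A κ : ℝ) (v : E3), 0 ≤ A → 0 < κ → Continuous F → (∀ w, 0 ≤ F w) →
      (∀ w, F w ≤ A * jap w ^ (-l)) →
      Integrable (fun p : E3 × S2 =>
        ‖p.1‖ ^ γ * truncAng s b κ (angle p.1 (p.2 : E3)) * F (v - halfSum p.1 p.2)) pairMeas ∧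
      Integrable (fun p : E3 × S2 =>
        ‖p.1‖ ^ γ * truncAng s b κ (angle p.1 (p.2 : E3)) * F (v - p.1)) pairMeas ∧
      |∫ p : E3 × S2, ‖p.1‖ ^ γ * truncAng s b κ (angle p.1 (p.2 : E3)) *
          F (v - halfSum p.1 p.2) ∂pairMeas
        - ∫ p : E3 × S2, ‖p.1‖ ^ γ * truncAng s b κ (angle p.1 (p.2 : E3)) * F (v - p.1) ∂pairMeas|
        ≤ C * A := by
  have hγ := h.neg_three_lt
  have hγ0 := h.nonpos
  have hs := h.s_pos
  have hs' := h.s_lt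
  have hβ := h.beta_nonneg
  obtain ⟨CP, hCP0, hCP⟩ := lintegral_norm_rpow_jap_le hγ hl
  set c1 : ℝ := (γ + 3) * (1 / 2) ^ (-(γ + 3) - 1) * β with hc1
  set D : ℝ → ℝ≥0∞ := fun θ => ENNReal.ofReal (c1 * θ ^ (-(1 + 2 * s))) with hD
  have hDm : Measurable D := by fun_prop
  have hDfin : angMean D < ∞ := angMean_lt_top (c := c1) (p := 1 + 2 * s) (by linarith) (by linarith)
    (fun θ _ _ => le_rfl)
  refine ⟨(angMean D).toReal * CP, by positivity, fun F A κ v hA hκ hFc hF0 hF => ?_⟩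
  have htm := measurable_truncAng (s := s) h.measurable κ
  have ht0 : ∀ θ, 0 ≤ θ → θ ≤ Real.pi → 0 ≤ truncAng s b κ θ := fun θ h1 _ => truncAng_nonneg h κ h1
  have hn : ∀ p : E3 × S2, 0 ≤ ‖p.1‖ ^ γ * truncAng s b κ (angle p.1 (p.2 : E3)) := fun p =>
    mul_nonneg (by positivity) (truncAng_nonneg h κ (InnerProductGeometry.angle_nonneg _ _))
  have hpm : Measurable fun p : E3 × S2 => ‖p.1‖ ^ γ * truncAng s b κ (angle p.1 (p.2 : E3)) :=
    (by fun_prop : Measurable fun p : E3 × S2 => ‖p.1‖ ^ γ).mul (htm.comp measurable_angle)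
  -- the angular integrals are finite for the truncated kernel
  have hcosb : ∀ θ, 0 < θ → θ ≤ Real.pi →
      Real.cos (θ / 2) ^ (-γ - 3) * truncAng s b κ θ ≤ (2 ^ (γ + 3) * (κ ^ (-2 - 2 * s) * β)) * θ ^ (-(0:ℝ)) := by
    intro θ h1 h2
    rw [neg_zero, Real.rpow_zero, mul_one]
    by_cases h3 : θ ≤ Real.pi / 2
    · refine mul_le_mul ?_ (truncAng_le_const h hκ θ) (ht0 _ h1.le h2) (by positivity)
      rw [show -γ - 3 = -(γ + 3) by ring]
      exact cos_rpow_le (by linarith) h1.le h3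
    · rw [truncAng, if_neg (by intro h4; exact h3 h4.2.le), mul_zero]
      positivity
  have hself : ∀ θ, 0 < θ → θ ≤ Real.pi → truncAng s b κ θ ≤ (κ ^ (-2 - 2 * s) * β) * θ ^ (-(0:ℝ)) := by
    intro θ _ _
    rw [neg_zero, Real.rpow_zero, mul_one]
    exact truncAng_le_const h hκ θ
  obtain ⟨_, -, hi1⟩ := integral_halfSum_le htm ht0 hγ hl le_rfl two_pos hcosb
  obtain ⟨_, -, hi2⟩ := integral_self_le htm ht0 hγ hl le_rfl two_pos hself
  have hm1 : Measurable fun p : E3 × S2 =>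
      ‖p.1‖ ^ γ * truncAng s b κ (angle p.1 (p.2 : E3)) * F (v - halfSum p.1 p.2) :=
    hpm.mul (hFc.measurable.comp (measurable_const.sub continuous_halfSum.measurable))
  have hm2 : Measurable fun p : E3 × S2 =>
      ‖p.1‖ ^ γ * truncAng s b κ (angle p.1 (p.2 : E3)) * F (v - p.1) :=
    hpm.mul (hFc.measurable.comp (measurable_const.sub measurable_fst))
  have hI1 : Integrable (fun p : E3 × S2 =>
      ‖p.1‖ ^ γ * truncAng s b κ (angle p.1 (p.2 : E3)) * F (v - halfSum p.1 p.2)) pairMeas := by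
    refine ((hi1 v).1.const_mul A).mono' hm1.aestronglyMeasurable (Eventually.of_forall fun p => ?_)
    rw [Real.norm_of_nonneg (mul_nonneg (hn p) (hF0 _)), mul_left_comm]
    exact mul_le_mul_of_nonneg_left (hF _) (hn p)
  have hI2 : Integrable (fun p : E3 × S2 =>
      ‖p.1‖ ^ γ * truncAng s b κ (angle p.1 (p.2 : E3)) * F (v - p.1)) pairMeas := by
    refine ((hi2 v).1.const_mul A).mono' hm2.aestronglyMeasurable (Eventually.of_forall fun p => ?_)
    rw [Real.norm_of_nonneg (mul_nonneg (hn p) (hF0 _)), mul_left_comm]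
    exact mul_le_mul_of_nonneg_left (hF _) (hn p)
  refine ⟨hI1, hI2, ?_⟩
  set X : ℝ≥0∞ := ∫⁻ u : E3, ENNReal.ofReal (‖u‖ ^ γ) * ENNReal.ofReal (F (v - u)) with hX
  have hXle : X ≤ ENNReal.ofReal (A * CP) := by
    have h1 : X ≤ ENNReal.ofReal A *
        ∫⁻ y : E3, ENNReal.ofReal (‖y‖ ^ γ) * ENNReal.ofReal (jap (v - y) ^ (-l)) := by
      rw [← lintegral_const_mul _ (by fun_prop)]
      refine lintegral_mono fun u => ?_
      rw [mul_left_comm, ← ENNReal.ofReal_mul hA]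
      exact mul_le_mul_right (ENNReal.ofReal_le_ofReal (hF _)) _
    refine h1.trans ?_
    rw [ENNReal.ofReal_mul hA]
    refine mul_le_mul_right ((hCP v).trans ?_) _
    rw [max_eq_right hγ0, Real.rpow_zero, mul_one]
  set a1 := angMean (fun θ => ENNReal.ofReal (Real.cos (θ / 2) ^ (-γ - 3)) *
    ENNReal.ofReal (truncAng s b κ θ)) with ha1
  set a0 := angMean (fun θ => ENNReal.ofReal (truncAng s b κ θ)) with ha0
  have ha1fin : a1 < ∞ := angMean_lt_top le_rfl two_pos fun θ h1 h2 => by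
    rw [← ENNReal.ofReal_mul' (ht0 _ h1.le h2)]
    exact ENNReal.ofReal_le_ofReal (hcosb θ h1 h2)
  have ha0fin : a0 < ∞ := angMean_lt_top le_rfl two_pos fun θ h1 h2 =>
    ENNReal.ofReal_le_ofReal (hself θ h1 h2)
  have h01 : a0 ≤ a1 := angMean_mono fun θ h1 h2 => by
    by_cases h3 : θ < Real.pi / 2
    · refine le_mul_of_one_le_left' ?_
      rw [ENNReal.one_le_ofReal]
      have hc := half_le_cos h1 h3.le
      exact Real.one_le_rpow_of_pos_of_le_one_of_nonpos (by linarith) (Real.cos_le_one _) (by linarith)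
    · rw [truncAng, if_neg (fun h4 => h3 h4.2)]; simp
  have h10 : a1 ≤ a0 + angMean D := by
    have hadd : a0 + angMean D = angMean (fun θ => ENNReal.ofReal (truncAng s b κ θ) + D θ) :=
      (lintegral_add_right _ (hDm.comp (measurable_angle_right e0))).symm
    rw [hadd]
    refine angMean_mono fun θ h1 h2 => ?_
    have hpos : 0 ≤ c1 * θ ^ (-(1 + 2 * s)) := by
      have : 0 ≤ γ + 3 := by linarith
      positivity
    rw [← ENNReal.ofReal_mul' (ht0 _ h1 h2), hD, ← ENNReal.ofReal_add (ht0 _ h1 h2) hpos]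
    apply ENNReal.ofReal_le_ofReal
    by_cases h3 : θ < Real.pi / 2
    · rw [← sub_le_iff_le_add', ← sub_one_mul]
      have h4 := cos_rpow_sub_one_le (r := γ + 3) (by linarith) h1 h3.le
      rw [show -γ - 3 = -(γ + 3) by ring]
      rcases h1.eq_or_lt with h5 | h5
      · rw [← h5]; simp
        exact mul_nonneg (by rw [hc1]; have : 0 ≤ γ + 3 := by linarith
                             positivity) (Real.rpow_nonneg le_rfl _)
      calc (Real.cos (θ / 2) ^ (-(γ + 3)) - 1) * truncAng s b κ θ
          ≤ ((γ + 3) * (1 / 2) ^ (-(γ + 3) - 1) * θ) * (θ ^ (-2 - 2 * s) * β) :=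
            mul_le_mul h4 (truncAng_le h κ h1) (ht0 _ h1 h2)
              (by have : 0 ≤ γ + 3 := by linarith
                  positivity)
        _ = c1 * (θ ^ (1 : ℝ) * θ ^ (-2 - 2 * s)) := by rw [hc1, Real.rpow_one]; ring
        _ = _ := by rw [← Real.rpow_add h5]; congr 2; ring
    · rw [truncAng, if_neg (fun h4 => h3 h4.2)]; simpa using hpos
  have e1 : ∫ p : E3 × S2, ‖p.1‖ ^ γ * truncAng s b κ (angle p.1 (p.2 : E3)) *
      F (v - halfSum p.1 p.2) ∂pairMeas = a1.toReal * X.toReal := by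
    rw [integral_eq_lintegral_of_nonneg_ae (Eventually.of_forall fun p => mul_nonneg (hn p) (hF0 _))
      hm1.aestronglyMeasurable, ← ENNReal.toReal_mul, ha1, hX,
      ← lintegral_halfSum γ (Θ := fun θ => ENNReal.ofReal (truncAng s b κ θ)) (by fun_prop)
        (G := fun u => ENNReal.ofReal (F (v - u))) (by fun_prop)]
    congr 1
    refine lintegral_congr fun p => ?_
    rw [ENNReal.ofReal_mul (hn p), ENNReal.ofReal_mul (by positivity)]
  have e2 : ∫ p : E3 × S2, ‖p.1‖ ^ γ * truncAng s b κ (angle p.1 (p.2 : E3)) *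
      F (v - p.1) ∂pairMeas = a0.toReal * X.toReal := by
    rw [integral_eq_lintegral_of_nonneg_ae (Eventually.of_forall fun p => mul_nonneg (hn p) (hF0 _))
      hm2.aestronglyMeasurable, ← ENNReal.toReal_mul, ha0, hX,
      ← lintegral_norm_angle_self γ (Θ := fun θ => ENNReal.ofReal (truncAng s b κ θ)) (by fun_prop)
        (G := fun u => ENNReal.ofReal (F (v - u))) (by fun_prop)]
    congr 1
    refine lintegral_congr fun p => ?_
    rw [ENNReal.ofReal_mul (hn p), ENNReal.ofReal_mul (by positivity)]
  have hx : X.toReal ≤ A * CP := ENNReal.toReal_le_of_le_ofReal (by positivity) hXle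
  have h01' := ENNReal.toReal_mono ha1fin.ne h01
  have h10' := ENNReal.toReal_mono (ENNReal.add_lt_top.2 ⟨ha0fin, hDfin⟩).ne h10
  rw [ENNReal.toReal_add ha0fin.ne hDfin.ne] at h10'
  rw [e1, e2, ← sub_mul, abs_of_nonneg (mul_nonneg (by linarith) ENNReal.toReal_nonneg)]
  calc (a1.toReal - a0.toReal) * X.toReal ≤ (angMean D).toReal * (A * CP) :=
        mul_le_mul (by linarith) hx ENNReal.toReal_nonneg ENNReal.toReal_nonneg
    _ = _ := by ring

/-- The cancellation lemma: `∫ B (G(v_*') - G(v_*))` over grazing angles is bounded by the size of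
`G` only; the Hölder regularity of `G` serves merely to make the integral converge. -/
lemma cancellation (h : KernelHyp γ s b β) {l l' a : ℝ} (ha : 2 * s < a) (ha1 : a < 1)
    (hl : 3 + γ < l) (hl' : 3 + γ + a < l') :
    ∃ C : ℝ, 0 ≤ C ∧ ∀ (G : E3 → ℝ) (A : ℝ) (v : E3), 0 ≤ A → Continuous G →
      (∀ w, |G w| ≤ A * jap w ^ (-l)) →
      (∃ A' : ℝ, ∀ w z, |G w - G z| ≤ A' * ‖w - z‖ ^ a * (jap w ^ (-l') + jap z ^ (-l'))) →
      Integrable (fun p : E3 × S2 => if angle p.1 (p.2 : E3) < Real.pi / 2 then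
        kernelB γ s b p.1 p.2 * (G (v - halfSum p.1 p.2) - G (v - p.1)) else 0) pairMeas ∧
      |∫ p : E3 × S2, (if angle p.1 (p.2 : E3) < Real.pi / 2 then
        kernelB γ s b p.1 p.2 * (G (v - halfSum p.1 p.2) - G (v - p.1)) else 0) ∂pairMeas| ≤ C * A := by
  have hγ := h.neg_three_lt
  have hs := h.s_pos
  have hs' := h.s_lt
  have hβ := h.beta_nonneg
  obtain ⟨C0, hC0, hC⟩ := cancellation_nonneg h hl
  -- convergence of the untruncated integral
  set t : ℝ → ℝ := fun θ => if θ < Real.pi / 2 then θ ^ (a - 2 - 2 * s) else 0 with ht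
  have htm : Measurable t := Measurable.ite measurableSet_Iio (by fun_prop) measurable_const
  have ht0 : ∀ θ, 0 ≤ θ → θ ≤ Real.pi → 0 ≤ t θ := fun θ h1 _ => by
    simp only [ht]; split_ifs
    · positivity
    · exact le_rfl
  have htle : ∀ θ, 0 < θ → t θ ≤ θ ^ (-(2 + 2 * s - a)) := fun θ h1 => by
    simp only [ht]; split_ifs
    · exact le_of_eq (by congr 1; ring)
    · positivity
  obtain ⟨_, -, hi1⟩ := integral_halfSum_le (q := γ + a) (l := l') (c := 2 ^ (γ + a + 3))
    (p := 2 + 2 * s - a) htm ht0 (by linarith) (by linarith) (by linarith) (by linarith)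
    (fun θ h1 h2 => by
      by_cases h3 : θ < Real.pi / 2
      · refine mul_le_mul ?_ (htle θ h1) (ht0 _ h1.le h2) (by positivity)
        rw [show -(γ + a) - 3 = -(γ + a + 3) by ring]
        exact cos_rpow_le (by linarith) h1.le h3.le
      · simp only [ht, if_neg h3, mul_zero]; positivity)
  obtain ⟨_, -, hi2⟩ := integral_self_le (q := γ + a) (l := l') (c := 1)
    (p := 2 + 2 * s - a) htm ht0 (by linarith) (by linarith) (by linarith) (by linarith)
    (fun θ h1 h2 => by rw [one_mul]; exact htle θ h1)
  refine ⟨2 * C0, by positivity, fun G A v hA hGc hG ⟨A', hA'⟩ => ?_⟩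
  have hang := measurable_angle
  have hKm : Measurable fun p : E3 × S2 => kernelB γ s b p.1 p.2 := measurable_kernelB h.measurable
  have hGm : Measurable fun p : E3 × S2 => G (v - halfSum p.1 p.2) - G (v - p.1) :=
    (hGc.measurable.comp (measurable_const.sub continuous_halfSum.measurable)).sub
      (hGc.measurable.comp (measurable_const.sub measurable_fst))
  set f : E3 × S2 → ℝ := fun p => if angle p.1 (p.2 : E3) < Real.pi / 2 then
        kernelB γ s b p.1 p.2 * (G (v - halfSum p.1 p.2) - G (v - p.1)) else 0 with hf
  have hfm : Measurable f := Measurable.ite (measurableSet_lt hang measurable_const)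
    (hKm.mul hGm) measurable_const
  have hA'0 : 0 ≤ A' := by
    have h1 := (abs_nonneg _).trans (hA' e0 0)
    have h2 : 0 < ‖e0 - 0‖ ^ a * (jap e0 ^ (-l') + jap 0 ^ (-l')) := by
      simp only [sub_zero, norm_e0, Real.one_rpow, one_mul]
      exact add_pos (jap_rpow_pos _ _) (jap_rpow_pos _ _)
    rw [mul_assoc] at h1
    exact nonneg_of_mul_nonneg_left h1 h2
  set g : E3 × S2 → ℝ := fun p => β * A' *
    (‖p.1‖ ^ (γ + a) * t (angle p.1 (p.2 : E3)) * jap (v - halfSum p.1 p.2) ^ (-l') +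
     ‖p.1‖ ^ (γ + a) * t (angle p.1 (p.2 : E3)) * jap (v - p.1) ^ (-l')) with hg
  have hgI : Integrable g pairMeas := ((hi1 v).1.add (hi2 v).1).const_mul _
  have hu0 : ∀ᵐ p : E3 × S2 ∂pairMeas, p.1 ≠ 0 := by
    have h1 : ∀ᵐ u : E3, u ≠ 0 := by simp [ae_iff]
    exact Measure.quasiMeasurePreserving_fst.ae h1
  have hfg : ∀ᵐ p ∂pairMeas, ‖f p‖ ≤ g p := by
    filter_upwards [hu0] with p hp
    have hθ0 := InnerProductGeometry.angle_nonneg p.1 (p.2 : E3)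
    have hgn : 0 ≤ g p := by
      refine mul_nonneg (by positivity) (add_nonneg ?_ ?_) <;>
      exact mul_nonneg (mul_nonneg (by positivity)
        (ht0 _ hθ0 (InnerProductGeometry.angle_le_pi _ _))) (jap_rpow_pos _ _).le
    simp only [hf]
    split_ifs with h3
    swap
    · simpa using hgn
    rw [norm_mul, Real.norm_of_nonneg (h.kernelB_nonneg _ _), Real.norm_eq_abs]
    rcases hθ0.eq_or_lt with h4 | h4
    · have : kernelB γ s b p.1 p.2 = 0 := by
        rw [kernelB, ← h4, Real.zero_rpow (by linarith)]; ring
      rw [this, zero_mul]; exact hgn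
    have h5 : ‖(v - halfSum p.1 p.2) - (v - p.1)‖ ^ a ≤ ‖p.1‖ ^ a * angle p.1 (p.2 : E3) ^ a := by
      rw [sub_sub_halfSum, ← Real.mul_rpow (norm_nonneg _) hθ0]
      exact Real.rpow_le_rpow (norm_nonneg _) (norm_halfDiff_le _ _) (by linarith)
    have h6 := hA' (v - halfSum p.1 p.2) (v - p.1)
    have hj : 0 ≤ jap (v - halfSum p.1 p.2) ^ (-l') + jap (v - p.1) ^ (-l') :=
      add_nonneg (jap_rpow_pos _ _).le (jap_rpow_pos _ _).le
    calc kernelB γ s b p.1 p.2 * |G (v - halfSum p.1 p.2) - G (v - p.1)|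
        ≤ (β * (‖p.1‖ ^ γ * angle p.1 (p.2 : E3) ^ (-2 - 2 * s))) *
          (A' * (‖p.1‖ ^ a * angle p.1 (p.2 : E3) ^ a) *
            (jap (v - halfSum p.1 p.2) ^ (-l') + jap (v - p.1) ^ (-l'))) := by
          refine mul_le_mul (h.kernelB_le _ _) (h6.trans ?_) (abs_nonneg _) (by positivity)
          gcongr
      _ = β * A' * ((‖p.1‖ ^ γ * ‖p.1‖ ^ a) *
            (angle p.1 (p.2 : E3) ^ (-2 - 2 * s) * angle p.1 (p.2 : E3) ^ a)) *
            (jap (v - halfSum p.1 p.2) ^ (-l') + jap (v - p.1) ^ (-l')) := by ring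
      _ = g p := by
          rw [← Real.rpow_add h4, ← Real.rpow_add (norm_pos_iff.2 hp)]
          simp only [hg, ht, if_pos h3]
          rw [show -2 - 2 * s + a = a - 2 - 2 * s by ring]
          ring
  have hfI : Integrable f pairMeas := hgI.mono' hfm.aestronglyMeasurable hfg
  refine ⟨hfI, ?_⟩
  -- Restrict to `θ > 1/(j+1)`, apply the lemma for nonnegative functions to the positive and the
  -- negative part of `G`, and let `j → ∞`.
  set fj : ℕ → E3 × S2 → ℝ := fun j p =>
    ‖p.1‖ ^ γ * truncAng s b (1 / ((j : ℝ) + 1)) (angle p.1 (p.2 : E3)) *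
      (G (v - halfSum p.1 p.2) - G (v - p.1)) with hfj
  have hfjf : ∀ j p, fj j p = if 1 / ((j : ℝ) + 1) < angle p.1 (p.2 : E3) then f p else 0 := by
    intro j p
    simp only [hfj, hf, truncAng, kernelB]
    split_ifs with h1 h2 h3 h4 h5
    · ring
    · exact absurd h1.2 h3
    · exact absurd h1.1 h2
    · exact absurd ⟨h4, h5⟩ h1
    · ring
    · ring
  have hlim : Tendsto (fun j => ∫ p, fj j p ∂pairMeas) atTop (𝓝 (∫ p, f p ∂pairMeas)) := by
    refine tendsto_integral_of_dominated_convergence g ?_ hgI ?_ ?_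
    · intro j
      exact (((by fun_prop : Measurable fun p : E3 × S2 => ‖p.1‖ ^ γ).mul
        ((measurable_truncAng h.measurable _).comp hang)).mul hGm).aestronglyMeasurable
    · intro j
      filter_upwards [hfg] with p hp
      rw [hfjf]
      split_ifs
      · exact hp
      · simpa using (norm_nonneg _).trans hp
    · refine Eventually.of_forall fun p => ?_
      rcases (InnerProductGeometry.angle_nonneg p.1 (p.2 : E3)).eq_or_lt with h4 | h4
      · have : f p = 0 := by
          simp only [hf, kernelB, ← h4]
          rw [Real.zero_rpow (by linarith)]; simp
        simp [hfjf, this]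
      · refine tendsto_const_nhds.congr' ?_
        have := tendsto_one_div_add_atTop_nhds_zero_nat (𝕜 := ℝ)
        filter_upwards [this.eventually (gt_mem_nhds h4)] with j hj
        rw [hfjf, if_pos hj]
  refine le_of_tendsto hlim.abs (Eventually.of_forall fun j => ?_)
  have hκ : (0 : ℝ) < 1 / ((j : ℝ) + 1) := by positivity
  have hpos := hC (fun w => max (G w) 0) A _ v hA hκ (hGc.max continuous_const)
    (fun w => le_max_right _ _) (fun w => max_le ((le_abs_self _).trans (hG w))
      ((abs_nonneg _).trans (hG w)))
  have hneg := hC (fun w => max (-G w) 0) A _ v hA hκ (hGc.neg.max continuous_const)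
    (fun w => le_max_right _ _) (fun w => max_le ((neg_le_abs _).trans (hG w))
      ((abs_nonneg _).trans (hG w)))
  have hsplit : ∀ x : ℝ, x = max x 0 - max (-x) 0 := fun x => by
    rcases le_total x 0 with hx | hx
    · rw [max_eq_right hx, max_eq_left (by linarith)]; ring
    · rw [max_eq_left hx, max_eq_right (by linarith)]; ring
  have heq : ∫ p, fj j p ∂pairMeas =
      (∫ p : E3 × S2, ‖p.1‖ ^ γ * truncAng s b (1 / ((j : ℝ) + 1)) (angle p.1 (p.2 : E3)) *
          max (G (v - halfSum p.1 p.2)) 0 ∂pairMeas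
        - ∫ p : E3 × S2, ‖p.1‖ ^ γ * truncAng s b (1 / ((j : ℝ) + 1)) (angle p.1 (p.2 : E3)) *
          max (G (v - p.1)) 0 ∂pairMeas) -
      (∫ p : E3 × S2, ‖p.1‖ ^ γ * truncAng s b (1 / ((j : ℝ) + 1)) (angle p.1 (p.2 : E3)) *
          max (-G (v - halfSum p.1 p.2)) 0 ∂pairMeas
        - ∫ p : E3 × S2, ‖p.1‖ ^ γ * truncAng s b (1 / ((j : ℝ) + 1)) (angle p.1 (p.2 : E3)) *
          max (-G (v - p.1)) 0 ∂pairMeas) := by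
    have e3 := integral_sub (hpos.1.sub hpos.2.1) (hneg.1.sub hneg.2.1)
    simp only [Pi.sub_apply] at e3
    rw [← integral_sub hpos.1 hpos.2.1, ← integral_sub hneg.1 hneg.2.1, ← e3]
    refine integral_congr_ae (Eventually.of_forall fun p => ?_)
    simp only [hfj]
    linear_combination ‖p.1‖ ^ γ * truncAng s b (1 / ((j : ℝ) + 1)) (angle p.1 (p.2 : E3)) *
      (hsplit (G (v - halfSum p.1 p.2)) - hsplit (G (v - p.1)))
  rw [heq]
  refine (abs_sub _ _).trans ?_
  linarith [hpos.2.2, hneg.2.2]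

end

/-! ### The main bound for the collision operator -/

section
variable {γ s : ℝ} {b : ℝ → ℝ} {β : ℝ}

lemma KernelHyp.kernelB_eq_zero (h : KernelHyp γ s b β) {u ω : E3} (h0 : angle u ω = 0) :
    kernelB γ s b u ω = 0 := by
  rw [kernelB, h0, Real.zero_rpow (by linarith [h.s_pos])]; ring

set_option maxHeartbeats 1000000 in
/-- Weighted bound for `Q(G, H)`.  Only the size of `G` enters, and the size and Hölder modulus of
`H` near `v`; the Hölder regularity of `G` serves merely to make the integral converge. -/
theorem collision_bound (h : KernelHyp γ s b β) {a l l' m n k : ℝ} (ha : 2 * s < a) (ha1 : a < 1)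
    (hl : 3 + γ + a < l) (hm : 3 + γ < m) (hkl : k ≤ l) (hkm : k ≤ m) (hkn : k + a ≤ n)
    (hnm : n ≤ m + a) (hl' : 3 + γ + a < l') :
    ∃ C : ℝ, 0 ≤ C ∧ ∀ (G H : E3 → ℝ) (A B : ℝ) (v : E3), 0 ≤ A → 0 ≤ B →
      Continuous G → Continuous H →
      (∀ w, |G w| ≤ A * jap w ^ (-l)) →
      (∃ A' : ℝ, ∀ w z, |G w - G z| ≤ A' * ‖w - z‖ ^ a * (jap w ^ (-l') + jap z ^ (-l'))) →
      (∀ w, |H w| ≤ B * jap w ^ (-m)) →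
      (∀ w, jap v ≤ 4 * jap w → |H v - H w| ≤ B * ‖v - w‖ ^ a * jap v ^ (-n)) →
      Integrable (collInt γ s b G H v) pairMeas ∧
      |collisionQ γ s b G H v| ≤ C * A * B * jap v ^ (-k) := by
  have hγ := h.neg_three_lt
  have hγ0 := h.nonpos
  have hs := h.s_pos
  have hs' := h.s_lt
  have hβ := h.beta_nonneg
  have ha0 : 0 < a := by linarith
  have hl0 : 0 < l := by linarith
  have hm0 : 0 < m := by linarith
  obtain ⟨C0, hC0, hcan⟩ := cancellation h (l := l) ha ha1 (by linarith) hl'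
  -- near-grazing part
  set t1 : ℝ → ℝ := fun θ => if θ < Real.pi / 2 then θ ^ (a - 2 - 2 * s) else 0 with ht1
  have ht1m : Measurable t1 := Measurable.ite measurableSet_Iio (by fun_prop) measurable_const
  have ht10 : ∀ θ, 0 ≤ θ → θ ≤ Real.pi → 0 ≤ t1 θ := fun θ h1 _ => by
    simp only [ht1]; split_ifs
    · positivity
    · exact le_rfl
  obtain ⟨C1, hC1, hM1⟩ := integral_halfSum_le (q := γ + a) (l := l) (c := 2 ^ (γ + a + 3))
    (p := 2 + 2 * s - a) ht1m ht10 (by linarith) (by linarith) (by linarith) (by linarith)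
    (fun θ h1 h2 => by
      by_cases h3 : θ < Real.pi / 2
      · simp only [ht1, if_pos h3]
        rw [show -(γ + a) - 3 = -(γ + a + 3) by ring, show a - 2 - 2 * s = -(2 + 2 * s - a) by ring]
        exact mul_le_mul_of_nonneg_right (cos_rpow_le (by linarith) h1.le h3.le) (by positivity)
      · simp only [ht1, if_neg h3, mul_zero]; positivity)
  -- `v'` much smaller than `v`
  set t2 : ℝ → ℝ := fun θ => θ ^ (-2 - 2 * s) * Real.sin (θ / 2) ^ l with ht2
  have hsin : ∀ θ, 0 ≤ θ → θ ≤ Real.pi → 0 ≤ Real.sin (θ / 2) := fun θ h1 h2 =>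
    Real.sin_nonneg_of_nonneg_of_le_pi (by linarith) (by linarith)
  have hcos : ∀ θ, 0 ≤ θ → θ ≤ Real.pi → 0 ≤ Real.cos (θ / 2) := fun θ h1 h2 =>
    Real.cos_nonneg_of_mem_Icc ⟨by linarith [Real.pi_pos], by linarith⟩
  have ht2m : Measurable t2 := by fun_prop
  have ht20 : ∀ θ, 0 ≤ θ → θ ≤ Real.pi → 0 ≤ t2 θ := fun θ h1 h2 =>
    mul_nonneg (by positivity) (Real.rpow_nonneg (hsin θ h1 h2) _)
  obtain ⟨C2, hC2, hM2⟩ := integral_halfDiff_le (q := γ) (l := m) (c := 1)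
    (p := 2 + 2 * s - a) ht2m ht20 hγ hm (by linarith) (by linarith)
    (fun θ h1 h2 => by
      have h3 : 0 < Real.sin (θ / 2) := Real.sin_pos_of_pos_of_lt_pi (by linarith) (by linarith)
      have h4 : Real.sin (θ / 2) ^ (-γ - 3) * Real.sin (θ / 2) ^ l ≤ θ ^ a := by
        rw [← Real.rpow_add h3]
        calc Real.sin (θ / 2) ^ (-γ - 3 + l) ≤ Real.sin (θ / 2) ^ a :=
              Real.rpow_le_rpow_of_exponent_ge h3 (Real.sin_le_one _) (by linarith)
          _ ≤ θ ^ a := Real.rpow_le_rpow h3.le ((Real.sin_le (by linarith)).trans (by linarith)) ha0.le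
      calc Real.sin (θ / 2) ^ (-γ - 3) * t2 θ
          = θ ^ (-2 - 2 * s) * (Real.sin (θ / 2) ^ (-γ - 3) * Real.sin (θ / 2) ^ l) := by
            simp only [ht2]; ring
        _ ≤ θ ^ (-2 - 2 * s) * θ ^ a := mul_le_mul_of_nonneg_left h4 (by positivity)
        _ = 1 * θ ^ (-(2 + 2 * s - a)) := by rw [← Real.rpow_add h1, one_mul]; congr 1; ring)
  -- large angles, `v_*'` much smaller than `v`
  set t3 : ℝ → ℝ := fun θ => if θ < Real.pi / 2 then 0 else Real.cos (θ / 2) ^ m with ht3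
  have ht3m : Measurable t3 := Measurable.ite measurableSet_Iio measurable_const (by fun_prop)
  have ht30 : ∀ θ, 0 ≤ θ → θ ≤ Real.pi → 0 ≤ t3 θ := fun θ h1 h2 => by
    simp only [ht3]; split_ifs
    · exact le_rfl
    · exact Real.rpow_nonneg (hcos θ h1 h2) _
  obtain ⟨C3, hC3, hM3⟩ := integral_halfSum_le (q := γ) (l := l) (c := 1)
    (p := 0) ht3m ht30 hγ (by linarith) le_rfl two_pos
    (fun θ h1 h2 => by
      rw [neg_zero, Real.rpow_zero, mul_one]
      simp only [ht3]; split_ifs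
      · simp
      · rcases (hcos θ h1.le h2).eq_or_lt with h3 | h3
        · rw [← h3, Real.zero_rpow hm0.ne']; simp
        · rw [← Real.rpow_add h3]
          exact Real.rpow_le_one h3.le (Real.cos_le_one _) (by linarith))
  -- large angles, `v_*'` not small
  set t4 : ℝ → ℝ := fun θ => if θ < Real.pi / 2 then 0 else 1 with ht4
  have ht4m : Measurable t4 := Measurable.ite measurableSet_Iio measurable_const measurable_const
  have ht40 : ∀ θ, 0 ≤ θ → θ ≤ Real.pi → 0 ≤ t4 θ := fun θ h1 h2 => by
    simp only [ht4]; split_ifs <;> norm_num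
  obtain ⟨C4, hC4, hM4⟩ := integral_halfDiff_le (q := γ) (l := m) (c := 2 ^ (γ + 3))
    (p := 0) ht4m ht40 hγ hm le_rfl two_pos
    (fun θ h1 h2 => by
      rw [neg_zero, Real.rpow_zero, mul_one, show -γ - 3 = -(γ + 3) by ring]
      simp only [ht4]; split_ifs with h3
      · rw [mul_zero]; positivity
      · rw [mul_one]; exact sin_rpow_le (by linarith) (by linarith) h2)
  obtain ⟨C5, hC5, hM5⟩ := integral_self_le (q := γ) (l := l) (c := 1)
    (p := 0) ht4m ht40 hγ (by linarith) le_rfl two_pos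
    (fun θ h1 h2 => by
      rw [neg_zero, Real.rpow_zero, mul_one]
      simp only [ht4]; split_ifs <;> norm_num)
  refine ⟨β * (2 * C1 + (3 ^ l * C2 + 4 ^ l * C4) + (3 ^ m * C3 + C5)) + C0, by positivity,
    fun G H A B v hA hB hGc hHc hG hG' hH hH' => ?_⟩
  obtain ⟨hcI, hcle⟩ := hcan G A v hA hGc hG hG'
  -- At grazing angles `G_*' H' - G_* H = G_*' (H' - H) + H (G_*' - G_*)`.  The first summand uses
  -- the regularity of `H`, the second one is the integrand of the cancellation lemma.
  set cn : E3 × S2 → ℝ := fun p => if angle p.1 (p.2 : E3) < Real.pi / 2 then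
        kernelB γ s b p.1 p.2 * (G (v - halfSum p.1 p.2) - G (v - p.1)) else 0 with hcn
  set f : E3 × S2 → ℝ := fun p => if angle p.1 (p.2 : E3) < Real.pi / 2 then
        kernelB γ s b p.1 p.2 * (G (v - halfSum p.1 p.2) * (H (v - halfDiff p.1 p.2) - H v))
        else collInt γ s b G H v p with hf
  have hsplit : collInt γ s b G H v = fun p => f p + H v * cn p := by
    ext p
    simp only [hf, hcn, collInt]
    split_ifs <;> ring
  have hKm : Measurable fun p : E3 × S2 => kernelB γ s b p.1 p.2 := measurable_kernelB h.measurable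
  have hG1 : Measurable fun p : E3 × S2 => G (v - halfSum p.1 p.2) :=
    hGc.measurable.comp (measurable_const.sub continuous_halfSum.measurable)
  have hG2 : Measurable fun p : E3 × S2 => G (v - p.1) :=
    hGc.measurable.comp (measurable_const.sub measurable_fst)
  have hH1 : Measurable fun p : E3 × S2 => H (v - halfDiff p.1 p.2) :=
    hHc.measurable.comp (measurable_const.sub continuous_halfDiff.measurable)
  have hfm : Measurable f := Measurable.ite (measurableSet_lt measurable_angle measurable_const)
    (hKm.mul (hG1.mul (hH1.sub measurable_const)))
    (hKm.mul ((hG1.mul hH1).sub (hG2.mul measurable_const)))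
  set g : E3 × S2 → ℝ := fun p => β * A * B *
    (2 * jap v ^ (-n) * (‖p.1‖ ^ (γ + a) * t1 (angle p.1 (p.2 : E3)) * jap (v - halfSum p.1 p.2) ^ (-l))
    + 3 ^ l * jap v ^ (-l) * (‖p.1‖ ^ γ * t2 (angle p.1 (p.2 : E3)) * jap (v - halfDiff p.1 p.2) ^ (-m))
    + 3 ^ m * jap v ^ (-m) * (‖p.1‖ ^ γ * t3 (angle p.1 (p.2 : E3)) * jap (v - halfSum p.1 p.2) ^ (-l))
    + 4 ^ l * jap v ^ (-l) * (‖p.1‖ ^ γ * t4 (angle p.1 (p.2 : E3)) * jap (v - halfDiff p.1 p.2) ^ (-m))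
    + jap v ^ (-m) * (‖p.1‖ ^ γ * t4 (angle p.1 (p.2 : E3)) * jap (v - p.1) ^ (-l))) with hg
  have i1 := (hM1 v).1.const_mul (2 * jap v ^ (-n))
  have i2 := (hM2 v).1.const_mul (3 ^ l * jap v ^ (-l))
  have i3 := (hM3 v).1.const_mul (3 ^ m * jap v ^ (-m))
  have i4 := (hM4 v).1.const_mul (4 ^ l * jap v ^ (-l))
  have i5 := (hM5 v).1.const_mul (jap v ^ (-m))
  have i12 := i1.add i2
  have i123 := i12.add i3
  have i1234 := i123.add i4
  have hgI : Integrable g pairMeas := (i1234.add i5).const_mul _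
  have hj := fun (r : ℝ) => jap_rpow_pos v r
  have hgint : ∫ p, g p ∂pairMeas ≤
      β * A * B * ((2 * C1 + (3 ^ l * C2 + 4 ^ l * C4) + (3 ^ m * C3 + C5)) * jap v ^ (-k)) := by
    rw [hg, integral_const_mul]
    refine mul_le_mul_of_nonneg_left ?_ (by positivity)
    have e5 := integral_add i1234 i5
    have e4 := integral_add i123 i4
    have e3 := integral_add i12 i3
    have e2 := integral_add i1 i2
    simp only [Pi.add_apply] at e2 e3 e4 e5
    rw [e5, e4, e3, e2]
    simp only [integral_const_mul]
    have k1 : jap v ^ (-n) * jap v ^ (max (γ + a) 0) ≤ jap v ^ (-k) := by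
      rw [← jap_rpow_add]
      refine jap_rpow_le v ?_
      rcases le_total (γ + a) 0 with h1 | h1
      · rw [max_eq_right h1]; linarith
      · rw [max_eq_left h1]; linarith
    have kl : jap v ^ (-l) ≤ jap v ^ (-k) := jap_rpow_le v (by linarith)
    have km : jap v ^ (-m) ≤ jap v ^ (-k) := jap_rpow_le v (by linarith)
    have n1 := (hM1 v).2
    have n2 := (hM2 v).2
    have n3 := (hM3 v).2
    have n4 := (hM4 v).2
    have n5 := (hM5 v).2
    rw [max_eq_right hγ0, Real.rpow_zero, mul_one] at n2 n3 n4 n5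
    have p1 := (mul_le_mul_of_nonneg_left n1 (mul_nonneg two_pos.le (hj (-n)).le)).trans
      (show _ ≤ 2 * C1 * jap v ^ (-k) from by
        calc _ = 2 * C1 * (jap v ^ (-n) * jap v ^ (max (γ + a) 0)) := by ring
          _ ≤ _ := by gcongr)
    have p2 := mul_le_mul (mul_le_mul_of_nonneg_left kl (by positivity : (0:ℝ) ≤ 3 ^ l)) n2
      (integral_nonneg fun p => ?_) (mul_nonneg (by positivity) (hj (-k)).le)
    have p3 := mul_le_mul (mul_le_mul_of_nonneg_left km (by positivity : (0:ℝ) ≤ 3 ^ m)) n3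
      (integral_nonneg fun p => ?_) (mul_nonneg (by positivity) (hj (-k)).le)
    have p4 := mul_le_mul (mul_le_mul_of_nonneg_left kl (by positivity : (0:ℝ) ≤ 4 ^ l)) n4
      (integral_nonneg fun p => ?_) (mul_nonneg (by positivity) (hj (-k)).le)
    have p5 := mul_le_mul km n5 (integral_nonneg fun p => ?_) (hj (-k)).le
    · nlinarith
    · exact mul_nonneg (mul_nonneg (by positivity) (ht40 _ (InnerProductGeometry.angle_nonneg _ _)
        (InnerProductGeometry.angle_le_pi _ _))) (jap_rpow_pos _ _).le
    · exact mul_nonneg (mul_nonneg (by positivity) (ht40 _ (InnerProductGeometry.angle_nonneg _ _)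
        (InnerProductGeometry.angle_le_pi _ _))) (jap_rpow_pos _ _).le
    · exact mul_nonneg (mul_nonneg (by positivity) (ht30 _ (InnerProductGeometry.angle_nonneg _ _)
        (InnerProductGeometry.angle_le_pi _ _))) (jap_rpow_pos _ _).le
    · exact mul_nonneg (mul_nonneg (by positivity) (ht20 _ (InnerProductGeometry.angle_nonneg _ _)
        (InnerProductGeometry.angle_le_pi _ _))) (jap_rpow_pos _ _).le
  have hu0 : ∀ᵐ p : E3 × S2 ∂pairMeas, p.1 ≠ 0 := by
    have h1 : ∀ᵐ u : E3, u ≠ 0 := by simp [ae_iff]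
    exact Measure.quasiMeasurePreserving_fst.ae h1
  have hfg : ∀ᵐ p ∂pairMeas, ‖f p‖ ≤ g p := by
    filter_upwards [hu0] with p hp
    set θ := angle p.1 (p.2 : E3) with hθ
    have hθ0 : 0 ≤ θ := InnerProductGeometry.angle_nonneg p.1 (p.2 : E3)
    have hθπ : θ ≤ Real.pi := InnerProductGeometry.angle_le_pi p.1 (p.2 : E3)
    have hup : 0 < ‖p.1‖ := norm_pos_iff.2 hp
    have hT := norm_halfDiff_le p.1 p.2
    have hE := energy_identity v p.1 p.2
    set w1 := v - halfDiff p.1 p.2 with hw1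
    set w2 := v - halfSum p.1 p.2 with hw2
    set vs := v - p.1 with hvs
    have j1 := fun r => jap_rpow_pos w1 r
    have j2 := fun r => jap_rpow_pos w2 r
    have j3 := fun r => jap_rpow_pos vs r
    have n1 := ht10 θ hθ0 hθπ
    have n2 := ht20 θ hθ0 hθπ
    have n3 := ht30 θ hθ0 hθπ
    have n4 := ht40 θ hθ0 hθπ
    have m1 : 0 ≤ ‖p.1‖ ^ (γ + a) * t1 θ * jap w2 ^ (-l) :=
      mul_nonneg (mul_nonneg (by positivity) n1) (j2 _).le
    have m2 : 0 ≤ ‖p.1‖ ^ γ * t2 θ * jap w1 ^ (-m) :=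
      mul_nonneg (mul_nonneg (by positivity) n2) (j1 _).le
    have m3 : 0 ≤ ‖p.1‖ ^ γ * t3 θ * jap w2 ^ (-l) :=
      mul_nonneg (mul_nonneg (by positivity) n3) (j2 _).le
    have m4 : 0 ≤ ‖p.1‖ ^ γ * t4 θ * jap w1 ^ (-m) :=
      mul_nonneg (mul_nonneg (by positivity) n4) (j1 _).le
    have m5 : 0 ≤ ‖p.1‖ ^ γ * t4 θ * jap vs ^ (-l) :=
      mul_nonneg (mul_nonneg (by positivity) n4) (j3 _).le
    have c1 := mul_nonneg (mul_nonneg two_pos.le (hj (-n)).le) m1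
    have c2 := mul_nonneg (mul_nonneg (by positivity : (0:ℝ) ≤ 3 ^ l) (hj (-l)).le) m2
    have c3 := mul_nonneg (mul_nonneg (by positivity : (0:ℝ) ≤ 3 ^ m) (hj (-m)).le) m3
    have c4 := mul_nonneg (mul_nonneg (by positivity : (0:ℝ) ≤ 4 ^ l) (hj (-l)).le) m4
    have c5 := mul_nonneg (hj (-m)).le m5
    have hgn : 0 ≤ g p := mul_nonneg (by positivity) (by linarith)
    have hKn := h.kernelB_nonneg p.1 (p.2 : E3)
    have hKle := h.kernelB_le p.1 (p.2 : E3)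
    have hd1 : ‖v - w1‖ = ‖v - vs‖ * Real.sin (θ / 2) := by
      rw [hw1, hvs, sub_sub_cancel, sub_sub_cancel, norm_halfDiff]
    have hd2 : ‖v - w2‖ = ‖v - vs‖ * Real.cos (θ / 2) := by
      rw [hw2, hvs, sub_sub_cancel, sub_sub_cancel, norm_halfSum]
    simp only [hf]
    split_ifs with h3
    · have e1 : t1 θ = θ ^ (a - 2 - 2 * s) := if_pos h3
      rcases hθ0.eq_or_lt with h4 | h4
      · rw [h.kernelB_eq_zero h4.symm, zero_mul, norm_zero]; exact hgn
      rw [norm_mul, Real.norm_of_nonneg hKn, norm_mul, Real.norm_eq_abs, Real.norm_eq_abs]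
      -- the Hölder part
      have hTa : ‖halfDiff p.1 p.2‖ ^ a ≤ ‖p.1‖ ^ a * θ ^ a := by
        rw [← Real.mul_rpow (norm_nonneg _) hθ0]
        exact Real.rpow_le_rpow (norm_nonneg _) hT ha0.le
      have hK1 : ∀ x y : ℝ, 0 ≤ x → x ≤ A * jap w2 ^ (-l) → 0 ≤ y →
          y ≤ 2 * B * (‖p.1‖ ^ a * θ ^ a) * jap v ^ (-n) →
          kernelB γ s b p.1 p.2 * (x * y) ≤ β * A * B * (2 * jap v ^ (-n) *
            (‖p.1‖ ^ (γ + a) * t1 θ * jap w2 ^ (-l))) := by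
        intro x y hx hxA hy hyB
        calc kernelB γ s b p.1 p.2 * (x * y) ≤ (β * (‖p.1‖ ^ γ * θ ^ (-2 - 2 * s))) *
              ((A * jap w2 ^ (-l)) * (2 * B * (‖p.1‖ ^ a * θ ^ a) * jap v ^ (-n))) :=
              mul_le_mul hKle (mul_le_mul hxA hyB hy (mul_nonneg hA (j2 _).le)) (by positivity)
                (by positivity)
          _ = β * A * B * (2 * jap v ^ (-n) * ((‖p.1‖ ^ γ * ‖p.1‖ ^ a) *
                (θ ^ (-2 - 2 * s) * θ ^ a) * jap w2 ^ (-l))) := by ring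
          _ = _ := by
              rw [← Real.rpow_add h4, ← Real.rpow_add hup]
              rw [e1, show -2 - 2 * s + a = a - 2 - 2 * s by ring]
      by_cases hfar : 4 * jap w1 < jap v
      · have h5 : |H w1 - H v| ≤ B * jap w1 ^ (-m) + B * jap v ^ (-m) :=
          (abs_sub _ _).trans (add_le_add (hH _) (hH _))
        have h6 : jap v ≤ 2 * ‖halfDiff p.1 p.2‖ := by
          have := jap_le_add v w1
          rw [hw1, sub_sub_cancel, ← hw1] at this
          linarith [norm_nonneg (halfDiff p.1 (p.2 : E3))]
        have h7 : B * jap v ^ (-m) ≤ 2 * B * (‖p.1‖ ^ a * θ ^ a) * jap v ^ (-n) := by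
          have h8 : jap v ^ a ≤ 2 * (‖p.1‖ ^ a * θ ^ a) := by
            calc jap v ^ a ≤ (2 * ‖halfDiff p.1 p.2‖) ^ a := Real.rpow_le_rpow (jap_pos v).le h6 ha0.le
              _ = 2 ^ a * ‖halfDiff p.1 p.2‖ ^ a := Real.mul_rpow (by norm_num) (norm_nonneg _)
              _ ≤ 2 * (‖p.1‖ ^ a * θ ^ a) := by
                  refine mul_le_mul ?_ hTa (by positivity) (by norm_num)
                  calc (2:ℝ) ^ a ≤ 2 ^ (1:ℝ) :=
                        Real.rpow_le_rpow_of_exponent_le (by norm_num) ha1.le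
                    _ = 2 := Real.rpow_one 2
          calc B * jap v ^ (-m) ≤ B * jap v ^ (a + -n) :=
                mul_le_mul_of_nonneg_left (jap_rpow_le v (by linarith)) hB
            _ = B * jap v ^ a * jap v ^ (-n) := by rw [jap_rpow_add]; ring
            _ ≤ B * (2 * (‖p.1‖ ^ a * θ ^ a)) * jap v ^ (-n) :=
                mul_le_mul_of_nonneg_right (mul_le_mul_of_nonneg_left h8 hB) (hj _).le
            _ = _ := by ring
        have h9 := jap_le_of_far (sin_half_nonneg p.1 p.2) hE hd1 hfar
        have hS : 0 < Real.sin (θ / 2) := Real.sin_pos_of_pos_of_lt_pi (by linarith) (by linarith)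
        have h10 : jap w2 ^ (-l) ≤ (3 ^ l * Real.sin (θ / 2) ^ l) * jap v ^ (-l) := by
          rw [← Real.mul_rpow (by norm_num) hS.le]
          exact jap_rpow_neg_le (by positivity) hl0.le h9
        have q1 := hK1 |G w2| (B * jap v ^ (-m)) (abs_nonneg _) (hG _)
          (mul_nonneg hB (hj _).le) h7
        have q2 : kernelB γ s b p.1 p.2 * (|G w2| * (B * jap w1 ^ (-m))) ≤ β * A * B *
            (3 ^ l * jap v ^ (-l) * (‖p.1‖ ^ γ * t2 θ * jap w1 ^ (-m))) := by
          calc kernelB γ s b p.1 p.2 * (|G w2| * (B * jap w1 ^ (-m)))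
              ≤ (β * (‖p.1‖ ^ γ * θ ^ (-2 - 2 * s))) *
                ((A * ((3 ^ l * Real.sin (θ / 2) ^ l) * jap v ^ (-l))) * (B * jap w1 ^ (-m))) := by
                refine mul_le_mul hKle (mul_le_mul_of_nonneg_right ((hG _).trans
                  (mul_le_mul_of_nonneg_left h10 hA)) (mul_nonneg hB (j1 _).le))
                  (mul_nonneg (abs_nonneg _) (mul_nonneg hB (j1 _).le)) (by positivity)
            _ = _ := by simp only [ht2]; ring
        have q3 : kernelB γ s b p.1 p.2 * (|G w2| * |H w1 - H v|) ≤
            kernelB γ s b p.1 p.2 * (|G w2| * (B * jap w1 ^ (-m))) +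
            kernelB γ s b p.1 p.2 * (|G w2| * (B * jap v ^ (-m))) := by
          rw [← mul_add, ← mul_add]
          gcongr
        refine q3.trans ((add_le_add q2 q1).trans ?_)
        rw [← mul_add]
        refine mul_le_mul_of_nonneg_left ?_ (by positivity)
        linarith
      · have h5 := hH' w1 (not_lt.1 hfar)
        rw [abs_sub_comm, hw1, sub_sub_cancel, ← hw1] at h5
        refine (hK1 |G w2| |H w1 - H v| (abs_nonneg _) (hG _) (abs_nonneg _) (h5.trans ?_)).trans ?_
        · have := mul_le_mul_of_nonneg_left hTa hB
          have h6 : 0 ≤ B * (‖p.1‖ ^ a * θ ^ a) := by positivity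
          exact mul_le_mul_of_nonneg_right (by linarith) (hj _).le
        · refine mul_le_mul_of_nonneg_left ?_ (by positivity)
          linarith
    · have h3' : Real.pi / 2 ≤ θ := not_lt.1 h3
      have hθ1 : θ ^ (-2 - 2 * s) ≤ 1 :=
        Real.rpow_le_one_of_one_le_of_nonpos (by linarith [Real.two_le_pi]) (by linarith)
      have hK1 : kernelB γ s b p.1 p.2 ≤ β * ‖p.1‖ ^ γ := hKle.trans
        (mul_le_mul_of_nonneg_left (mul_le_of_le_one_right (by positivity) hθ1) hβ)
      have e4 : t4 θ = 1 := if_neg h3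
      have e3 : t3 θ = Real.cos (θ / 2) ^ m := if_neg h3
      have hloss : |G vs * H v| ≤ A * B * (jap v ^ (-m) * jap vs ^ (-l)) := by
        rw [abs_mul]
        calc |G vs| * |H v| ≤ (A * jap vs ^ (-l)) * (B * jap v ^ (-m)) :=
              mul_le_mul (hG _) (hH _) (abs_nonneg _) (mul_nonneg hA (j3 _).le)
          _ = _ := by ring
      have hgain : |G w2 * H w1| ≤ A * B * (3 ^ m * jap v ^ (-m) * (t3 θ * jap w2 ^ (-l)) +
          4 ^ l * jap v ^ (-l) * jap w1 ^ (-m)) := by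
        rw [abs_mul]
        by_cases hfar : 4 * jap w2 < jap v
        · have h9 := jap_le_of_far (cos_half_nonneg p.1 p.2) ((add_comm _ _).trans hE) hd2 hfar
          have hc : 0 < Real.cos (θ / 2) := by
            by_contra hc
            have : Real.cos (θ / 2) = 0 := le_antisymm (not_lt.1 hc) (cos_half_nonneg p.1 p.2)
            rw [this] at h9
            linarith [jap_pos v]
          have h10 : jap w1 ^ (-m) ≤ (3 ^ m * Real.cos (θ / 2) ^ m) * jap v ^ (-m) := by
            rw [← Real.mul_rpow (by norm_num) hc.le]
            exact jap_rpow_neg_le (by positivity) hm0.le h9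
          calc |G w2| * |H w1| ≤ (A * jap w2 ^ (-l)) *
                (B * ((3 ^ m * Real.cos (θ / 2) ^ m) * jap v ^ (-m))) :=
                mul_le_mul (hG _) ((hH _).trans (mul_le_mul_of_nonneg_left h10 hB)) (abs_nonneg _)
                  (mul_nonneg hA (j2 _).le)
            _ = A * B * (3 ^ m * jap v ^ (-m) * (t3 θ * jap w2 ^ (-l))) := by rw [e3]; ring
            _ ≤ _ := by
                refine mul_le_mul_of_nonneg_left ?_ (by positivity)
                linarith [mul_nonneg (mul_nonneg (by positivity : (0:ℝ) ≤ 4 ^ l) (hj (-l)).le)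
                  (j1 (-m)).le]
        · have h10 : jap w2 ^ (-l) ≤ 4 ^ l * jap v ^ (-l) :=
            jap_rpow_neg_le (by norm_num) hl0.le (not_lt.1 hfar)
          calc |G w2| * |H w1| ≤ (A * (4 ^ l * jap v ^ (-l))) * (B * jap w1 ^ (-m)) :=
                mul_le_mul ((hG _).trans (mul_le_mul_of_nonneg_left h10 hA)) (hH _) (abs_nonneg _)
                  (mul_nonneg hA (mul_nonneg (by positivity) (hj _).le))
            _ = A * B * (4 ^ l * jap v ^ (-l) * jap w1 ^ (-m)) := by ring
            _ ≤ _ := by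
                refine mul_le_mul_of_nonneg_left ?_ (by positivity)
                linarith [mul_nonneg (mul_nonneg (by positivity : (0:ℝ) ≤ 3 ^ m) (hj (-m)).le)
                  (mul_nonneg n3 (j2 (-l)).le)]
      rw [collInt, norm_mul, Real.norm_of_nonneg hKn, Real.norm_eq_abs]
      calc kernelB γ s b p.1 p.2 * |G w2 * H w1 - G vs * H v|
          ≤ (β * ‖p.1‖ ^ γ) * (A * B * (3 ^ m * jap v ^ (-m) * (t3 θ * jap w2 ^ (-l)) +
              4 ^ l * jap v ^ (-l) * jap w1 ^ (-m)) + A * B * (jap v ^ (-m) * jap vs ^ (-l))) :=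
            mul_le_mul hK1 ((abs_sub _ _).trans (add_le_add hgain hloss)) (abs_nonneg _) (by positivity)
        _ = β * A * B * (3 ^ m * jap v ^ (-m) * (‖p.1‖ ^ γ * t3 θ * jap w2 ^ (-l))
            + 4 ^ l * jap v ^ (-l) * (‖p.1‖ ^ γ * t4 θ * jap w1 ^ (-m))
            + jap v ^ (-m) * (‖p.1‖ ^ γ * t4 θ * jap vs ^ (-l))) := by rw [e4]; ring
        _ ≤ _ := by
            refine mul_le_mul_of_nonneg_left ?_ (by positivity)
            linarith
  have hfI : Integrable f pairMeas := hgI.mono' hfm.aestronglyMeasurable hfg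
  have hcI' : Integrable (fun p => H v * cn p) pairMeas := hcI.const_mul _
  constructor
  · rw [hsplit]; exact hfI.add hcI'
  · rw [collisionQ_eq, hsplit, integral_add hfI hcI', integral_const_mul]
    have h1 : |∫ p, f p ∂pairMeas| ≤ ∫ p, g p ∂pairMeas :=
      norm_integral_le_of_norm_le hgI hfg
    have h2 : |H v * ∫ p, cn p ∂pairMeas| ≤ (B * jap v ^ (-k)) * (C0 * A) := by
      rw [abs_mul]
      exact mul_le_mul ((hH v).trans (mul_le_mul_of_nonneg_left (jap_rpow_le v (by linarith)) hB))
        hcle (abs_nonneg _) (mul_nonneg hB (hj _).le)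
    refine (abs_add_le _ _).trans ((add_le_add (h1.trans hgint) h2).trans (le_of_eq ?_))
    ring

end

/-! ### Differential inequalities in time -/

/-- A continuous function whose right upper Dini derivative is everywhere at most an integrable
`φ` grows by at most `∫ φ`. -/
lemma sub_le_integral_of_right_slope_le {g φ : ℝ → ℝ} {a b : ℝ} (hab : a ≤ b)
    (hcont : ContinuousOn g (Icc a b)) (φint : IntegrableOn φ (Icc a b))
    (hφg : ∀ t ∈ Ico a b, ∀ y, φ t < y → ∀ᶠ u in 𝓝[>] t, g u - g t ≤ (u - t) * y) :
    g b - g a ≤ ∫ y in a..b, φ y := by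
  refine le_of_forall_pos_le_add fun ε εpos => ?_
  -- a lower semicontinuous majorant of `φ`, by the Vitali–Carathéodory theorem
  rcases exists_lt_lowerSemicontinuous_integral_lt φ φint εpos with
    ⟨G', f_lt_G', G'cont, G'int, G'lt_top, hG'⟩
  set s := {t | g t - g a ≤ ∫ u in a..t, (G' u).toReal} ∩ Icc a b
  have s_closed : IsClosed s := by
    have : ContinuousOn (fun t => (g t - g a, ∫ u in a..t, (G' u).toReal)) (Icc a b) := by
      rw [← uIcc_of_le hab] at G'int hcont ⊢
      exact (hcont.sub continuousOn_const).prodMk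
        (intervalIntegral.continuousOn_primitive_interval G'int)
    simp only [s, inter_comm]
    exact this.preimage_isClosed_of_isClosed isClosed_Icc OrderClosedTopology.isClosed_le'
  have main : Icc a b ⊆ {t | g t - g a ≤ ∫ u in a..t, (G' u).toReal} := by
    refine s_closed.Icc_subset_of_forall_exists_gt
      (by simp) fun t ht v t_lt_v => ?_
    obtain ⟨y, g'_lt_y', y_lt_G'⟩ : ∃ y : ℝ, (φ t : EReal) < y ∧ (y : EReal) < G' t :=
      EReal.lt_iff_exists_real_btwn.1 (f_lt_G' t)
    have I1 : ∀ᶠ u in 𝓝[>] t, (u - t) * y ≤ ∫ w in t..u, (G' w).toReal := by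
      have B : ∀ᶠ u in 𝓝 t, (y : EReal) < G' u := G'cont.lowerSemicontinuousAt _ _ y_lt_G'
      rcases mem_nhds_iff_exists_Ioo_subset.1 B with ⟨m, M, ⟨hm, hM⟩, H⟩
      have : Ioo t (min M b) ∈ 𝓝[>] t := Ioo_mem_nhdsGT (lt_min hM ht.right.right)
      filter_upwards [this] with u hu
      have I : Icc t u ⊆ Icc a b := Icc_subset_Icc ht.2.1 (hu.2.le.trans (min_le_right _ _))
      calc
        (u - t) * y = ∫ _ in Icc t u, y := by
          simp only [MeasureTheory.integral_const, MeasurableSet.univ, measureReal_restrict_apply,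
            univ_inter, hu.left.le, Real.volume_real_Icc_of_le, smul_eq_mul]
        _ ≤ ∫ w in t..u, (G' w).toReal := by
          rw [intervalIntegral.integral_of_le hu.1.le, ← integral_Icc_eq_integral_Ioc]
          apply setIntegral_mono_ae_restrict
          · simp
          · exact IntegrableOn.mono_set G'int I
          · have C1 : ∀ᵐ x : ℝ ∂volume.restrict (Icc t u), G' x < ⊤ :=
              ae_mono (Measure.restrict_mono I le_rfl) G'lt_top
            have C2 : ∀ᵐ x : ℝ ∂volume.restrict (Icc t u), x ∈ Icc t u :=
              ae_restrict_mem measurableSet_Icc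
            filter_upwards [C1, C2] with x G'x hx
            apply EReal.coe_le_coe_iff.1
            have : x ∈ Ioo m M := by
              simp only [hm.trans_le hx.left,
                (hx.right.trans_lt hu.right).trans_le (min_le_left M b), mem_Ioo, and_self_iff]
            refine (H this).out.le.trans_eq ?_
            exact (EReal.coe_toReal G'x.ne (f_lt_G' x).ne_bot).symm
    have I2 : ∀ᶠ u in 𝓝[>] t, g u - g t ≤ (u - t) * y :=
      hφg t ht.2 y (EReal.coe_lt_coe_iff.1 g'_lt_y')
    have I3 : ∀ᶠ u in 𝓝[>] t, g u - g t ≤ ∫ w in t..u, (G' w).toReal := by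
      filter_upwards [I1, I2] with u hu1 hu2 using hu2.trans hu1
    have I4 : ∀ᶠ u in 𝓝[>] t, u ∈ Ioc t (min v b) := Ioc_mem_nhdsGT <| lt_min t_lt_v ht.2.2
    rcases (I3.and I4).exists with ⟨x, hx, h'x⟩
    refine ⟨x, ?_, Ioc_subset_Ioc le_rfl (min_le_left _ _) h'x⟩
    calc
      g x - g a = g t - g a + (g x - g t) := by abel
      _ ≤ (∫ w in a..t, (G' w).toReal) + ∫ w in t..x, (G' w).toReal := add_le_add ht.1 hx
      _ = ∫ w in a..x, (G' w).toReal := by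
        apply intervalIntegral.integral_add_adjacent_intervals
        · rw [intervalIntegrable_iff_integrableOn_Ioc_of_le ht.2.1]
          exact IntegrableOn.mono_set G'int
            (Ioc_subset_Icc_self.trans (Icc_subset_Icc le_rfl ht.2.2.le))
        · rw [intervalIntegrable_iff_integrableOn_Ioc_of_le h'x.1.le]
          apply IntegrableOn.mono_set G'int
          exact Ioc_subset_Icc_self.trans (Icc_subset_Icc ht.2.1 (h'x.2.trans (min_le_right _ _)))
  calc
    g b - g a ≤ ∫ y in a..b, (G' y).toReal := main (right_mem_Icc.2 hab)
    _ ≤ (∫ y in a..b, φ y) + ε := by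
      convert! hG'.le <;>
        · rw [intervalIntegral.integral_of_le hab]
          simp only [integral_Icc_eq_integral_Ioc', Real.volume_singleton]

/-- A continuous function whose left upper Dini derivative is finite everywhere and at most `φ`
almost everywhere grows by at most `∫ φ`.  Finiteness at *every* point excludes Cantor-type
growth. -/
lemma sub_le_integral_of_left_slope_le {M φ : ℝ → ℝ} {a b : ℝ} (hab : a ≤ b)
    (hcont : ContinuousOn M (Icc a b)) (hφ : IntegrableOn φ (Icc a b))
    (hfin : ∀ t ∈ Ioc a b, ∃ L, ∀ᶠ s in 𝓝[<] t, M t - M s ≤ (t - s) * L)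
    (hae : ∀ᵐ t ∂volume.restrict (Ioc a b), ∀ y, φ t < y → ∀ᶠ s in 𝓝[<] t, M t - M s ≤ (t - s) * y) :
    M b - M a ≤ ∫ t in a..b, φ t := by
  classical
  choose! L hL using hfin
  set φ' : ℝ → ℝ := fun t => if (∀ y, φ t < y → ∀ᶠ s in 𝓝[<] t, M t - M s ≤ (t - s) * y) then φ t else L t
    with hφ'
  have hae' : ∀ᵐ t ∂volume.restrict (Ioc a b), φ t = φ' t := by
    filter_upwards [hae] with t ht
    simp only [hφ', if_pos ht]
  have hres : volume.restrict (Icc a b) = volume.restrict (Ioc a b) :=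
    Measure.restrict_congr_set Ioc_ae_eq_Icc.symm
  have hφ'i : IntegrableOn φ' (Icc a b) := by
    rw [IntegrableOn, hres] at hφ ⊢
    exact hφ.congr hae'
  have hint : ∫ t in a..b, φ t = ∫ t in a..b, φ' t := by
    rw [intervalIntegral.integral_of_le hab, intervalIntegral.integral_of_le hab]
    exact integral_congr_ae hae'
  have key := sub_le_integral_of_right_slope_le (g := fun x => -M (-x)) (φ := fun x => φ' (-x))
    (a := -b) (b := -a) (by linarith)
    ((hcont.comp continuousOn_neg (fun x hx => ⟨by linarith [hx.2], by linarith [hx.1]⟩)).neg)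
    (by
      have h1 := (MeasurePreserving.integrableOn_comp_preimage
        (Measure.measurePreserving_neg (volume : Measure ℝ))
        (Homeomorph.neg ℝ).measurableEmbedding).2 hφ'i
      have h2 : (Neg.neg ⁻¹' Icc a b : Set ℝ) = Icc (-b) (-a) := by simp
      rw [h2] at h1
      exact h1)
    (by
      intro x hx y hy
      have hmem : -x ∈ Ioc a b := ⟨by linarith [hx.2], by linarith [hx.1]⟩
      have h1 : ∀ᶠ s in 𝓝[<] (-x), M (-x) - M s ≤ (-x - s) * y := by
        by_cases hg : ∀ y, φ (-x) < y → ∀ᶠ s in 𝓝[<] (-x), M (-x) - M s ≤ (-x - s) * y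
        · simp only [hφ', if_pos hg] at hy
          exact hg y hy
        · simp only [hφ', if_neg hg] at hy
          filter_upwards [hL (-x) hmem, self_mem_nhdsWithin] with s hs hs'
          have hs'' : s < -x := hs'
          exact hs.trans (mul_le_mul_of_nonneg_left hy.le (by linarith))
      have h2 : Tendsto (fun u : ℝ => -u) (𝓝[>] x) (𝓝[<] (-x)) := tendsto_neg_nhdsGT
      filter_upwards [h2.eventually h1] with u hu
      linarith)
  rw [hint]
  simp only [neg_neg] at key
  rw [intervalIntegral.integral_comp_neg (fun t => φ' t)] at key
  simp only [neg_neg] at key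
  linarith

lemma absolutelyContinuousOnInterval_exp_of_nonpos {f : ℝ → ℝ} {a b : ℝ}
    (hf : AbsolutelyContinuousOnInterval f a b) (h0 : ∀ t ∈ uIcc a b, f t ≤ 0) :
    AbsolutelyContinuousOnInterval (fun t => Real.exp (f t)) a b := by
  have hlip : ∀ x y : ℝ, x ≤ 0 → y ≤ 0 → dist (Real.exp x) (Real.exp y) ≤ dist x y := by
    intro x y hx hy
    have h := Convex.norm_image_sub_le_of_norm_hasDerivWithin_le (f := Real.exp) (f' := Real.exp)
      (s := Iic (0 : ℝ)) (C := 1) (x := y) (y := x)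
      (fun t _ => (Real.hasDerivAt_exp t).hasDerivWithinAt)
      (fun t ht => by rw [Real.norm_of_nonneg (Real.exp_pos t).le]; exact Real.exp_le_one_iff.2 ht)
      (convex_Iic 0) hy hx
    simpa [dist_eq_norm] using h
  refine squeeze_zero' (Eventually.of_forall fun E => Finset.sum_nonneg fun _ _ => dist_nonneg)
    ?_ hf
  have hE : ∀ᶠ E in AbsolutelyContinuousOnInterval.totalLengthFilter ⊓
      𝓟 (AbsolutelyContinuousOnInterval.disjWithin a b),
      E ∈ AbsolutelyContinuousOnInterval.disjWithin a b :=
    mem_inf_of_right (mem_principal_self _)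
  filter_upwards [hE] with E hE'
  refine Finset.sum_le_sum fun i hi => ?_
  exact hlip _ _ (h0 _ (hE'.1 i hi).1) (h0 _ (hE'.1 i hi).2)

/-- Grönwall's inequality in integral form, with a merely integrable coefficient. -/
lemma gronwall_integral {α y : ℝ → ℝ} {A T : ℝ}
    (hα : IntegrableOn α (Icc 0 T)) (hα0 : ∀ t, 0 ≤ α t)
    (hαy : IntegrableOn (fun t => α t * y t) (Icc 0 T))
    (h : ∀ᵐ t ∂volume.restrict (Icc 0 T), y t ≤ A + ∫ τ in (0 : ℝ)..t, α τ * y τ) :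
    ∀ t ∈ Icc 0 T, A + ∫ τ in (0 : ℝ)..t, α τ * y τ ≤ A * Real.exp (∫ τ in (0 : ℝ)..t, α τ) := by
  intro t ht
  have hsub : Icc 0 t ⊆ Icc 0 T := Icc_subset_Icc_right ht.2
  have hαt : IntervalIntegrable α volume 0 t :=
    (intervalIntegrable_iff_integrableOn_Icc_of_le ht.1).2 (hα.mono_set hsub)
  have hαyt : IntervalIntegrable (fun t => α t * y t) volume 0 t :=
    (intervalIntegrable_iff_integrableOn_Icc_of_le ht.1).2 (hαy.mono_set hsub)
  set I : ℝ → ℝ := fun t => ∫ τ in (0 : ℝ)..t, α τ with hI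
  set u : ℝ → ℝ := fun t => A + ∫ τ in (0 : ℝ)..t, α τ * y τ with hu
  set E : ℝ → ℝ := fun t => Real.exp (-I t) with hE
  have hI0 : ∀ τ ∈ uIcc 0 t, 0 ≤ I τ := fun τ hτ => by
    rw [uIcc_of_le ht.1] at hτ
    exact intervalIntegral.integral_nonneg hτ.1 fun _ _ => hα0 _
  have hIac : AbsolutelyContinuousOnInterval I 0 t :=
    hαt.absolutelyContinuousOnInterval_intervalIntegral (by simp)
  have hEac : AbsolutelyContinuousOnInterval E 0 t :=
    absolutelyContinuousOnInterval_exp_of_nonpos hIac.neg fun τ hτ => by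
      simpa using hI0 τ hτ
  have hvac : AbsolutelyContinuousOnInterval (fun t => ∫ τ in (0 : ℝ)..t, α τ * y τ) 0 t :=
    hαyt.absolutelyContinuousOnInterval_intervalIntegral (by simp)
  have hcac : AbsolutelyContinuousOnInterval (fun _ : ℝ => A) 0 t :=
    ((LipschitzWith.const A).lipschitzOnWith (s := uIcc 0 t)).absolutelyContinuousOnInterval
  have huac : AbsolutelyContinuousOnInterval u 0 t := hcac.add hvac
  have hprod := huac.integral_deriv_mul_eq_sub hEac
  have hle : ∫ x in (0 : ℝ)..t, deriv u x * E x + u x * deriv E x ≤ 0 := by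
    rw [intervalIntegral.integral_of_le ht.1]
    refine integral_nonpos_of_ae ?_
    have h' : ∀ᵐ x ∂volume.restrict (Ioc 0 t), y x ≤ u x :=
      ae_mono (Measure.restrict_mono (Ioc_subset_Icc_self.trans hsub) le_rfl) h
    filter_upwards [h', ae_restrict_mem measurableSet_Ioc,
      ae_restrict_of_ae hαt.ae_hasDerivAt_integral, ae_restrict_of_ae hαyt.ae_hasDerivAt_integral]
      with x hx hxm h1 h2
    have hxm' : x ∈ uIcc 0 t := by rw [uIcc_of_le ht.1]; exact Ioc_subset_Icc_self hxm
    have d1 : HasDerivAt I (α x) x := h1 hxm' 0 (by simp)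
    have d2 : HasDerivAt u (α x * y x) x := (h2 hxm' 0 (by simp)).const_add A
    have d3 : HasDerivAt E (Real.exp (-I x) * (-α x)) x := d1.neg.exp
    rw [d2.deriv, d3.deriv]
    simp only [Pi.zero_apply, hE]
    have := mul_nonneg (mul_nonneg (hα0 x) (Real.exp_pos (-I x)).le) (sub_nonneg.2 hx)
    nlinarith
  rw [hprod] at hle
  have hu0 : u 0 = A := by simp [hu]
  have hE0 : E 0 = 1 := by simp [hE, hI]
  rw [hu0, hE0, mul_one] at hle
  change u t ≤ A * Real.exp (I t)
  have h3 : u t * E t * Real.exp (I t) ≤ A * Real.exp (I t) :=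
    mul_le_mul_of_nonneg_right (by linarith) (Real.exp_pos _).le
  rwa [mul_assoc, hE, ← Real.exp_add, neg_add_cancel, Real.exp_zero, mul_one] at h3

/-! ### The maximum principle -/

lemma exists_mem_unit_cube (x : E3) : ∃ x' : E3, (∀ i, x' i ∈ Icc (0 : ℝ) 1) ∧
    ∀ (φ : E3 × E3 → ℝ), PeriodicX φ → ∀ v, φ (x', v) = φ (x, v) := by
  set e : Fin 3 → E3 := fun i => EuclideanSpace.single i (1 : ℝ) with he
  refine ⟨x + (-⌊x 0⌋) • e 0 + (-⌊x 1⌋) • e 1 + (-⌊x 2⌋) • e 2, fun i => ?_, fun φ hφ v => ?_⟩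
  · have h1 : (x + (-⌊x 0⌋) • e 0 + (-⌊x 1⌋) • e 1 + (-⌊x 2⌋) • e 2) i = x i - ⌊x i⌋ := by
      fin_cases i <;> simp [he] <;> rfl
    rw [h1]
    exact ⟨sub_nonneg.2 (Int.floor_le _), by linarith [Int.lt_floor_add_one (x i)]⟩
  · have hp : ∀ i, Function.Periodic (fun x => φ (x, v)) (e i) := fun i x => hφ i x v
    have h1 := (hp 2).zsmul (-⌊x 2⌋) (x + (-⌊x 0⌋) • e 0 + (-⌊x 1⌋) • e 1)
    have h2 := (hp 1).zsmul (-⌊x 1⌋) (x + (-⌊x 0⌋) • e 0)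
    have h3 := (hp 0).zsmul (-⌊x 0⌋) x
    exact h1.trans (h2.trans h3)

lemma isCompact_unit_cube : IsCompact {x : E3 | ∀ i, x i ∈ Icc (0 : ℝ) 1} := by
  have h : {x : E3 | ∀ i, x i ∈ Icc (0 : ℝ) 1} =
      (EuclideanSpace.equiv (Fin 3) ℝ).toHomeomorph ⁻¹' (Set.pi univ fun _ => Icc (0 : ℝ) 1) := by
    ext x
    simp only [Set.mem_preimage, Set.mem_univ_pi]
    rfl
  rw [h, Homeomorph.isCompact_preimage]
  exact isCompact_univ_pi fun _ => isCompact_Icc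

/-- The maximum principle for functions that are only differentiable in time almost everywhere.
`w` is compared with multiples `N(t) q` of a weight; at almost every time the time derivative is
controlled at the points where the smallest such multiple touches `w`. -/
theorem max_principle {T : ℝ} {w : ℝ → E3 × E3 → ℝ} {q : E3 → ℝ} {Φ : ℝ → ℝ}
    {N0 : ℝ} (hq : Continuous q) (hqpos : ∀ v, 0 < q v)
    (hcont : ContinuousOn (fun p : ℝ × (E3 × E3) => w p.1 p.2) (Icc 0 T ×ˢ univ))
    (hper : ∀ t ∈ Icc 0 T, PeriodicX (w t))
    (hdec : ∀ κ > 0, ∃ R, ∀ t ∈ Icc 0 T, ∀ z, R ≤ ‖z.2‖ → w t z ≤ κ * q z.2)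
    (hlip : ∀ z, LocallyLipschitzOn (Ioo 0 T) (fun t => w t z))
    (hΦ : IntegrableOn Φ (Icc 0 T)) (hΦ0 : ∀ t, 0 ≤ Φ t)
    (hmax : ∀ᵐ t ∂volume.restrict (Ioo 0 T), ∀ z, DifferentiableAt ℝ (fun τ => w τ z) t ∧
      ∀ N, 0 < N → w t z = N * q z.2 → (∀ z', w t z' ≤ N * q z'.2) →
        deriv (fun τ => w τ z) t ≤ Φ t * q z.2)
    (hN0 : 0 ≤ N0) (h0 : ∀ z, w 0 z ≤ N0 * q z.2) :
    ∀ t ∈ Ico 0 T, ∀ z, w t z ≤ (N0 + ∫ τ in (0 : ℝ)..t, Φ τ) * q z.2 := by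
  intro t₀ ht₀ z₀
  have hT : 0 < T := ht₀.1.trans_lt ht₀.2
  suffices H : ∀ κ > 0, w t₀ z₀ / q z₀.2 ≤ (N0 + ∫ τ in (0 : ℝ)..t₀, Φ τ) + κ by
    rw [← div_le_iff₀ (hqpos _)]
    exact le_of_forall_pos_le_add H
  intro κ hκ
  obtain ⟨R, hR⟩ := hdec κ hκ
  set K : Set (E3 × E3) := {x : E3 | ∀ i, x i ∈ Icc (0 : ℝ) 1} ×ˢ Metric.closedBall 0 (max R 0) with hK
  have hKc : IsCompact K := isCompact_unit_cube.prod (isCompact_closedBall _ _)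
  have hKn : K.Nonempty := ⟨(0, 0), by simp [hK]⟩
  set u : ℝ → E3 × E3 → ℝ := fun t z => w (projIcc 0 T hT.le t) z / q z.2 with hu
  have hucont : Continuous (Function.uncurry u) := by
    have h1 : Continuous fun p : ℝ × (E3 × E3) => w (projIcc 0 T hT.le p.1) p.2 := by
      have h2 : Continuous fun p : ℝ × (E3 × E3) => (((projIcc 0 T hT.le p.1 : ℝ)), p.2) := by
        fun_prop
      exact hcont.comp_continuous h2 fun p => ⟨(projIcc 0 T hT.le p.1).2, mem_univ _⟩
    exact h1.div (hq.comp (continuous_snd.comp continuous_snd)) fun p => (hqpos _).ne'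
  have hut : ∀ t ∈ Icc 0 T, ∀ z, u t z = w t z / q z.2 := fun t ht z => by
    simp only [hu, projIcc_of_mem hT.le ht]
  set m : ℝ → ℝ := fun t => sSup (u t '' K) with hm
  have hmcont : Continuous m := hKc.continuous_sSup hucont
  set M : ℝ → ℝ := fun t => max κ (m t) with hM
  have hMcont : Continuous M := continuous_const.max hmcont
  have hbdd : ∀ t, BddAbove (u t '' K) := fun t =>
    (hKc.image (hucont.comp (Continuous.prodMk_right t))).bddAbove
  have hule : ∀ t ∈ Icc 0 T, ∀ z, w t z / q z.2 ≤ M t := by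
    intro t ht z
    by_cases hz : R ≤ ‖z.2‖
    · exact ((div_le_iff₀ (hqpos _)).2 (hR t ht z hz)).trans (le_max_left _ _)
    · obtain ⟨x', hx', hx'φ⟩ := exists_mem_unit_cube z.1
      have h1 : w t z = w t (x', z.2) := (hx'φ (w t) (hper t ht) z.2).symm
      refine le_trans (le_csSup (hbdd t) ⟨(x', z.2), ⟨hx', ?_⟩, ?_⟩) (le_max_right _ _)
      · rw [mem_closedBall_zero_iff]
        exact (not_le.1 hz).le.trans (le_max_left _ _)
      · rw [hut t ht, h1]
  have hatt : ∀ t ∈ Icc 0 T, κ < m t → ∃ z, w t z = M t * q z.2 := by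
    intro t ht hlt
    obtain ⟨z, -, hz⟩ := hKc.exists_sSup_image_eq hKn
      (f := u t) (hucont.comp (Continuous.prodMk_right t)).continuousOn
    refine ⟨z, ?_⟩
    have h1 : M t = w t z / q z.2 := by
      rw [← hut t ht, ← hz, hM]; exact max_eq_right hlt.le
    rw [h1, div_mul_cancel₀ _ (hqpos _).ne']
  -- left difference quotients of `M` are controlled by those of `w` at a touching point
  have hslope : ∀ t ∈ Ioo 0 T, ∀ z, w t z = M t * q z.2 → ∀ s ∈ Ioo 0 T,
      M t - M s ≤ (w t z - w s z) / q z.2 := by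
    intro t ht z hz s hs
    have h1 := hule s (Ioo_subset_Icc_self hs) z
    rw [sub_div, hz, mul_div_cancel_right₀ _ (hqpos _).ne']
    linarith
  have hflat : ∀ t, m t ≤ κ → ∀ L, 0 ≤ L → ∀ᶠ s in 𝓝[<] t, M t - M s ≤ (t - s) * L := by
    intro t ht L hL
    filter_upwards [self_mem_nhdsWithin] with s hs
    have hs' : s < t := hs
    have h1 : M t = κ := max_eq_left ht
    have h2 : κ ≤ M s := le_max_left _ _
    have h3 : 0 ≤ (t - s) * L := mul_nonneg (by linarith) hL
    linarith
  have hsub : Ioc 0 t₀ ⊆ Ioo 0 T := fun t ht => ⟨ht.1, ht.2.trans_lt ht₀.2⟩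
  have key := sub_le_integral_of_left_slope_le (M := M) (φ := Φ) ht₀.1 hMcont.continuousOn
    (hΦ.mono_set (Icc_subset_Icc_right ht₀.2.le)) ?_ ?_
  · have h1 := hule t₀ ⟨ht₀.1, ht₀.2.le⟩ z₀
    have h2 : M 0 ≤ N0 + κ := by
      refine max_le (by linarith) ?_
      refine csSup_le (hKn.image _) ?_
      rintro _ ⟨z, -, rfl⟩
      rw [hut 0 ⟨le_rfl, hT.le⟩, div_le_iff₀ (hqpos _)]
      exact (h0 z).trans (mul_le_mul_of_nonneg_right (by linarith) (hqpos _).le)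
    linarith
  · intro t ht
    rcases le_or_gt (m t) κ with h1 | h1
    · exact ⟨0, hflat t h1 0 le_rfl⟩
    · obtain ⟨z, hz⟩ := hatt t (Ioo_subset_Icc_self (hsub ht)) h1
      obtain ⟨Kl, S, hS, hLip⟩ := hlip z (hsub ht)
      refine ⟨Kl / q z.2, ?_⟩
      have hS' : S ∈ 𝓝 t := by
        rwa [nhdsWithin_eq_nhds.2 (isOpen_Ioo.mem_nhds (hsub ht))] at hS
      filter_upwards [self_mem_nhdsWithin, mem_nhdsWithin_of_mem_nhds hS',
        mem_nhdsWithin_of_mem_nhds (isOpen_Ioo.mem_nhds (hsub ht))] with s hs hsS hsI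
      have hs' : s < t := hs
      refine (hslope t (hsub ht) z hz s hsI).trans ?_
      have h2 := hLip.dist_le_mul t (mem_of_mem_nhds hS') s hsS
      rw [Real.dist_eq, Real.dist_eq, abs_of_pos (by linarith : 0 < t - s)] at h2
      rw [mul_div_assoc', div_le_div_iff_of_pos_right (hqpos _), mul_comm]
      exact (le_abs_self _).trans h2
  · have h2 : ∀ᵐ t ∂volume.restrict (Ioc 0 t₀), t ∈ Ioc 0 t₀ := ae_restrict_mem measurableSet_Ioc
    filter_upwards [h2, ae_mono (Measure.restrict_mono hsub le_rfl) hmax] with t ht hmt y hy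
    rcases le_or_gt (m t) κ with h1 | h1
    · exact hflat t h1 y ((hΦ0 t).trans hy.le)
    · obtain ⟨z, hz⟩ := hatt t (Ioo_subset_Icc_self (hsub ht)) h1
      obtain ⟨hd, hle⟩ := hmt z
      have hMpos : 0 < M t := hκ.trans_le (le_max_left _ _)
      have hle' := hle (M t) hMpos hz fun z' =>
        (div_le_iff₀ (hqpos _)).1 (hule t (Ioo_subset_Icc_self (hsub ht)) z')
      have hlt : deriv (fun τ => w τ z) t < y * q z.2 :=
        hle'.trans_lt (mul_lt_mul_of_pos_right hy (hqpos _))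
      have hsl := (hasDerivAt_iff_tendsto_slope.1 hd.hasDerivAt).eventually (gt_mem_nhds hlt)
      have hsl' : ∀ᶠ s in 𝓝[<] t, slope (fun τ => w τ z) t s < y * q z.2 :=
        hsl.filter_mono (nhdsWithin_mono _ fun s hs => ne_of_lt hs)
      filter_upwards [hsl', self_mem_nhdsWithin,
        mem_nhdsWithin_of_mem_nhds (isOpen_Ioo.mem_nhds (hsub ht))] with s hs1 hs hsI
      have hs' : s < t := hs
      refine (hslope t (hsub ht) z hz s hsI).trans ?_
      rw [div_le_iff₀ (hqpos _)]
      rw [slope_def_field, div_lt_iff_of_neg (by linarith)] at hs1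
      nlinarith

/-! ### Weighted Lipschitz bounds -/

/-- Bounds for `φ` and its difference quotients with the weights of `normX`.  This replaces the
`C¹` norm in the estimates: it passes to limits and it does not mention derivatives. -/
structure WLip (m₀ m₁ A : ℝ) (φ : E3 × E3 → ℝ) : Prop where
  bound : ∀ z, |φ z| ≤ A * jap z.2 ^ (-m₀)
  lip : ∀ z h, ‖h‖ < 1 → |φ (z + h) - φ z| ≤ A * ‖h‖ * jap z.2 ^ (-m₁)

section
variable {m₀ m₁ A : ℝ} {φ : E3 × E3 → ℝ}

lemma WLip.nonneg (h : WLip m₀ m₁ A φ) : 0 ≤ A := by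
  have h1 := (abs_nonneg _).trans (h.bound 0)
  exact nonneg_of_mul_nonneg_left h1 (jap_rpow_pos _ _)

lemma WLip.mono {A' : ℝ} (h : WLip m₀ m₁ A φ) (hA : A ≤ A') : WLip m₀ m₁ A' φ :=
  ⟨fun z => (h.bound z).trans (mul_le_mul_of_nonneg_right hA (jap_rpow_pos _ _).le),
    fun z k hk => (h.lip z k hk).trans (mul_le_mul_of_nonneg_right
      (mul_le_mul_of_nonneg_right hA (norm_nonneg _)) (jap_rpow_pos _ _).le)⟩

lemma WLip.bound_le (h : WLip m₀ m₁ A φ) (hm : 0 ≤ m₀) (z : E3 × E3) : |φ z| ≤ A :=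
  (h.bound z).trans (mul_le_of_le_one_right h.nonneg (jap_rpow_le_one _ (by linarith)))

lemma WLip.lip_le (h : WLip m₀ m₁ A φ) (hm : 0 ≤ m₁) (z k : E3 × E3) (hk : ‖k‖ < 1) :
    |φ (z + k) - φ z| ≤ A * ‖k‖ :=
  (h.lip z k hk).trans (mul_le_of_le_one_right (mul_nonneg h.nonneg (norm_nonneg _))
    (jap_rpow_le_one _ (by linarith)))

lemma WLip.lip_global (h : WLip m₀ m₁ A φ) (hm : 0 ≤ m₀) (hm' : 0 ≤ m₁) (z z' : E3 × E3) :
    |φ z - φ z'| ≤ 2 * A * ‖z - z'‖ := by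
  have hA := h.nonneg
  rcases lt_or_ge ‖z - z'‖ 1 with h1 | h1
  · have h2 := h.lip_le hm' z' (z - z') h1
    rw [add_sub_cancel] at h2
    nlinarith [mul_nonneg hA (norm_nonneg (z - z'))]
  · have h2 := h.bound_le hm z
    have h3 := h.bound_le hm z'
    have h4 := abs_sub (φ z) (φ z')
    nlinarith

lemma WLip.continuous (h : WLip m₀ m₁ A φ) (hm : 0 ≤ m₀) (hm' : 0 ≤ m₁) : Continuous φ := by
  refine LipschitzWith.continuous (K := (2 * A).toNNReal) (LipschitzWith.of_dist_le_mul fun z z' => ?_)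
  rw [Real.dist_eq, dist_eq_norm, Real.coe_toNNReal _ (by linarith [h.nonneg])]
  exact h.lip_global hm hm' z z'

lemma jap_add_rpow_neg_le {c m : ℝ} (hm : 0 ≤ m) (hc : 0 < c) (v k : E3) (hk : 1 + ‖k‖ ≤ c) :
    jap (v + k) ^ (-m) ≤ c ^ m * jap v ^ (-m) := by
  refine jap_rpow_neg_le hc hm ?_
  have h1 := jap_le_add v (v + k)
  have h2 : ‖v - (v + k)‖ = ‖k‖ := by rw [sub_add_cancel_left, norm_neg]
  rw [h2] at h1
  have := one_le_jap (v + k)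
  nlinarith [norm_nonneg k]

lemma WLip.shift (h : WLip m₀ m₁ A φ) (hm : 0 ≤ m₁) (hmm : m₁ ≤ m₀) {k : E3 × E3} (hk : ‖k‖ ≤ 1) :
    WLip m₀ m₁ (2 ^ m₀ * A) (fun z => φ (z + k)) := by
  have hk2 : 1 + ‖k.2‖ ≤ 2 := by have := norm_snd_le k; linarith
  refine ⟨fun z => (h.bound _).trans ?_, fun z l hl => ?_⟩
  · have := jap_add_rpow_neg_le (hm.trans hmm) two_pos z.2 k.2 hk2
    calc A * jap (z + k).2 ^ (-m₀) ≤ A * (2 ^ m₀ * jap z.2 ^ (-m₀)) :=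
          mul_le_mul_of_nonneg_left this h.nonneg
      _ = _ := by ring
  · have h1 := h.lip (z + k) l hl
    rw [add_right_comm]
    refine h1.trans ?_
    have h2 := jap_add_rpow_neg_le hm two_pos z.2 k.2 hk2
    have h3 : (2 : ℝ) ^ m₁ ≤ 2 ^ m₀ := Real.rpow_le_rpow_of_exponent_le one_le_two hmm
    calc A * ‖l‖ * jap (z + k).2 ^ (-m₁) ≤ A * ‖l‖ * (2 ^ m₀ * jap z.2 ^ (-m₁)) :=
          mul_le_mul_of_nonneg_left (h2.trans (mul_le_mul_of_nonneg_right h3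
            (jap_rpow_pos _ _).le)) (mul_nonneg h.nonneg (norm_nonneg _))
      _ = _ := by ring

lemma jap_mul_le_of_le {m x : ℝ} {v : E3} (hx : x ≤ A * jap v ^ (-m)) : jap v ^ m * x ≤ A := by
  rwa [Real.rpow_neg (jap_pos _).le, ← div_eq_mul_inv, le_div_iff₀ (jap_rpow_pos _ _),
    mul_comm] at hx

lemma le_of_jap_mul_le {m x : ℝ} {v : E3} (hx : jap v ^ m * x ≤ A) : x ≤ A * jap v ^ (-m) := by
  rwa [Real.rpow_neg (jap_pos _).le, ← div_eq_mul_inv, le_div_iff₀ (jap_rpow_pos _ _), mul_comm]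

lemma bound_of_normX (h : normX m₀ m₁ φ < ∞) (z : E3 × E3) :
    |φ z| ≤ (normX m₀ m₁ φ).toReal * jap z.2 ^ (-m₀) ∧
      ‖fderiv ℝ φ z‖ ≤ (normX m₀ m₁ φ).toReal * jap z.2 ^ (-m₁) := by
  have key : ∀ m x : ℝ, ENNReal.ofReal (jap z.2 ^ m * x) ≤ normX m₀ m₁ φ →
      x ≤ (normX m₀ m₁ φ).toReal * jap z.2 ^ (-m) := fun m x hx =>
    le_of_jap_mul_le ((ENNReal.ofReal_le_iff_le_toReal h.ne).1 hx)
  constructor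
  · refine key _ _ (le_trans ?_ le_self_add)
    exact le_iSup (fun z : E3 × E3 => ENNReal.ofReal (jap z.2 ^ m₀ * |φ z|)) z
  · refine key _ _ (le_trans ?_ le_add_self)
    exact le_iSup (fun z : E3 × E3 => ENNReal.ofReal (jap z.2 ^ m₁ * ‖fderiv ℝ φ z‖)) z

lemma MemX.wLip (h : MemX m₀ m₁ φ) (hm : 0 ≤ m₁) :
    WLip m₀ m₁ (2 ^ m₁ * (normX m₀ m₁ φ).toReal) φ := by
  set y := (normX m₀ m₁ φ).toReal with hy
  have hy0 : 0 ≤ y := ENNReal.toReal_nonneg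
  have h2 : (1 : ℝ) ≤ 2 ^ m₁ := Real.one_le_rpow one_le_two hm
  refine ⟨fun z => (bound_of_normX h.finite z).1.trans
    (mul_le_mul_of_nonneg_right (by nlinarith) (jap_rpow_pos _ _).le), fun z k hk => ?_⟩
  have h3 : ∀ x ∈ Metric.ball z 1, ‖fderiv ℝ φ x‖ ≤ 2 ^ m₁ * y * jap z.2 ^ (-m₁) := by
    intro x hx
    rw [mem_ball_iff_norm] at hx
    refine (bound_of_normX h.finite x).2.trans ?_
    have h4 : ‖z.2 - x.2‖ ≤ 1 := by
      rw [norm_sub_rev]; exact (norm_snd_le (x - z)).trans hx.le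
    have h5 := jap_rpow_neg_le two_pos hm (jap_le_two_mul h4)
    calc y * jap x.2 ^ (-m₁) ≤ y * (2 ^ m₁ * jap z.2 ^ (-m₁)) :=
          mul_le_mul_of_nonneg_left h5 hy0
      _ = _ := by ring
  have h6 := (convex_ball z 1).norm_image_sub_le_of_norm_fderiv_le (𝕜 := ℝ)
    (fun x _ => (h.contDiff.differentiable one_ne_zero) x) h3 (Metric.mem_ball_self one_pos)
    (y := z + k) (by simpa [mem_ball_iff_norm] using hk)
  rw [add_sub_cancel_left, Real.norm_eq_abs] at h6
  linarith

lemma WLip.norm_fderiv_le (h : WLip m₀ m₁ A φ) (hd : Differentiable ℝ φ) (z : E3 × E3) :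
    ‖fderiv ℝ φ z‖ ≤ A * jap z.2 ^ (-m₁) := by
  refine (hd z).hasFDerivAt.le_of_lip' (mul_nonneg h.nonneg (jap_rpow_pos _ _).le) ?_
  filter_upwards [Metric.ball_mem_nhds z one_pos] with x hx
  rw [mem_ball_iff_norm] at hx
  have := h.lip z (x - z) hx
  rw [add_sub_cancel] at this
  rw [Real.norm_eq_abs]
  linarith

lemma WLip.normX_le (h : WLip m₀ m₁ A φ) (hd : Differentiable ℝ φ) :
    normX m₀ m₁ φ ≤ ENNReal.ofReal (2 * A) := by
  have hA := h.nonneg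
  rw [two_mul, ENNReal.ofReal_add hA hA]
  exact add_le_add
    (iSup_le fun z => ENNReal.ofReal_le_ofReal (jap_mul_le_of_le (h.bound z)))
    (iSup_le fun z => ENNReal.ofReal_le_ofReal (jap_mul_le_of_le (h.norm_fderiv_le hd z)))

/-- The smallest constant in `WLip`, as a countable supremum, so that it is measurable in time for
functions that are only pointwise measurable in time. -/
def wnorm (m₀ m₁ : ℝ) (φ : E3 × E3 → ℝ) : ℝ≥0∞ :=
  ⨆ n : ℕ, let p := TopologicalSpace.denseSeq ((E3 × E3) × (E3 × E3)) n
    max (ENNReal.ofReal (jap p.1.2 ^ m₀ * |φ p.1|))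
      (if ‖p.2‖ < 1 then ENNReal.ofReal (jap p.1.2 ^ m₁ * (|φ (p.1 + p.2) - φ p.1| / ‖p.2‖)) else 0)

lemma aemeasurable_wnorm {g : ℝ → E3 × E3 → ℝ} {μ : Measure ℝ}
    (hg : ∀ z, AEMeasurable (fun t => g t z) μ) :
    AEMeasurable (fun t => wnorm m₀ m₁ (g t)) μ := by
  unfold wnorm
  refine AEMeasurable.iSup fun n => ?_
  have habs : ∀ {u : ℝ → ℝ}, AEMeasurable u μ → AEMeasurable (fun t => |u t|) μ := fun hu =>
    continuous_abs.measurable.comp_aemeasurable hu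
  refine AEMeasurable.max ((habs (hg _)).const_mul _).ennreal_ofReal ?_
  split_ifs
  · exact (((habs ((hg _).sub (hg _))).div_const _).const_mul _).ennreal_ofReal
  · exact aemeasurable_const

lemma WLip.wnorm_le (h : WLip m₀ m₁ A φ) : wnorm m₀ m₁ φ ≤ ENNReal.ofReal A := by
  have hA := h.nonneg
  refine iSup_le fun n => max_le (ENNReal.ofReal_le_ofReal (jap_mul_le_of_le (h.bound _))) ?_
  split_ifs with h1
  · refine ENNReal.ofReal_le_ofReal (jap_mul_le_of_le ?_)
    refine div_le_of_le_mul₀ (norm_nonneg _) (mul_nonneg hA (jap_rpow_pos _ _).le) ?_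
    have := h.lip (TopologicalSpace.denseSeq ((E3 × E3) × (E3 × E3)) n).1 _ h1
    linarith
  · exact zero_le

lemma wLip_of_wnorm (hφ : Continuous φ) (h : wnorm m₀ m₁ φ < ∞) :
    WLip m₀ m₁ (wnorm m₀ m₁ φ).toReal φ := by
  set y := (wnorm m₀ m₁ φ).toReal with hy
  have hden := TopologicalSpace.denseRange_denseSeq ((E3 × E3) × (E3 × E3))
  have hle := fun n => le_iSup (fun n : ℕ =>
    let p := TopologicalSpace.denseSeq ((E3 × E3) × (E3 × E3)) n
    max (ENNReal.ofReal (jap p.1.2 ^ m₀ * |φ p.1|))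
      (if ‖p.2‖ < 1 then ENNReal.ofReal (jap p.1.2 ^ m₁ * (|φ (p.1 + p.2) - φ p.1| / ‖p.2‖))
        else 0)) n
  have c1 : ∀ r : ℝ, Continuous fun p : (E3 × E3) × (E3 × E3) => jap p.1.2 ^ r := fun r =>
    (continuous_jap_rpow r).comp (continuous_snd.comp continuous_fst)
  have c2 : Continuous fun p : (E3 × E3) × (E3 × E3) => φ p.1 := hφ.comp continuous_fst
  have c3 : Continuous fun p : (E3 × E3) × (E3 × E3) => φ (p.1 + p.2) := hφ.comp (by fun_prop)
  have c4 : Continuous fun p : (E3 × E3) × (E3 × E3) => ‖p.2‖ := by fun_prop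
  have c5 : Continuous fun p : (E3 × E3) × (E3 × E3) =>
      jap p.1.2 ^ m₁ * |φ (p.1 + p.2) - φ p.1| := (c1 m₁).mul (c3.sub c2).abs
  have b1 : ∀ p : (E3 × E3) × (E3 × E3), jap p.1.2 ^ m₀ * |φ p.1| ≤ y := fun p => by
    refine hden.induction_on (p := fun p => jap p.1.2 ^ m₀ * |φ p.1| ≤ y) p
      (isClosed_le ((c1 m₀).mul c2.abs) continuous_const) fun n => ?_
    exact (ENNReal.ofReal_le_iff_le_toReal h.ne).1 ((le_max_left _ _).trans (hle n))
  have b2 : ∀ p : (E3 × E3) × (E3 × E3), 1 ≤ ‖p.2‖ ∨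
      jap p.1.2 ^ m₁ * |φ (p.1 + p.2) - φ p.1| ≤ y * ‖p.2‖ := fun p => by
    refine hden.induction_on (p := fun p => 1 ≤ ‖p.2‖ ∨
        jap p.1.2 ^ m₁ * |φ (p.1 + p.2) - φ p.1| ≤ y * ‖p.2‖) p
      (((isClosed_le continuous_const c4).union (isClosed_le c5 (continuous_const.mul c4)) :)) fun n => ?_
    rw [or_iff_not_imp_left, not_le]
    intro hn
    have h1 := (le_max_right _ _).trans (hle n)
    simp only [if_pos hn] at h1
    have h2 := (ENNReal.ofReal_le_iff_le_toReal h.ne).1 h1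
    rcases eq_or_ne (TopologicalSpace.denseSeq ((E3 × E3) × (E3 × E3)) n).2 0 with h0 | h0
    · simp [h0]
    · rwa [mul_div_assoc', div_le_iff₀ (norm_pos_iff.2 h0)] at h2
  refine ⟨fun z => le_of_jap_mul_le (b1 (z, 0)), fun z k hk => ?_⟩
  have h1 := (b2 (z, k)).resolve_left (not_le.2 hk)
  have h2 : jap z.2 ^ m₁ * |φ (z + k) - φ z| ≤ y * ‖k‖ := h1
  rw [Real.rpow_neg (jap_pos _).le, ← div_eq_mul_inv, le_div_iff₀ (jap_rpow_pos _ _), mul_comm]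
  exact h2

end

/-! ### The mollification -/

section
variable {ψ : E3 → ℝ}

lemma IsCutoff.continuous (h : IsCutoff ψ) : Continuous ψ := h.smooth.continuous

lemma IsCutoff.hasCompactSupport (h : IsCutoff ψ) : HasCompactSupport ψ :=
  HasCompactSupport.intro (isCompact_closedBall 0 1) fun x hx => by
    refine h.eq_zero x ?_
    rw [mem_closedBall_zero_iff, not_le] at hx
    exact hx.le

lemma IsCutoff.integral_smul (h : IsCutoff ψ) {ε : ℝ} (hε : 0 < ε) :
    ∫ v, ψ (ε⁻¹ • v) = ε ^ 3 := by
  rw [Measure.integral_comp_smul, h.integral_eq_one, finrank_euclideanSpace_fin, smul_eq_mul,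
    mul_one, inv_pow, inv_inv, abs_of_pos (by positivity)]

lemma IsCutoff.integrable_smul (h : IsCutoff ψ) {ε : ℝ} (hε : 0 < ε) :
    Integrable fun v => ψ (ε⁻¹ • v) :=
  ((h.continuous.integrable_of_hasCompactSupport h.hasCompactSupport)).comp_smul
    (inv_ne_zero hε.ne')

/-- Mollification averages translates of `φ` by at most `ε` in each variable. -/
lemma IsCutoff.exists_kernel (h : IsCutoff ψ) {ε : ℝ} (hε : 0 < ε) :
    ∃ k : E3 × E3 → ℝ, (∀ q, 0 ≤ k q) ∧ Integrable k ∧ ∫ q, k q = 1 ∧ (∀ q, ε < ‖q.2‖ → k q = 0) ∧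
      ∀ φ z, mollify ψ ε φ z = ∫ q, k q * φ (z - q) := by
  refine ⟨fun q => (ε ^ 6)⁻¹ * (ψ (ε⁻¹ • q.1) * ψ (ε⁻¹ • q.2)), fun q =>
    mul_nonneg (by positivity) (mul_nonneg (h.nonneg _) (h.nonneg _)),
    ((h.integrable_smul hε).mul_prod (h.integrable_smul hε)).const_mul _, ?_, fun q hq => ?_,
    fun φ z => ?_⟩
  · rw [integral_const_mul]
    have h1 := integral_prod_mul (μ := (volume : Measure E3)) (ν := (volume : Measure E3))
      (fun v : E3 => ψ (ε⁻¹ • v)) (fun v : E3 => ψ (ε⁻¹ • v))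
    rw [h.integral_smul hε] at h1
    rw [Measure.volume_eq_prod, h1]
    field_simp
  · have h1 : ψ (ε⁻¹ • q.2) = 0 := h.eq_zero _ (by
      rw [norm_smul, norm_inv, Real.norm_of_nonneg hε.le, ← div_eq_inv_mul, one_le_div hε]
      exact hq.le)
    simp [h1]
  · have : (volume : Measure (E3 × E3)).IsNegInvariant :=
      ⟨((Measure.measurePreserving_neg (volume : Measure E3)).prod
        (Measure.measurePreserving_neg (volume : Measure E3))).map_eq⟩
    have : (volume : Measure (E3 × E3)).IsAddLeftInvariant :=
      (inferInstance : ((volume : Measure E3).prod (volume : Measure E3)).IsAddLeftInvariant)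
    rw [mollify, if_neg hε.ne', ← integral_const_mul, ← integral_sub_left_eq_self _ volume z]
    refine integral_congr_ae (Eventually.of_forall fun q => ?_)
    simp only [Prod.fst_sub, Prod.snd_sub, sub_sub_cancel]
    ring

variable {m₀ m₁ A ε Λ : ℝ} {φ : E3 × E3 → ℝ}

lemma IsCutoff.mollify_nonneg (h : IsCutoff ψ) (hε : 0 ≤ ε) (hφ : ∀ z, 0 ≤ φ z) (z : E3 × E3) :
    0 ≤ mollify ψ ε φ z := by
  rcases hε.eq_or_lt with rfl | hε
  · simpa [mollify] using hφ z
  · obtain ⟨k, hk0, -, -, -, hk⟩ := h.exists_kernel hε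
    rw [hk]
    exact integral_nonneg fun q => mul_nonneg (hk0 _) (hφ _)

lemma IsCutoff.wLip_mollify (h : IsCutoff ψ) (hε : 0 ≤ ε) (hεΛ : ε ≤ Λ) (hm : 0 ≤ m₁)
    (hmm : m₁ ≤ m₀) (hφ : WLip m₀ m₁ A φ) :
    WLip m₀ m₁ ((1 + Λ) ^ m₀ * A) (mollify ψ ε φ) := by
  have hA := hφ.nonneg
  have h1Λ : 1 ≤ (1 + Λ) ^ m₀ := Real.one_le_rpow (by linarith) (by linarith)
  rcases hε.eq_or_lt with rfl | hε
  · have h1 : mollify ψ 0 φ = φ := by funext z; simp [mollify]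
    rw [h1]
    exact hφ.mono (by nlinarith)
  · obtain ⟨k, hk0, hki, hk1, hks, hk⟩ := h.exists_kernel hε
    have hcont := hφ.continuous (hm.trans hmm) hm
    have hint : ∀ z, Integrable fun q => k q * φ (z - q) := fun z =>
      hki.mul_bdd (c := A) (hcont.comp (by fun_prop)).aestronglyMeasurable
        (Eventually.of_forall fun q => hφ.bound_le (hm.trans hmm) _)
    -- an average of a quantity is bounded by its supremum over the support of the kernel
    have key : ∀ (u : E3 × E3 → ℝ) (D : ℝ), 0 ≤ D → (∀ q, ‖q.2‖ ≤ ε → |u q| ≤ D) →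
        |∫ q, k q * u q| ≤ D := by
      intro u D hD hu
      have h2 : ‖∫ q, k q * u q‖ ≤ ∫ q, k q * D :=
        norm_integral_le_of_norm_le (hki.mul_const D) (Eventually.of_forall fun q => by
          rw [norm_mul, Real.norm_of_nonneg (hk0 q)]
          rcases le_or_gt ‖q.2‖ ε with h3 | h3
          · exact mul_le_mul_of_nonneg_left (hu q h3) (hk0 q)
          · simp [hks q h3])
      rwa [integral_mul_const, hk1, one_mul] at h2
    have hjap : ∀ {m : ℝ}, 0 ≤ m → m ≤ m₀ → ∀ z q : E3 × E3, ‖q.2‖ ≤ ε →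
        jap (z - q).2 ^ (-m) ≤ (1 + Λ) ^ m₀ * jap z.2 ^ (-m) := by
      intro m h0 h1 z q hq
      have h2 := jap_add_rpow_neg_le h0 (c := 1 + Λ) (by linarith) z.2 (-q.2)
        (by rw [norm_neg]; linarith)
      rw [Prod.snd_sub, sub_eq_add_neg]
      exact h2.trans (mul_le_mul_of_nonneg_right
        (Real.rpow_le_rpow_of_exponent_le (by linarith) h1) (jap_rpow_pos _ _).le)
    refine ⟨fun z => ?_, fun z l hl => ?_⟩
    · rw [hk]
      refine key _ _ (mul_nonneg (mul_nonneg (by linarith) hA) (jap_rpow_pos _ _).le) fun q hq => ?_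
      refine (hφ.bound _).trans ?_
      calc _ ≤ A * ((1 + Λ) ^ m₀ * jap z.2 ^ (-m₀)) :=
            mul_le_mul_of_nonneg_left (hjap (hm.trans hmm) le_rfl z q hq) hA
        _ = _ := by ring
    · have e1 : mollify ψ ε φ (z + l) - mollify ψ ε φ z =
          ∫ q, k q * (φ (z - q + l) - φ (z - q)) := by
        rw [hk, hk, ← integral_sub (hint _) (hint _)]
        refine integral_congr_ae (Eventually.of_forall fun q => ?_)
        simp only
        rw [show z + l - q = z - q + l by abel]
        ring
      rw [e1]
      refine key _ _ (mul_nonneg (mul_nonneg (mul_nonneg (by linarith) hA) (norm_nonneg _))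
        (jap_rpow_pos _ _).le) fun q hq => ?_
      refine (hφ.lip _ l hl).trans ?_
      calc _ ≤ A * ‖l‖ * ((1 + Λ) ^ m₀ * jap z.2 ^ (-m₁)) :=
            mul_le_mul_of_nonneg_left (hjap hm hmm z q hq) (mul_nonneg hA (norm_nonneg _))
        _ = _ := by ring

end

/-! ### Lipschitz functions of the velocity -/

/-- Weighted bound and unweighted Lipschitz bound, with the same constant, for a function of the
velocity. -/
structure VLip (m B : ℝ) (H : E3 → ℝ) : Prop where
  bound : ∀ w, |H w| ≤ B * jap w ^ (-m)
  lip : ∀ w z, |H w - H z| ≤ B * ‖w - z‖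

section
variable {m B B' a : ℝ} {H H' : E3 → ℝ}

lemma VLip.nonneg (h : VLip m B H) : 0 ≤ B :=
  nonneg_of_mul_nonneg_left ((abs_nonneg _).trans (h.bound 0)) (jap_rpow_pos _ _)

lemma VLip.continuous (h : VLip m B H) : Continuous H := by
  refine LipschitzWith.continuous (K := B.toNNReal) (LipschitzWith.of_dist_le_mul fun w z => ?_)
  rw [Real.dist_eq, dist_eq_norm, Real.coe_toNNReal _ h.nonneg]
  exact h.lip w z

lemma VLip.sub (h : VLip m B H) (h' : VLip m B' H') : VLip m (B + B') (fun w => H w - H' w) := by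
  refine ⟨fun w => ?_, fun w z => ?_⟩
  · have := abs_sub (H w) (H' w)
    have := h.bound w
    have := h'.bound w
    linarith
  · have := abs_sub (H w - H z) (H' w - H' z)
    have := h.lip w z
    have := h'.lip w z
    rw [show H w - H' w - (H z - H' z) = H w - H z - (H' w - H' z) by ring]
    linarith

lemma VLip.const_mul (h : VLip m B H) (c : ℝ) : VLip m (|c| * B) (fun w => c * H w) := by
  refine ⟨fun w => ?_, fun w z => ?_⟩
  · rw [abs_mul, mul_assoc]
    exact mul_le_mul_of_nonneg_left (h.bound w) (abs_nonneg _)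
  · rw [← mul_sub, abs_mul, mul_assoc]
    exact mul_le_mul_of_nonneg_left (h.lip w z) (abs_nonneg _)

lemma VLip.mul_left (h : VLip m B H) (hm : 0 ≤ m) {χ : E3 → ℝ} {L : ℝ} (h1 : ∀ v, |χ v| ≤ L)
    (h2 : ∀ v w, |χ v - χ w| ≤ L * ‖v - w‖) : VLip m (2 * L * B) (fun w => χ w * H w) := by
  have hL : 0 ≤ L := (abs_nonneg _).trans (h1 0)
  have hB := h.nonneg
  refine ⟨fun w => ?_, fun w z => ?_⟩
  · rw [abs_mul]
    have h3 := mul_le_mul (h1 w) (h.bound w) (abs_nonneg _) hL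
    nlinarith [mul_nonneg hL (mul_nonneg hB (jap_rpow_pos w (-m)).le)]
  · have e : χ w * H w - χ z * H z = χ w * (H w - H z) + (χ w - χ z) * H z := by ring
    rw [e]
    refine (abs_add_le _ _).trans ?_
    rw [abs_mul, abs_mul]
    have h3 := mul_le_mul (h1 w) (h.lip w z) (abs_nonneg _) hL
    have h4 : |H z| ≤ B := (h.bound z).trans
      (mul_le_of_le_one_right hB (jap_rpow_le_one _ (by linarith)))
    have h5 := mul_le_mul (h2 w z) h4 (abs_nonneg _) (mul_nonneg hL (norm_nonneg _))
    nlinarith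

lemma rpow_add_le_add_rpow' {p x y : ℝ} (hx : 0 ≤ x) (hy : 0 ≤ y) (hp : 0 ≤ p) (hp1 : p ≤ 1) :
    (x + y) ^ p ≤ x ^ p + y ^ p := by
  lift x to NNReal using hx
  lift y to NNReal using hy
  exact_mod_cast NNReal.rpow_add_le_add_rpow x y hp hp1

/-- Interpolation between the size and the Lipschitz bound. -/
lemma VLip.holder (h : VLip m B H) (ha : 0 < a) (ha1 : a < 1) (w z : E3) :
    |H w - H z| ≤ B * ‖w - z‖ ^ a *
      (jap w ^ (-((1 - a) * m)) + jap z ^ (-((1 - a) * m))) := by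
  have hB := h.nonneg
  set D := |H w - H z| with hD
  have hD0 : 0 ≤ D := abs_nonneg _
  have h1 : D ≤ B * (jap w ^ (-m) + jap z ^ (-m)) := by
    have := abs_sub (H w) (H z)
    have := h.bound w
    have := h.bound z
    rw [mul_add]; linarith
  have h2 := h.lip w z
  have e : D = D ^ a * D ^ (1 - a) := by
    rw [← Real.rpow_add' hD0 (by linarith), show a + (1 - a) = 1 by ring, Real.rpow_one]
  have hx := (jap_rpow_pos w (-m)).le
  have hy := (jap_rpow_pos z (-m)).le
  calc D = D ^ a * D ^ (1 - a) := e
    _ ≤ (B * ‖w - z‖) ^ a * (B * (jap w ^ (-m) + jap z ^ (-m))) ^ (1 - a) :=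
        mul_le_mul (Real.rpow_le_rpow hD0 h2 ha.le) (Real.rpow_le_rpow hD0 h1 (by linarith))
          (Real.rpow_nonneg hD0 _) (Real.rpow_nonneg (mul_nonneg hB (norm_nonneg _)) _)
    _ = (B ^ a * B ^ (1 - a)) * ‖w - z‖ ^ a * (jap w ^ (-m) + jap z ^ (-m)) ^ (1 - a) := by
        rw [Real.mul_rpow hB (norm_nonneg _), Real.mul_rpow hB (add_nonneg hx hy)]; ring
    _ = B * ‖w - z‖ ^ a * (jap w ^ (-m) + jap z ^ (-m)) ^ (1 - a) := by
        rw [← Real.rpow_add' hB (by linarith), show a + (1 - a) = 1 by ring, Real.rpow_one]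
    _ ≤ _ := by
        refine mul_le_mul_of_nonneg_left ?_ (by positivity)
        refine (rpow_add_le_add_rpow' hx hy (by linarith) (by linarith)).trans_eq ?_
        rw [← Real.rpow_mul (jap_pos _).le, ← Real.rpow_mul (jap_pos _).le]
        congr 2 <;> ring

lemma VLip.holder_near (h : VLip m B H) (hm : 0 ≤ m) (ha : 0 < a) (ha1 : a < 1) {v w : E3}
    (hvw : jap v ≤ 4 * jap w) :
    |H v - H w| ≤ (1 + 4 ^ m) * B * ‖v - w‖ ^ a * jap v ^ (-((1 - a) * m)) := by
  have hB := h.nonneg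
  refine (h.holder ha ha1 v w).trans ?_
  have h1 := jap_rpow_neg_le (r := (1 - a) * m) four_pos (by nlinarith) hvw
  have h2 : (4 : ℝ) ^ ((1 - a) * m) ≤ 4 ^ m :=
    Real.rpow_le_rpow_of_exponent_le (by norm_num) (by nlinarith)
  have h3 := mul_le_mul_of_nonneg_right h2 (jap_rpow_pos v (-((1 - a) * m))).le
  calc _ ≤ B * ‖v - w‖ ^ a * (jap v ^ (-((1 - a) * m)) + 4 ^ m * jap v ^ (-((1 - a) * m))) :=
        mul_le_mul_of_nonneg_left (by linarith) (by positivity)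
    _ = _ := by ring

lemma WLip.vLip {m₀ m₁ A : ℝ} {φ : E3 × E3 → ℝ} (h : WLip m₀ m₁ A φ) (hm : 0 ≤ m₀) (hm' : 0 ≤ m₁)
    (x : E3) : VLip m₀ (2 * A) (fun v => φ (x, v)) := by
  refine ⟨fun w => (h.bound (x, w)).trans (mul_le_mul_of_nonneg_right (by linarith [h.nonneg])
    (jap_rpow_pos _ _).le), fun w z => ?_⟩
  have h1 := h.lip_global hm hm' (x, w) (x, z)
  have h2 : ‖((x, w) : E3 × E3) - (x, z)‖ = ‖w - z‖ := by simp [Prod.norm_def]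
  rwa [h2] at h1

end

/-! ### The cut-off in the velocity -/

section
variable {ψ : E3 → ℝ} {L Λ δ : ℝ}

lemma IsCutoff.exists_lip (h : IsCutoff ψ) : ∃ L : ℝ, 1 ≤ L ∧ (∀ v w, |ψ v - ψ w| ≤ L * ‖v - w‖) ∧
    ∀ v w k, |ψ (v + k) - ψ v - (ψ (w + k) - ψ w)| ≤ L * ‖k‖ * ‖v - w‖ := by
  obtain ⟨C1, hC1⟩ := ContDiff.lipschitzWith_of_hasCompactSupport (𝕂 := ℝ) h.hasCompactSupport
    h.smooth (by simp)
  have hs : ContDiff ℝ 1 (fderiv ℝ ψ) := h.smooth.fderiv_right (m := 1) (by norm_num; exact WithTop.coe_le_coe.2 le_top)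
  obtain ⟨C2, hC2⟩ := ContDiff.lipschitzWith_of_hasCompactSupport (𝕂 := ℝ)
    (h.hasCompactSupport.fderiv ℝ) hs one_ne_zero
  have hd : Differentiable ℝ ψ := h.smooth.differentiable (by simp)
  refine ⟨1 + C1 + C2, by linarith [C1.2, C2.2], fun v w => ?_, fun v w k => ?_⟩
  · have h1 := hC1.dist_le_mul v w
    rw [Real.dist_eq, dist_eq_norm] at h1
    exact h1.trans (mul_le_mul_of_nonneg_right (by linarith [C2.2]) (norm_nonneg _))
  · have h1 : ∀ x ∈ (univ : Set E3), HasFDerivWithinAt (fun x => ψ (x + k) - ψ x)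
        (fderiv ℝ ψ (x + k) - fderiv ℝ ψ x) univ x := fun x _ => by
      have h2 : HasFDerivAt (fun x => ψ (x + k)) (fderiv ℝ ψ (x + k)) x := by
        simpa [Function.comp_def] using (hd (x + k)).hasFDerivAt.comp x ((hasFDerivAt_id x).add_const k)
      exact (h2.sub (hd x).hasFDerivAt).hasFDerivWithinAt
    have h3 := convex_univ.norm_image_sub_le_of_norm_hasFDerivWithin_le (C := C2 * ‖k‖) h1
      (fun x _ => by
        have := hC2.dist_le_mul (x + k) x
        rwa [dist_eq_norm, dist_eq_norm, add_sub_cancel_left] at this) (mem_univ w) (mem_univ v)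
    rw [Real.norm_eq_abs] at h3
    refine h3.trans (mul_le_mul_of_nonneg_right (mul_le_mul_of_nonneg_right
      (by linarith [C1.2]) (norm_nonneg _)) (norm_nonneg _))

lemma IsCutoff.abs_le_one (h : IsCutoff ψ) (v : E3) : |ψ v| ≤ 1 := by
  rw [abs_of_nonneg (h.nonneg v)]; exact h.le_one v

/-- The cut-off `ψ(δ·)` varies only where `δ⟨v⟩` is bounded. -/
lemma IsCutoff.abs_sub_mul_jap_le (h : IsCutoff ψ) (hL : 0 ≤ L)
    (hlip : ∀ v w, |ψ v - ψ w| ≤ L * ‖v - w‖) (hδ : 0 ≤ δ) (hδΛ : δ ≤ Λ) {v w : E3} {c : ℝ}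
    (hc : 1 ≤ c) (hvw : jap v ≤ c * jap w) :
    |ψ (δ • v) - ψ (δ • w)| * jap v ≤ L * (c * (1 + Λ)) * ‖v - w‖ := by
  have hJ := jap_pos v
  have h0 : ∀ u : E3, ‖δ • u‖ < 1 → δ * jap u ≤ 1 + Λ := fun u hu => by
    rw [norm_smul, Real.norm_of_nonneg hδ] at hu
    nlinarith [jap_le_one_add_norm u]
  have hΛ : 0 ≤ Λ := hδ.trans hδΛ
  have h1 : |ψ (δ • v) - ψ (δ • w)| ≤ L * (δ * ‖v - w‖) := by
    have := hlip (δ • v) (δ • w)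
    rwa [← smul_sub, norm_smul, Real.norm_of_nonneg hδ] at this
  have key : δ * jap v ≤ c * (1 + Λ) →
      |ψ (δ • v) - ψ (δ • w)| * jap v ≤ L * (c * (1 + Λ)) * ‖v - w‖ := fun hk =>
    calc _ ≤ L * (δ * ‖v - w‖) * jap v := mul_le_mul_of_nonneg_right h1 hJ.le
      _ = L * (δ * jap v) * ‖v - w‖ := by ring
      _ ≤ _ := mul_le_mul_of_nonneg_right (mul_le_mul_of_nonneg_left hk hL) (norm_nonneg _)
  by_cases hv : ‖δ • v‖ < 1
  · exact key ((h0 v hv).trans (le_mul_of_one_le_left (by linarith) hc))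
  by_cases hw : ‖δ • w‖ < 1
  · refine key ?_
    calc δ * jap v ≤ δ * (c * jap w) := mul_le_mul_of_nonneg_left hvw hδ
      _ = c * (δ * jap w) := by ring
      _ ≤ _ := mul_le_mul_of_nonneg_left (h0 w hw) (by linarith)
  · rw [h.eq_zero _ (not_lt.1 hv), h.eq_zero _ (not_lt.1 hw)]
    simp only [sub_self, abs_zero, zero_mul]
    positivity

lemma le_add_mul_rpow {x P Q t a : ℝ} (hP : 0 ≤ P) (hQ : 0 ≤ Q) (ht : 0 ≤ t) (h1 : x ≤ P)
    (h2 : x ≤ Q * t) (ha : 0 < a) (ha1 : a ≤ 1) : x ≤ (P + Q) * t ^ a := by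
  rcases le_or_gt t 1 with h | h
  · have h3 : t ≤ t ^ a := by
      have := Real.rpow_le_rpow_of_exponent_ge' ht h ha.le ha1
      rwa [Real.rpow_one] at this
    nlinarith [Real.rpow_nonneg ht a]
  · have h3 : 1 ≤ t ^ a := Real.one_le_rpow h.le ha.le
    nlinarith

lemma abs_jap_sub_le (v w : E3) : |jap v - jap w| ≤ ‖v - w‖ := by
  rw [abs_sub_le_iff]
  have h1 := jap_le_add v w
  have h2 := jap_le_add w v
  rw [norm_sub_rev] at h2
  constructor <;> linarith

/-- Hölder modulus of the truncated weight near `v`, with a gain of `⟨v⟩^{-a}`. -/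
lemma IsCutoff.abs_weight_sub_le (h : IsCutoff ψ) (hL : 0 ≤ L)
    (hlip : ∀ v w, |ψ v - ψ w| ≤ L * ‖v - w‖) (hδ : 0 ≤ δ) (hδΛ : δ ≤ Λ) {m a : ℝ} (hm : 0 ≤ m)
    (ha : 0 < a) (ha1 : a ≤ 1) {v w : E3} (hvw : jap v ≤ 4 * jap w) :
    |ψ (δ • v) * jap v ^ (-m) - ψ (δ • w) * jap w ^ (-m)| ≤
      (1 + L * (4 * (1 + Λ)) + (4 ^ m + m * 4 ^ (m + 1))) * ‖v - w‖ ^ a * jap v ^ (-(m + a)) := by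
  have hJ := jap_pos v
  have hΛ : 0 ≤ Λ := hδ.trans hδΛ
  set t := ‖v - w‖ / jap v with ht
  have ht0 : 0 ≤ t := by positivity
  have hX := jap_rpow_pos v (-m)
  have h1 : |ψ (δ • v) - ψ (δ • w)| ≤ (1 + L * (4 * (1 + Λ))) * t ^ a := by
    refine le_add_mul_rpow zero_le_one (by positivity) ht0 ?_ ?_ ha ha1
    · have := h.nonneg (δ • v)
      have := h.nonneg (δ • w)
      have := h.le_one (δ • v)
      have := h.le_one (δ • w)
      rw [abs_le]; constructor <;> linarith
    · have := h.abs_sub_mul_jap_le hL hlip hδ hδΛ (by norm_num) hvw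
      rw [ht, mul_div_assoc', le_div_iff₀ hJ]
      exact this
  have h4w := jap_rpow_neg_le four_pos hm hvw
  have hY := jap_rpow_pos w (-m)
  have h41 : (1 : ℝ) ≤ 4 ^ m := Real.one_le_rpow (by norm_num) hm
  have h2 : |jap v ^ (-m) - jap w ^ (-m)| ≤
      (4 ^ m * jap v ^ (-m) + m * 4 ^ (m + 1) * jap v ^ (-m)) * t ^ a := by
    refine le_add_mul_rpow (by positivity) (by positivity) ht0 ?_ ?_ ha ha1
    · rw [abs_le]; constructor <;> nlinarith
    · have h3 := abs_rpow_neg_sub_le (x := jap v) (y := jap w) (z := jap v / 4) (m := m)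
        (by positivity) (by linarith) (by linarith) hm
      have e : (jap v / 4) ^ (-m - 1) = 4 ^ (m + 1) * jap v ^ (-m) / jap v := by
        rw [Real.div_rpow hJ.le (by norm_num), Real.rpow_sub_one hJ.ne',
          show -m - 1 = -(m + 1) by ring, Real.rpow_neg (by norm_num : (0 : ℝ) ≤ 4), div_inv_eq_mul]
        ring
      rw [e] at h3
      calc _ ≤ m * (4 ^ (m + 1) * jap v ^ (-m) / jap v) * ‖v - w‖ :=
            h3.trans (mul_le_mul_of_nonneg_left (abs_jap_sub_le v w) (by positivity))
        _ = _ := by rw [ht]; ring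
  have e : ψ (δ • v) * jap v ^ (-m) - ψ (δ • w) * jap w ^ (-m) =
      (ψ (δ • v) - ψ (δ • w)) * jap v ^ (-m) + ψ (δ • w) * (jap v ^ (-m) - jap w ^ (-m)) := by ring
  have et : t ^ a * jap v ^ (-m) = ‖v - w‖ ^ a * jap v ^ (-(m + a)) := by
    rw [ht, Real.div_rpow (norm_nonneg _) hJ.le, show -(m + a) = -m - a by ring, Real.rpow_sub hJ]
    ring
  rw [e]
  refine (abs_add_le _ _).trans ?_
  rw [abs_mul, abs_mul, abs_of_pos hX]
  have h5 := mul_le_mul_of_nonneg_right h1 hX.le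
  have h6 := mul_le_mul (h.abs_le_one (δ • w)) h2 (abs_nonneg _) zero_le_one
  calc _ ≤ (1 + L * (4 * (1 + Λ))) * t ^ a * jap v ^ (-m) +
        1 * ((4 ^ m * jap v ^ (-m) + m * 4 ^ (m + 1) * jap v ^ (-m)) * t ^ a) := add_le_add h5 h6
    _ = (1 + L * (4 * (1 + Λ)) + (4 ^ m + m * 4 ^ (m + 1))) * (t ^ a * jap v ^ (-m)) := by ring
    _ = _ := by rw [et]; ring

end

/-! ### Consequences of the bound for the collision operator -/

section
variable {γ s : ℝ} {b : ℝ → ℝ} {β : ℝ}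

/-- `Q(G, H)` for Lipschitz `H`: the loss of decay in the Hölder modulus of `H` is harmless as `m₀`
is large. -/
theorem collision_lip (h : KernelHyp γ s b β) {a m₀ m₁ : ℝ} (ha : 2 * s < a) (ha1 : a < 1)
    (hm₁ : 3 + γ + a < m₁) (hm₀ : m₁ + a ≤ (1 - a) * m₀) :
    ∃ C : ℝ, 0 ≤ C ∧ ∀ (G H : E3 → ℝ) (A A' B : ℝ) (v : E3), 0 ≤ A →
      (∀ w, |G w| ≤ A * jap w ^ (-m₁)) → VLip m₀ A' G → VLip m₀ B H →
      Integrable (collInt γ s b G H v) pairMeas ∧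
      |collisionQ γ s b G H v| ≤ C * A * B * jap v ^ (-m₁) := by
  have hγ := h.neg_three_lt
  have hs := h.s_pos
  have hm₁0 : 0 < m₁ := by linarith
  have hm₀0 : 0 < m₀ := by
    by_contra hc
    nlinarith
  have hle : m₁ + a ≤ m₀ := by nlinarith
  obtain ⟨C, hC, hQ⟩ := collision_bound h (l := m₁) (l' := (1 - a) * m₀) (m := m₀)
    (n := (1 - a) * m₀) (k := m₁) ha ha1 hm₁ (by linarith) le_rfl (by linarith) hm₀ (by nlinarith)
    (by linarith)
  refine ⟨C * (1 + 4 ^ m₀), by positivity, fun G H A A' B v hA hG hGL hHL => ?_⟩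
  have hB := hHL.nonneg
  have h41 : (0 : ℝ) ≤ 4 ^ m₀ := by positivity
  have h1 := hQ G H A ((1 + 4 ^ m₀) * B) v hA (by positivity) hGL.continuous hHL.continuous hG
    ⟨A', fun w z => hGL.holder (by linarith) ha1 w z⟩
    (fun w => (hHL.bound w).trans (mul_le_mul_of_nonneg_right (by nlinarith)
      (jap_rpow_pos _ _).le))
    (fun w hw => hHL.holder_near hm₀0.le (by linarith) ha1 hw)
  exact ⟨h1.1, h1.2.trans_eq (by ring)⟩

/-- `Q(G, ·)` applied to a truncated weight of lower order than the decay of `G`. -/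
theorem collision_weight (h : KernelHyp γ s b β) {a m₀ m : ℝ} (ha : 2 * s < a) (ha1 : a < 1)
    (hm₀ : 3 + γ + a < (1 - a) * m₀) (hm : 3 + γ < m) (hmm : m ≤ m₀) {ψ : E3 → ℝ} (hψ : IsCutoff ψ)
    {Λ : ℝ} (hΛ : 0 ≤ Λ) :
    ∃ C : ℝ, 0 ≤ C ∧ ∀ (G : E3 → ℝ) (A δ : ℝ) (v : E3), 0 ≤ δ → δ ≤ Λ → VLip m₀ A G →
      Integrable (collInt γ s b G (fun w => ψ (δ • w) * jap w ^ (-m)) v) pairMeas ∧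
      |collisionQ γ s b G (fun w => ψ (δ • w) * jap w ^ (-m)) v| ≤ C * A * jap v ^ (-m) := by
  have hγ := h.neg_three_lt
  have hs := h.s_pos
  have hm0 : 0 < m := by linarith
  have hle : 3 + γ + a < m₀ := by nlinarith
  obtain ⟨L, hL1, hlip, -⟩ := hψ.exists_lip
  obtain ⟨C, hC, hQ⟩ := collision_bound h (l := m₀) (l' := (1 - a) * m₀) (m := m)
    (n := m + a) (k := m) ha ha1 hle hm hmm le_rfl le_rfl le_rfl hm₀
  set D : ℝ := 1 + L * (4 * (1 + Λ)) + (4 ^ m + m * 4 ^ (m + 1)) with hD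
  have hD1 : 1 ≤ D := by
    have : 0 ≤ L * (4 * (1 + Λ)) := by positivity
    have : 0 ≤ (4 : ℝ) ^ m + m * 4 ^ (m + 1) := by positivity
    linarith
  refine ⟨C * D, by positivity, fun G A δ v hδ hδΛ hG => ?_⟩
  have hcont : Continuous fun w => ψ (δ • w) * jap w ^ (-m) :=
    (hψ.continuous.comp (continuous_const_smul δ)).mul (continuous_jap_rpow _)
  have h1 := hQ G _ A D v hG.nonneg (by positivity) hG.continuous hcont hG.bound
    ⟨A, fun w z => hG.holder (by linarith) ha1 w z⟩
    (fun w => by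
      rw [abs_mul, abs_of_pos (jap_rpow_pos _ _)]
      exact mul_le_mul_of_nonneg_right ((hψ.abs_le_one _).trans hD1) (jap_rpow_pos _ _).le)
    (fun w hw => hψ.abs_weight_sub_le (by linarith) hlip hδ hδΛ hm0.le (by linarith) ha1.le hw)
  exact ⟨h1.1, h1.2.trans_eq (by ring)⟩

/-- For `G ≥ 0` the operator `Q(G, ·)` respects the order of functions touching at `v`. -/
lemma collisionQ_mono (h : KernelHyp γ s b β) {G H H' : E3 → ℝ} {v : E3} (hG : ∀ w, 0 ≤ G w)
    (hle : ∀ w, H w ≤ H' w) (heq : H v = H' v) (hi : Integrable (collInt γ s b G H v) pairMeas)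
    (hi' : Integrable (collInt γ s b G H' v) pairMeas) :
    collisionQ γ s b G H v ≤ collisionQ γ s b G H' v := by
  rw [collisionQ_eq, collisionQ_eq]
  refine integral_mono hi hi' fun p => ?_
  simp only [collInt, heq]
  refine mul_le_mul_of_nonneg_left ?_ (h.kernelB_nonneg _ _)
  have := mul_le_mul_of_nonneg_left (hle (v - halfDiff p.1 p.2)) (hG (v - halfSum p.1 p.2))
  linarith

lemma collisionQ_add_right {G H H' : E3 → ℝ} {v : E3}
    (hi : Integrable (collInt γ s b G H v) pairMeas)
    (hi' : Integrable (collInt γ s b G H' v) pairMeas) :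
    collisionQ γ s b G (fun w => H w + H' w) v =
      collisionQ γ s b G H v + collisionQ γ s b G H' v := by
  rw [collisionQ_eq, collisionQ_eq, collisionQ_eq, ← integral_add hi hi']
  refine integral_congr_ae (Eventually.of_forall fun p => ?_)
  simp only [collInt]
  ring

lemma integrable_collInt_add_right {G H H' : E3 → ℝ} {v : E3}
    (hi : Integrable (collInt γ s b G H v) pairMeas)
    (hi' : Integrable (collInt γ s b G H' v) pairMeas) :
    Integrable (collInt γ s b G (fun w => H w + H' w) v) pairMeas := by
  refine (hi.add hi').congr (Eventually.of_forall fun p => ?_)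
  simp only [Pi.add_apply, collInt]
  ring

lemma collisionQ_add_left {G G' H : E3 → ℝ} {v : E3}
    (hi : Integrable (collInt γ s b G H v) pairMeas)
    (hi' : Integrable (collInt γ s b G' H v) pairMeas) :
    collisionQ γ s b (fun w => G w + G' w) H v =
      collisionQ γ s b G H v + collisionQ γ s b G' H v := by
  rw [collisionQ_eq, collisionQ_eq, collisionQ_eq, ← integral_add hi hi']
  refine integral_congr_ae (Eventually.of_forall fun p => ?_)
  simp only [collInt]
  ring

lemma collisionQ_const_mul_right (c : ℝ) (G H : E3 → ℝ) (v : E3) :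
    collisionQ γ s b G (fun w => c * H w) v = c * collisionQ γ s b G H v := by
  rw [collisionQ_eq, collisionQ_eq, ← integral_const_mul]
  refine integral_congr_ae (Eventually.of_forall fun p => ?_)
  simp only [collInt]
  ring

lemma collisionQ_const_mul_left (c : ℝ) (G H : E3 → ℝ) (v : E3) :
    collisionQ γ s b (fun w => c * G w) H v = c * collisionQ γ s b G H v := by
  rw [collisionQ_eq, collisionQ_eq, ← integral_const_mul]
  refine integral_congr_ae (Eventually.of_forall fun p => ?_)
  simp only [collInt]
  ring

lemma integrable_collInt_const_mul_right (c : ℝ) {G H : E3 → ℝ} {v : E3}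
    (hi : Integrable (collInt γ s b G H v) pairMeas) :
    Integrable (collInt γ s b G (fun w => c * H w) v) pairMeas := by
  refine (hi.const_mul c).congr (Eventually.of_forall fun p => ?_)
  simp only [collInt]
  ring

/-- The collision operator commutes with translations of the velocity. -/
lemma collisionQ_translate (G H : E3 → ℝ) (v k : E3) :
    collisionQ γ s b (fun w => G (w + k)) (fun w => H (w + k)) v = collisionQ γ s b G H (v + k) := by
  rw [collisionQ_eq, collisionQ_eq]
  refine integral_congr_ae (Eventually.of_forall fun p => ?_)
  simp only [collInt, sub_add_eq_add_sub]

end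

/-! ### The Laplacian at a touching point -/

lemma deriv_deriv_nonneg_of_min {D : ℝ → ℝ} (hD : ContDiff ℝ 2 D) (h : ∀ t, D 0 ≤ D t) :
    0 ≤ deriv (deriv D) 0 := by
  by_contra! hneg
  have hmin : IsLocalMin D 0 := Eventually.of_forall h
  have hmax := isLocalMax_of_deriv_deriv_neg hneg hmin.deriv_eq_zero hD.continuous.continuousAt
  -- a local minimum that is also a local maximum is locally constant
  have hconst : D =ᶠ[𝓝 0] fun _ => D 0 := by
    filter_upwards [hmax] with t ht
    exact le_antisymm ht (h t)
  rw [hconst.deriv.deriv_eq] at hneg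
  simp at hneg

lemma iteratedFDeriv_two_eq_deriv_deriv {f : E3 → ℝ} (hf : ContDiff ℝ 2 f) (x e : E3) :
    iteratedFDeriv ℝ 2 f x ![e, e] = deriv (deriv fun t : ℝ => f (x + t • e)) 0 := by
  have hl : ∀ t : ℝ, HasDerivAt (fun t : ℝ => x + t • e) e t := fun t => by
    simpa using ((hasDerivAt_id t).smul_const e).const_add x
  have h1 : (deriv fun t : ℝ => f (x + t • e)) = fun t => fderiv ℝ f (x + t • e) e := by
    funext t
    exact ((hf.differentiable (by norm_num)).differentiableAt.hasFDerivAt.comp_hasDerivAt t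
      (hl t)).deriv
  have hd : Differentiable ℝ (fderiv ℝ f) :=
    (hf.fderiv_right (m := 1) (by norm_num)).differentiable one_ne_zero
  have h2 : HasDerivAt (fun t : ℝ => fderiv ℝ f (x + t • e))
      (fderiv ℝ (fderiv ℝ f) (x + (0 : ℝ) • e) e) 0 :=
    (hd _).hasFDerivAt.comp_hasDerivAt (0 : ℝ) (hl 0)
  rw [h1, iteratedFDeriv_two_apply, (h2.clm_apply (hasDerivAt_const (0 : ℝ) e)).deriv]
  simp

lemma laplacian_le_of_touch {f g : E3 → ℝ} (hf : ContDiff ℝ 2 f) (hg : ContDiff ℝ 2 g)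
    (hle : ∀ x, f x ≤ g x) {x : E3} (heq : f x = g x) :
    Laplacian.laplacian f x ≤ Laplacian.laplacian g x := by
  rw [InnerProductSpace.laplacian_eq_iteratedFDeriv_stdOrthonormalBasis,
    InnerProductSpace.laplacian_eq_iteratedFDeriv_stdOrthonormalBasis]
  refine Finset.sum_le_sum fun i _ => ?_
  set e := stdOrthonormalBasis ℝ E3 i
  have hgf : ContDiff ℝ 2 (g - f) := hg.sub hf
  have h1 : 0 ≤ iteratedFDeriv ℝ 2 (g - f) x ![e, e] := by
    rw [iteratedFDeriv_two_eq_deriv_deriv hgf]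
    refine deriv_deriv_nonneg_of_min (hgf.comp (by fun_prop)) fun t => ?_
    simp only [zero_smul, add_zero, Pi.sub_apply, heq, sub_self, sub_nonneg]
    exact hle _
  have h2 : iteratedFDeriv ℝ 2 (g - f) x = iteratedFDeriv ℝ 2 g x - iteratedFDeriv ℝ 2 f x :=
    iteratedFDeriv_sub_apply hg.contDiffAt hf.contDiffAt
  rw [h2] at h1
  simpa using h1

lemma jap_rpow_eq (v : E3) (r : ℝ) : jap v ^ r = (1 + ‖v‖ ^ 2) ^ (r / 2) := by
  rw [jap, Real.sqrt_eq_rpow, ← Real.rpow_mul (by positivity)]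
  congr 1; ring

lemma contDiff_jap_rpow (r : ℝ) : ContDiff ℝ 2 fun v : E3 => jap v ^ r := by
  simp only [jap_rpow_eq]
  exact (contDiff_const.add (contDiff_norm_sq ℝ)).rpow_const_of_ne fun v => by positivity

lemma laplacian_jap_le {m : ℝ} (hm : 0 ≤ m) (v : E3) :
    Laplacian.laplacian (fun v : E3 => jap v ^ (-m)) v ≤ 3 * (m * (m + 2)) * jap v ^ (-m) := by
  rw [InnerProductSpace.laplacian_eq_iteratedFDeriv_stdOrthonormalBasis]
  have key : ∀ e : E3, ‖e‖ = 1 → iteratedFDeriv ℝ 2 (fun v : E3 => jap v ^ (-m)) v ![e, e] ≤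
      m * (m + 2) * jap v ^ (-m) := by
    intro e he
    rw [iteratedFDeriv_two_eq_deriv_deriv (contDiff_jap_rpow _)]
    set c : ℝ := inner ℝ v e with hc
    have hcv : |c| ≤ ‖v‖ := by
      have := abs_real_inner_le_norm v e
      rwa [he, mul_one] at this
    set P : ℝ → ℝ := fun t => 1 + ‖v‖ ^ 2 + 2 * t * c + t ^ 2 with hP
    have hPe : ∀ t : ℝ, 1 + ‖v + t • e‖ ^ 2 = P t := fun t => by
      rw [norm_add_sq_real, norm_smul, he, inner_smul_right, mul_one, Real.norm_eq_abs, sq_abs, hP]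
      ring
    have hP0 : ∀ t, 0 < P t := fun t => by rw [← hPe]; positivity
    have hPd : ∀ t, HasDerivAt P (2 * c + 2 * t) t := fun t => by
      have h1 : HasDerivAt (fun t : ℝ => 2 * t * c) (2 * c) t := by
        simpa using ((hasDerivAt_id t).const_mul 2).mul_const c
      have h2 : HasDerivAt (fun t : ℝ => t ^ 2) (2 * t) t := by simpa using hasDerivAt_pow 2 t
      exact (h1.const_add (1 + ‖v‖ ^ 2)).add h2
    have h1 : (deriv fun t : ℝ => jap (v + t • e) ^ (-m)) =
        fun t => (2 * c + 2 * t) * (-m / 2) * P t ^ (-m / 2 - 1) := by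
      funext t
      have e1 : (fun t : ℝ => jap (v + t • e) ^ (-m)) = fun t => P t ^ (-m / 2) := by
        funext t; rw [jap_rpow_eq, hPe]
      rw [e1]
      exact ((hPd t).rpow_const (Or.inl (hP0 t).ne')).deriv
    have h2 : HasDerivAt (fun t : ℝ => (2 * c + 2 * t) * (-m / 2)) (2 * (-m / 2)) 0 := by
      simpa using (((hasDerivAt_id (0 : ℝ)).const_mul 2).const_add (2 * c)).mul_const (-m / 2)
    have h3 := (hPd 0).rpow_const (p := -m / 2 - 1) (Or.inl (hP0 0).ne')
    have h4 : HasDerivAt (fun t => (2 * c + 2 * t) * (-m / 2) * P t ^ (-m / 2 - 1)) _ 0 := h2.mul h3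
    rw [h1, h4.deriv]
    have hPz : P 0 = 1 + ‖v‖ ^ 2 := by simp [hP]
    rw [jap_rpow_eq, ← hPz]
    set X := P 0 ^ (-m / 2) with hX
    have hX0 : 0 < X := Real.rpow_pos_of_pos (hP0 0) _
    have hc2 : c ^ 2 ≤ P 0 := by
      have := sq_le_sq' (abs_le.1 hcv).1 (abs_le.1 hcv).2
      rw [hPz]; linarith
    have e3 : P 0 ^ (-m / 2 - 1) = X / P 0 := Real.rpow_sub_one (hP0 0).ne' _
    have e4 : P 0 ^ (-m / 2 - 1 - 1) = X / P 0 / P 0 := by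
      rw [Real.rpow_sub_one (hP0 0).ne', e3]
    rw [e3, e4]
    have hY : 0 < X / P 0 := div_pos hX0 (hP0 0)
    have hc3 : c ^ 2 / P 0 ≤ 1 := (div_le_one (hP0 0)).2 hc2
    calc _ = -(m * (X / P 0)) + m * (m + 2) * X * (c ^ 2 / P 0) * (1 / P 0) := by
          field_simp; ring
      _ ≤ 0 + m * (m + 2) * X * 1 * 1 := by
          refine add_le_add (neg_nonpos.2 (by positivity)) ?_
          refine mul_le_mul (mul_le_mul_of_nonneg_left hc3 (by positivity)) ?_
            (by have := hP0 0; positivity) (by positivity)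
          rw [div_le_one (hP0 0), hPz]
          nlinarith [sq_nonneg ‖v‖]
      _ = m * (m + 2) * X := by ring
  refine (Finset.sum_le_sum fun i _ => key _ ((stdOrthonormalBasis ℝ E3).orthonormal.1 i)).trans ?_
  rw [Finset.sum_const, Finset.card_univ, Fintype.card_fin, finrank_euclideanSpace_fin, nsmul_eq_mul]
  push_cast
  linarith

/-! ### The comparison weights -/

/-- The weight `⟨v⟩^{-m} + η ⟨v⟩^{-m+κ}`.  The second term decays more slowly than the functions to
be compared, so that the comparison takes place on a compact set; `η` is then sent to `0`. -/
def cmpWeight (m κ η : ℝ) (v : E3) : ℝ := jap v ^ (-m) + η * jap v ^ (-(m - κ))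

section
variable {m κ η : ℝ}

lemma continuous_cmpWeight : Continuous (cmpWeight m κ η) :=
  (continuous_jap_rpow _).add ((continuous_jap_rpow _).const_mul η)

lemma contDiff_cmpWeight : ContDiff ℝ 2 (cmpWeight m κ η) :=
  (contDiff_jap_rpow _).add (contDiff_const.mul (contDiff_jap_rpow _))

lemma jap_le_cmpWeight (hη : 0 ≤ η) (v : E3) : jap v ^ (-m) ≤ cmpWeight m κ η v :=
  le_add_of_nonneg_right (mul_nonneg hη (jap_rpow_pos _ _).le)

lemma cmpWeight_pos (hη : 0 ≤ η) (v : E3) : 0 < cmpWeight m κ η v :=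
  (jap_rpow_pos _ _).trans_le (jap_le_cmpWeight hη v)

lemma laplacian_cmpWeight_le (hκ : 0 ≤ κ) (hκm : κ ≤ m) (hη : 0 ≤ η) (v : E3) :
    Laplacian.laplacian (cmpWeight m κ η) v ≤ 3 * (m * (m + 2)) * cmpWeight m κ η v := by
  have h1 : cmpWeight m κ η = (fun v => jap v ^ (-m)) + η • fun v => jap v ^ (-(m - κ)) := by
    funext v; simp [cmpWeight]
  have h2 : Laplacian.laplacian (cmpWeight m κ η) v =
      Laplacian.laplacian (fun v : E3 => jap v ^ (-m)) v +
        η * Laplacian.laplacian (fun v : E3 => jap v ^ (-(m - κ))) v := by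
    have h3 : ContDiff ℝ 2 (η • fun v : E3 => jap v ^ (-(m - κ))) :=
      (contDiff_jap_rpow _).const_smul η
    rw [h1, ContDiffAt.laplacian_add (contDiff_jap_rpow _).contDiffAt h3.contDiffAt,
      InnerProductSpace.laplacian_smul η (contDiff_jap_rpow _).contDiffAt, smul_eq_mul]
  rw [h2, cmpWeight, mul_add]
  refine add_le_add (laplacian_jap_le (hκ.trans hκm) v) ?_
  have h3 := laplacian_jap_le (m := m - κ) (by linarith) v
  have h4 : 3 * ((m - κ) * (m - κ + 2)) * jap v ^ (-(m - κ)) ≤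
      3 * (m * (m + 2)) * jap v ^ (-(m - κ)) :=
    mul_le_mul_of_nonneg_right (by nlinarith) (jap_rpow_pos _ _).le
  calc _ ≤ η * (3 * (m * (m + 2)) * jap v ^ (-(m - κ))) :=
        mul_le_mul_of_nonneg_left (h3.trans h4) hη
    _ = _ := by ring

/-- Functions that decay like `⟨v⟩^{-m}` are eventually below any multiple of the weight. -/
lemma exists_le_cmpWeight (hκ : 0 < κ) (hη : 0 < η) (A : ℝ) {c : ℝ} (hc : 0 < c) :
    ∃ R, ∀ v : E3, R ≤ ‖v‖ → A * jap v ^ (-m) ≤ c * cmpWeight m κ η v := by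
  refine ⟨(|A| / (c * η)) ^ (1 / κ), fun v hv => ?_⟩
  have h1 : |A| / (c * η) ≤ jap v ^ κ := by
    have h2 := Real.rpow_le_rpow (by positivity) (hv.trans (norm_le_jap v)) hκ.le
    rwa [← Real.rpow_mul (by positivity), one_div_mul_cancel hκ.ne', Real.rpow_one] at h2
  rw [div_le_iff₀ (by positivity)] at h1
  have e : jap v ^ (-(m - κ)) = jap v ^ κ * jap v ^ (-m) := by
    rw [← jap_rpow_add]; congr 1; ring
  have hJ := jap_rpow_pos v (-m)
  rw [cmpWeight, e]
  have := mul_le_mul_of_nonneg_right ((le_abs_self A).trans h1) hJ.le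
  nlinarith [mul_pos hc hJ]

/-- Terms of `Δ_{x,v}` at a point where `w` touches a multiple of the weight from below. -/
lemma laplXV_le_of_touch {w : E3 × E3 → ℝ} (hw : ContDiff ℝ 2 w) (hκ : 0 ≤ κ) (hκm : κ ≤ m)
    (hη : 0 ≤ η) {N : ℝ} (hN : 0 ≤ N) (hle : ∀ z, w z ≤ N * cmpWeight m κ η z.2) {z : E3 × E3}
    (heq : w z = N * cmpWeight m κ η z.2) :
    laplXV w z ≤ 3 * (m * (m + 2)) * (N * cmpWeight m κ η z.2) := by
  have h1 : Laplacian.laplacian (fun x : E3 => w (x, z.2)) z.1 ≤ 0 := by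
    have hwx : ContDiff ℝ 2 fun x : E3 => w (x, z.2) := hw.comp (by fun_prop)
    refine (laplacian_le_of_touch hwx contDiff_const
      (fun x => hle (x, z.2)) heq).trans_eq ?_
    simp
  have h2 : Laplacian.laplacian (fun v : E3 => w (z.1, v)) z.2 ≤
      Laplacian.laplacian (N • cmpWeight m κ η) z.2 :=
    have hwv : ContDiff ℝ 2 fun v : E3 => w (z.1, v) := hw.comp (by fun_prop)
    laplacian_le_of_touch hwv (contDiff_cmpWeight.const_smul N)
      (fun v => hle (z.1, v)) heq
  rw [InnerProductSpace.laplacian_smul N contDiff_cmpWeight.contDiffAt, smul_eq_mul] at h2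
  have h3 := mul_le_mul_of_nonneg_left (laplacian_cmpWeight_le (m := m) hκ hκm hη z.2) hN
  rw [laplXV]
  linarith

/-- The `x`-derivative vanishes at a touching point as the weight depends only on `v`. -/
lemma fderiv_eq_zero_of_touch {w : E3 × E3 → ℝ} {q : E3 → ℝ} {z : E3 × E3}
    (hw : DifferentiableAt ℝ w z) (hle : ∀ z, w z ≤ q z.2) (heq : w z = q z.2) (e : E3) :
    fderiv ℝ w z (e, 0) = 0 := by
  have hl : HasDerivAt (fun t : ℝ => z + t • ((e, 0) : E3 × E3)) (e, 0) 0 := by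
    simpa using ((hasDerivAt_id (0 : ℝ)).smul_const ((e, 0) : E3 × E3)).const_add z
  have h0 : z + (0 : ℝ) • ((e, 0) : E3 × E3) = z := by simp
  have hd : HasDerivAt (fun t : ℝ => w (z + t • ((e, 0) : E3 × E3))) (fderiv ℝ w z (e, 0)) 0 := by
    have h1 : HasFDerivAt w (fderiv ℝ w z) (z + (0 : ℝ) • ((e, 0) : E3 × E3)) := by
      rw [h0]; exact hw.hasFDerivAt
    exact h1.comp_hasDerivAt (0 : ℝ) hl
  have hmax : IsLocalMax (fun t : ℝ => w (z + t • ((e, 0) : E3 × E3))) 0 := by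
    refine Eventually.of_forall fun t => ?_
    simp only [h0, heq]
    exact (hle _).trans_eq (by simp)
  exact hmax.hasDerivAt_eq_zero hd

/-- The derivatives of a combination of `F` and a translate of `F`. -/
lemma laplXV_comb {F : E3 × E3 → ℝ} (hF : ContDiff ℝ 2 F) (c c' : ℝ) (k z : E3 × E3) :
    laplXV (fun z => c * F (z + k) + c' * F z) z = c * laplXV F (z + k) + c' * laplXV F z := by
  have key : ∀ (u : E3 → ℝ) (l x : E3), Laplacian.laplacian (fun x => u (x + l)) x =
      Laplacian.laplacian u (x + l) := fun u l x => by
    rw [InnerProductSpace.laplacian_eq_iteratedFDeriv_stdOrthonormalBasis,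
      InnerProductSpace.laplacian_eq_iteratedFDeriv_stdOrthonormalBasis]
    simp only [iteratedFDeriv_comp_add_right]
  have key2 : ∀ (u u' : E3 → ℝ) (l x : E3), ContDiff ℝ 2 u → ContDiff ℝ 2 u' →
      Laplacian.laplacian (fun x => c * u (x + l) + c' * u' x) x =
        c * Laplacian.laplacian u (x + l) + c' * Laplacian.laplacian u' x := by
    intro u u' l x hu hu'
    have hul : ContDiff ℝ 2 fun x => u (x + l) := hu.comp (by fun_prop)
    have h1 : ContDiff ℝ 2 (c • fun x => u (x + l)) := hul.const_smul c
    have h2 : ContDiff ℝ 2 (c' • u') := hu'.const_smul c'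
    have e : (fun x => c * u (x + l) + c' * u' x) = (c • fun x => u (x + l)) + c' • u' := rfl
    rw [e, ContDiffAt.laplacian_add h1.contDiffAt h2.contDiffAt,
      InnerProductSpace.laplacian_smul c hul.contDiffAt,
      InnerProductSpace.laplacian_smul c' hu'.contDiffAt, key, smul_eq_mul, smul_eq_mul]
  have h1 := key2 (fun x => F (x, z.2 + k.2)) (fun x => F (x, z.2)) k.1 z.1
    (hF.comp (by fun_prop)) (hF.comp (by fun_prop))
  have h2 := key2 (fun v => F (z.1 + k.1, v)) (fun v => F (z.1, v)) k.2 z.2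
    (hF.comp (by fun_prop)) (hF.comp (by fun_prop))
  simp only [laplXV]
  change Laplacian.laplacian (fun x => c * F (x + k.1, z.2 + k.2) + c' * F (x, z.2)) z.1 +
    Laplacian.laplacian (fun v => c * F (z.1 + k.1, v + k.2) + c' * F (z.1, v)) z.2 = _
  rw [h1, h2]
  simp only [Prod.fst_add, Prod.snd_add]
  ring

lemma fderiv_comb {F : E3 × E3 → ℝ} (hF : Differentiable ℝ F) (c c' : ℝ) (k z : E3 × E3) :
    HasFDerivAt (fun z => c * F (z + k) + c' * F z)
      (c • fderiv ℝ F (z + k) + c' • fderiv ℝ F z) z := by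
  have h1 : HasFDerivAt (fun z => F (z + k)) (fderiv ℝ F (z + k)) z :=
    (hasFDerivAt_comp_add_right k).2 (hF _).hasFDerivAt
  exact (h1.const_mul c).add ((hF z).hasFDerivAt.const_mul c')

end

/-! ### The collision operator at a touching point -/

section
variable {γ s : ℝ} {b : ℝ → ℝ} {β : ℝ} {ψ : E3 → ℝ} {Λ : ℝ}

/-- As `Q(G, ·)` respects the order, at a touching point it is enough to evaluate it at the
weight. -/
theorem collision_touch (h : KernelHyp γ s b β) {a m₀ m₁ m : ℝ} (ha : 2 * s < a) (ha1 : a < 1)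
    (hm₁ : 3 + γ + a < m₁) (hm₀ : m₁ + a ≤ (1 - a) * m₀) (hm : 3 + γ + 2 * s < m) (hmm : m ≤ m₀)
    (hψ : IsCutoff ψ) (hΛ : 0 ≤ Λ) :
    ∃ C : ℝ, 0 ≤ C ∧ ∀ (G W : E3 → ℝ) (A B δ η N : ℝ) (v : E3), 0 ≤ δ → δ ≤ Λ → 0 ≤ η → 0 ≤ N →
      VLip m₀ A G → (∀ w, 0 ≤ G w) → VLip m₀ B (fun w => ψ (δ • w) * W w) →
      (∀ w, W w ≤ N * cmpWeight m (2 * s) η w) → W v = N * cmpWeight m (2 * s) η v →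
      collisionQ γ s b G (fun w => ψ (δ • w) * W w) v ≤
        C * A * N * cmpWeight m (2 * s) η v := by
  have hs := h.s_pos
  have hγ := h.neg_three_lt
  have hm₀' : 0 < m₀ := by linarith
  have hle : m₁ ≤ m₀ := by nlinarith
  obtain ⟨C1, hC1, hQ1⟩ := collision_weight h (m₀ := m₀) (m := m) ha ha1 (by linarith)
    (by linarith) hmm hψ hΛ
  obtain ⟨C2, hC2, hQ2⟩ := collision_weight h (m₀ := m₀) (m := m - 2 * s) ha ha1 (by linarith)
    (by linarith) (by linarith) hψ hΛ
  obtain ⟨C3, hC3, hQ3⟩ := collision_lip h (m₀ := m₀) (m₁ := m₁) ha ha1 hm₁ hm₀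
  refine ⟨C1 + C2, by positivity, fun G W A B δ η N v hδ hδΛ hη hN hG hG0 hW hle' heq => ?_⟩
  have hA := hG.nonneg
  obtain ⟨i1, q1⟩ := hQ1 G A δ v hδ hδΛ hG
  obtain ⟨i2, q2⟩ := hQ2 G A δ v hδ hδΛ hG
  have i3 := (hQ3 G _ A A B v hA (fun w => (hG.bound w).trans
    (mul_le_mul_of_nonneg_left (jap_rpow_le w (by linarith)) hA)) hG hW).1
  have i2' := integrable_collInt_const_mul_right η i2
  have i4 := integrable_collInt_const_mul_right N (integrable_collInt_add_right i1 i2')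
  have e : ∀ w, ψ (δ • w) * (N * cmpWeight m (2 * s) η w) = N * (ψ (δ • w) * jap w ^ (-m) +
      η * (ψ (δ • w) * jap w ^ (-(m - 2 * s)))) := fun w => by rw [cmpWeight]; ring
  refine (collisionQ_mono h hG0 (fun w => ?_) ?_ i3 i4).trans ?_
  · rw [← e]
    exact mul_le_mul_of_nonneg_left (hle' w) (hψ.nonneg _)
  · rw [← e, heq]
  · rw [collisionQ_const_mul_right, collisionQ_add_right i1 i2', collisionQ_const_mul_right]
    have p1 := jap_rpow_pos v (-m)
    have p2 := jap_rpow_pos v (-(m - 2 * s))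
    have b1 := (le_abs_self _).trans q1
    have b2 := mul_le_mul_of_nonneg_left ((le_abs_self _).trans q2) hη
    have hcA1 : 0 ≤ C1 * A := mul_nonneg hC1 hA
    have hcA2 : 0 ≤ C2 * A := mul_nonneg hC2 hA
    have hsum : C1 * A * jap v ^ (-m) + η * (C2 * A * jap v ^ (-(m - 2 * s))) ≤
        (C1 + C2) * A * (jap v ^ (-m) + η * jap v ^ (-(m - 2 * s))) := by
      nlinarith [mul_nonneg hcA1 (mul_nonneg hη p2.le), mul_nonneg hcA2 p1.le]
    have := mul_le_mul_of_nonneg_left ((add_le_add b1 b2).trans hsum) hN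
    rw [cmpWeight]
    linarith

/-- Cut-offs `ψ(δ·)` and their difference quotients are multipliers of Lipschitz functions. -/
lemma IsCutoff.exists_multiplier (hψ : IsCutoff ψ) (hΛ : 0 ≤ Λ) : ∃ L : ℝ, 1 ≤ L ∧
    ∀ (δ : ℝ) (k : E3) (c : ℝ), 0 ≤ δ → δ ≤ Λ → |c| * ‖k‖ ≤ 1 →
      (∀ v w, |ψ (δ • v) - ψ (δ • w)| ≤ L * ‖v - w‖) ∧
      (∀ v, |c * (ψ (δ • (v + k)) - ψ (δ • v))| ≤ L) ∧
      ∀ v w, |c * (ψ (δ • (v + k)) - ψ (δ • v)) - c * (ψ (δ • (w + k)) - ψ (δ • w))| ≤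
        L * ‖v - w‖ := by
  obtain ⟨L, hL, h1, h2⟩ := hψ.exists_lip
  refine ⟨L * (1 + Λ) ^ 2, by nlinarith, fun δ k c hδ hδΛ hck => ?_⟩
  have hL0 : 0 ≤ L := by linarith
  have hδ1 : L * δ ≤ L * (1 + Λ) ^ 2 := mul_le_mul_of_nonneg_left (by nlinarith) hL0
  have hδ2 : L * δ ^ 2 ≤ L * (1 + Λ) ^ 2 := mul_le_mul_of_nonneg_left (by nlinarith) hL0
  have hlip : ∀ v w, |ψ (δ • v) - ψ (δ • w)| ≤ L * δ * ‖v - w‖ := fun v w => by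
    have := h1 (δ • v) (δ • w)
    rwa [← smul_sub, norm_smul, Real.norm_of_nonneg hδ, ← mul_assoc] at this
  refine ⟨fun v w => (hlip v w).trans (mul_le_mul_of_nonneg_right hδ1 (norm_nonneg _)),
    fun v => ?_, fun v w => ?_⟩
  · rw [abs_mul]
    have h3 := mul_le_mul_of_nonneg_left (hlip (v + k) v) (abs_nonneg c)
    rw [add_sub_cancel_left] at h3
    have h4 := mul_le_mul_of_nonneg_left hck (mul_nonneg hL0 hδ)
    linarith
  · rw [← mul_sub, abs_mul]
    have h3 := h2 (δ • v) (δ • w) (δ • k)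
    rw [← smul_sub, norm_smul, norm_smul, Real.norm_of_nonneg hδ, ← smul_add, ← smul_add] at h3
    have h4 := mul_le_mul_of_nonneg_left h3 (abs_nonneg c)
    have h5 := mul_le_mul_of_nonneg_right hck
      (mul_nonneg (mul_nonneg hL0 (sq_nonneg δ)) (norm_nonneg (v - w)))
    have h6 := mul_le_mul_of_nonneg_right hδ2 (norm_nonneg (v - w))
    linarith

/-- The difference quotient of the regularized collision operator at a touching point of the
difference quotient of `F`.  The terms where the quotient falls on `g` or on a cut-off need no
derivative of `F` in `Q`. -/
theorem collisionReg_diff_le (h : KernelHyp γ s b β) {a m₀ m₁ : ℝ} (ha : 2 * s < a) (ha1 : a < 1)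
    (hm₁ : 3 + γ + a < m₁) (hm₀ : m₁ + a ≤ (1 - a) * m₀) (hψ : IsCutoff ψ) (hΛ : 0 ≤ Λ) :
    ∃ C : ℝ, 0 ≤ C ∧ ∀ (g F : E3 × E3 → ℝ) (A y ε δ η N c : ℝ) (k z : E3 × E3),
      0 ≤ ε → ε ≤ Λ → 0 ≤ δ → δ ≤ Λ → 0 ≤ η → 0 ≤ N → N ≤ y →
      WLip m₀ m₁ A g → (∀ z, 0 ≤ g z) → WLip m₀ m₁ y F →
      ‖k‖ < 1 → |c| * ‖k‖ ≤ 1 →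
      (∀ z, c * (F (z + k) - F z) ≤ N * cmpWeight m₁ (2 * s) η z.2) →
      c * (F (z + k) - F z) = N * cmpWeight m₁ (2 * s) η z.2 →
      c * (collisionReg γ s b ψ ε δ g F (z + k) - collisionReg γ s b ψ ε δ g F z) ≤
        C * A * y * cmpWeight m₁ (2 * s) η z.2 := by
  have hs := h.s_pos
  have hγ := h.neg_three_lt
  have hm₁0 : 0 ≤ m₁ := by linarith
  have hm₀0 : 0 ≤ m₀ := by
    by_contra hc
    nlinarith
  have hle : m₁ ≤ m₀ := by nlinarith
  obtain ⟨C1, hC1, hQ1⟩ := collision_lip h (m₀ := m₀) (m₁ := m₁) ha ha1 hm₁ hm₀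
  obtain ⟨C2, hC2, hQ2⟩ := collision_touch h (m₀ := m₀) (m₁ := m₁) (m := m₁) ha ha1 hm₁ hm₀
    (by linarith) hle hψ hΛ
  obtain ⟨L, hL, hmul⟩ := hψ.exists_multiplier hΛ
  set P : ℝ := 2 ^ m₀ with hP
  set E : ℝ := (1 + Λ) ^ m₀ with hE
  have hP0 : 0 < P := by positivity
  have hE0 : 0 < E := by positivity
  refine ⟨L * (C1 * (2 * (P * E)) * (2 * L * (2 * P))) + C1 * E * (2 * L * (2 * P)) +
    C2 * (2 * E) + C1 * (2 * E) * (2 * L * (2 * P)), by positivity, ?_⟩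
  intro g F A y ε δ η N c k z hε hεΛ hδ hδΛ hη hN hNy hg hg0 hF hk hck hle' heq
  have hA := hg.nonneg
  have hy := hF.nonneg
  have hck2 : |c| * ‖k.2‖ ≤ 1 :=
    (mul_le_mul_of_nonneg_left (norm_snd_le k) (abs_nonneg c)).trans hck
  obtain ⟨hψl, hχ, hχl⟩ := hmul δ k.2 c hδ hδΛ hck2
  have hψ1 : ∀ v : E3, |ψ (δ • v)| ≤ L := fun v => (hψ.abs_le_one _).trans hL
  obtain ⟨x, v⟩ := z
  obtain ⟨k₁, k₂⟩ := k
  set ge := mollify ψ ε g with hge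
  have hgeW : WLip m₀ m₁ (E * A) ge := hψ.wLip_mollify hε hεΛ hm₁0 hle hg
  set G : E3 → ℝ := fun w => ge (x, w) with hG
  set G' : E3 → ℝ := fun w => ge (x + k₁, w + k₂) with hG'
  set F₀ : E3 → ℝ := fun w => F (x, w) with hF₀
  set F' : E3 → ℝ := fun w => F (x + k₁, w + k₂) with hF'
  set p : E3 → ℝ := fun w => ψ (δ • w) with hp
  set χ : E3 → ℝ := fun w => c * (ψ (δ • (w + k₂)) - ψ (δ • w)) with hχdef
  have vG : VLip m₀ (2 * (E * A)) G := hgeW.vLip hm₀0 hm₁0 x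
  have vG' : VLip m₀ (2 * (P * (E * A))) G' := (hgeW.shift hm₁0 hle hk.le).vLip hm₀0 hm₁0 x
  have vF₀ : VLip m₀ (2 * y) F₀ := hF.vLip hm₀0 hm₁0 x
  have vF' : VLip m₀ (2 * (P * y)) F' := (hF.shift hm₁0 hle hk.le).vLip hm₀0 hm₁0 x
  have vH : VLip m₀ _ (fun w => p w * F₀ w) := vF₀.mul_left hm₀0 hψ1 hψl
  have vH' : VLip m₀ (2 * L * (2 * (P * y))) (fun w => ψ (δ • (w + k₂)) * F' w) :=
    vF'.mul_left hm₀0 (fun w => hψ1 _) fun w w' => by simpa using hψl (w + k₂) (w' + k₂)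
  have vχ : VLip m₀ (2 * L * (2 * (P * y))) (fun w => χ w * F' w) := vF'.mul_left hm₀0 hχ hχl
  have vK : VLip m₀ _ (fun w => c * (G' w - G w)) := (vG'.sub vG).const_mul c
  have vW : VLip m₀ _ (fun w => p w * (c * (F' w - F₀ w))) :=
    ((vF'.sub vF₀).const_mul c).mul_left hm₀0 hψ1 hψl
  have to₁ : ∀ {B : ℝ} {u : E3 → ℝ}, VLip m₀ B u → ∀ w, |u w| ≤ B * jap w ^ (-m₁) := fun hu w =>
    (hu.bound w).trans (mul_le_mul_of_nonneg_left (jap_rpow_le w (by linarith)) hu.nonneg)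
  have bK : ∀ w, |c * (G' w - G w)| ≤ E * A * jap w ^ (-m₁) := fun w => by
    rw [abs_mul]
    have h1 := mul_le_mul_of_nonneg_left (hgeW.lip (x, w) (k₁, k₂) hk) (abs_nonneg c)
    have h2 := mul_le_mul_of_nonneg_right hck
      (mul_nonneg (mul_nonneg hE0.le hA) (jap_rpow_pos w (-m₁)).le)
    refine h1.trans (le_of_eq_of_le ?_ (h2.trans_eq (one_mul _)))
    ring
  -- the four parts
  obtain ⟨i1, q1⟩ := hQ1 G' _ _ _ _ v vG'.nonneg (to₁ vG') vG' vH'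
  obtain ⟨i2, q2⟩ := hQ1 _ _ _ _ _ v (mul_nonneg hE0.le hA) bK vK vH'
  obtain ⟨i3, -⟩ := hQ1 G _ _ _ _ v vG.nonneg (to₁ vG) vG vW
  obtain ⟨i4, q4⟩ := hQ1 G _ _ _ _ v vG.nonneg (to₁ vG) vG vχ
  obtain ⟨i5, -⟩ := hQ1 G _ _ _ _ v vG.nonneg (to₁ vG) vG vH
  obtain ⟨i6, -⟩ := hQ1 G _ _ _ _ v vG.nonneg (to₁ vG) vG vH'
  have q3 := hQ2 G (fun w => c * (F' w - F₀ w)) _ _ δ η N v hδ hδΛ hη hN vG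
    (fun w => hψ.mollify_nonneg hε hg0 _) vW (fun w => hle' (x, w)) heq
  have e0 : collisionReg γ s b ψ ε δ g F ((x, v) + (k₁, k₂)) =
      p (v + k₂) * collisionQ γ s b G' (fun w => ψ (δ • (w + k₂)) * F' w) v := by
    have := collisionQ_translate (γ := γ) (s := s) (b := b) (fun w => ge (x + k₁, w))
      (fun w => ψ (δ • w) * F (x + k₁, w)) v k₂
    simp only [collisionReg, Prod.mk_add_mk]
    rw [← this]
  have e1 : collisionReg γ s b ψ ε δ g F (x, v) =
      p v * collisionQ γ s b G (fun w => p w * F₀ w) v := rfl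
  have e2 : c * collisionQ γ s b G' (fun w => ψ (δ • (w + k₂)) * F' w) v =
      c * collisionQ γ s b G (fun w => ψ (δ • (w + k₂)) * F' w) v +
        collisionQ γ s b (fun w => c * (G' w - G w)) (fun w => ψ (δ • (w + k₂)) * F' w) v := by
    have i7 : Integrable (collInt γ s b (fun w => G' w - G w)
        (fun w => ψ (δ • (w + k₂)) * F' w) v) pairMeas := by
      refine (i1.sub i6).congr (Eventually.of_forall fun p => ?_)
      simp only [Pi.sub_apply, collInt]; ring
    have h1 := collisionQ_add_left i6 i7
    rw [collisionQ_const_mul_left, ← mul_add, ← h1]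
    simp only [add_sub_cancel]
  have e3 : c * collisionQ γ s b G (fun w => ψ (δ • (w + k₂)) * F' w) v =
      c * collisionQ γ s b G (fun w => p w * F₀ w) v +
        (collisionQ γ s b G (fun w => p w * (c * (F' w - F₀ w))) v +
          collisionQ γ s b G (fun w => χ w * F' w) v) := by
    rw [← collisionQ_const_mul_right, ← collisionQ_const_mul_right c G (fun w => p w * F₀ w),
      ← collisionQ_add_right i3 i4,
      ← collisionQ_add_right (integrable_collInt_const_mul_right c i5)
        (integrable_collInt_add_right i3 i4)]
    congr 1
    funext w
    simp only [hp, hχdef]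
    ring
  have hJ := jap_le_cmpWeight (m := m₁) (κ := 2 * s) hη v
  set J := jap v ^ (-m₁) with hJdef
  set q := cmpWeight m₁ (2 * s) η v with hq
  have hJ0 : 0 < J := jap_rpow_pos _ _
  have hq0 : 0 < q := hJ0.trans_le hJ
  set Q1 := collisionQ γ s b G' (fun w => ψ (δ • (w + k₂)) * F' w) v
  set Q2 := collisionQ γ s b (fun w => c * (G' w - G w)) (fun w => ψ (δ • (w + k₂)) * F' w) v
  set Q3 := collisionQ γ s b G (fun w => p w * (c * (F' w - F₀ w))) v
  set Q4 := collisionQ γ s b G (fun w => χ w * F' w) v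
  set Q5 := collisionQ γ s b G (fun w => p w * F₀ w) v
  have hsplit : c * (p (v + k₂) * Q1 - p v * Q5) = χ v * Q1 + p v * (Q2 + Q3 + Q4) := by
    have h1 : χ v = c * (p (v + k₂) - p v) := rfl
    rw [h1]
    linear_combination p v * e2 + p v * e3
  have hAy : 0 ≤ A * y := mul_nonneg hA hy
  have t1 : χ v * Q1 ≤ L * (C1 * (2 * (P * E)) * (2 * L * (2 * P))) * (A * y) * q := by
    refine (le_abs_self _).trans ?_
    rw [abs_mul]
    refine (mul_le_mul (hχ v) q1 (abs_nonneg _) (by linarith)).trans ?_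
    calc _ = L * (C1 * (2 * (P * E)) * (2 * L * (2 * P))) * (A * y) * J := by ring
      _ ≤ _ := mul_le_mul_of_nonneg_left hJ (by positivity)
  have t2 : Q2 ≤ C1 * E * (2 * L * (2 * P)) * (A * y) * q := by
    refine ((le_abs_self _).trans q2).trans ?_
    calc _ = C1 * E * (2 * L * (2 * P)) * (A * y) * J := by ring
      _ ≤ _ := mul_le_mul_of_nonneg_left hJ (by positivity)
  have t4 : Q4 ≤ C1 * (2 * E) * (2 * L * (2 * P)) * (A * y) * q := by
    refine ((le_abs_self _).trans q4).trans ?_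
    calc _ = C1 * (2 * E) * (2 * L * (2 * P)) * (A * y) * J := by ring
      _ ≤ _ := mul_le_mul_of_nonneg_left hJ (by positivity)
  have t3 : Q3 ≤ C2 * (2 * E) * (A * y) * q := by
    refine q3.trans ?_
    calc _ = C2 * (2 * E) * (A * N) * q := by ring
      _ ≤ _ := mul_le_mul_of_nonneg_right (mul_le_mul_of_nonneg_left
          (mul_le_mul_of_nonneg_left hNy hA) (by positivity)) hq0.le
  have t5 : p v * (Q2 + Q3 + Q4) ≤ (C1 * E * (2 * L * (2 * P)) + C2 * (2 * E) +
      C1 * (2 * E) * (2 * L * (2 * P))) * (A * y) * q := by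
    have h1 : Q2 + Q3 + Q4 ≤ (C1 * E * (2 * L * (2 * P)) + C2 * (2 * E) +
      C1 * (2 * E) * (2 * L * (2 * P))) * (A * y) * q := by linarith
    refine (mul_le_mul_of_nonneg_left h1 (hψ.nonneg _)).trans
      (mul_le_of_le_one_left (by positivity) (hψ.le_one _))
  rw [e0, e1, hsplit]
  linarith

end

/-! ### The equation at a touching point -/

/-- The truncated transport field `ψ(δv) v` is Lipschitz uniformly in `δ`. -/
lemma IsCutoff.exists_lip_transport {ψ : E3 → ℝ} (hψ : IsCutoff ψ) {Λ : ℝ} (hΛ : 0 ≤ Λ) :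
    ∃ L : ℝ, 0 ≤ L ∧ ∀ (δ : ℝ) (v k : E3), 0 ≤ δ → δ ≤ Λ → ‖k‖ ≤ 1 →
      ‖ψ (δ • (v + k)) • (v + k) - ψ (δ • v) • v‖ ≤ L * ‖k‖ := by
  obtain ⟨L, hL, hlip, -⟩ := hψ.exists_lip
  refine ⟨1 + L * (2 * (1 + Λ)), by positivity, fun δ v k hδ hδΛ hk => ?_⟩
  have hvk : v - (v + k) = -k := by abel
  have h1 := hψ.abs_sub_mul_jap_le (by linarith) hlip hδ hδΛ one_le_two (v := v) (w := v + k)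
    (jap_le_two_mul (by rwa [hvk, norm_neg]))
  rw [hvk, norm_neg] at h1
  have e : ψ (δ • (v + k)) • (v + k) - ψ (δ • v) • v =
      ψ (δ • (v + k)) • k - (ψ (δ • v) - ψ (δ • (v + k))) • v := by module
  rw [e]
  refine (norm_sub_le _ _).trans ?_
  rw [norm_smul, norm_smul, Real.norm_eq_abs, Real.norm_eq_abs]
  have h2 := mul_le_mul_of_nonneg_right (hψ.abs_le_one (δ • (v + k))) (norm_nonneg k)
  have h3 := mul_le_mul_of_nonneg_left (norm_le_jap v) (abs_nonneg (ψ (δ • v) - ψ (δ • (v + k))))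
  linarith

section
variable {γ s : ℝ} {b : ℝ → ℝ} {β : ℝ} {ψ : E3 → ℝ} {Λ : ℝ}

lemma le_of_mul_cmpWeight_le {m κ η N y : ℝ} (hη : 0 ≤ η) (hy : 0 ≤ y) {v : E3}
    (h : N * cmpWeight m κ η v ≤ y * jap v ^ (-m)) : N ≤ y :=
  le_of_mul_le_mul_right
    (h.trans (mul_le_mul_of_nonneg_left (jap_le_cmpWeight hη v) hy)) (cmpWeight_pos hη v)

/-- Bounds for the time derivative `D` of a solution and of its difference quotients, at points
where these touch a multiple of the weight; `g`, `F`, `R`, `D` are taken at a fixed time. -/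
theorem touch_bound (h : KernelHyp γ s b β) {a m₀ m₁ : ℝ} (ha : 2 * s < a) (ha1 : a < 1)
    (hm₁ : 3 + γ + a < m₁) (hm₀ : m₁ + a ≤ (1 - a) * m₀) (hψ : IsCutoff ψ) (hΛ : 0 ≤ Λ) :
    ∃ C : ℝ, 0 ≤ C ∧ ∀ (σ ε δ A y r : ℝ) (g F R D : E3 × E3 → ℝ),
      0 ≤ σ → σ ≤ 1 → 0 ≤ ε → ε ≤ Λ → 0 ≤ δ → δ ≤ Λ →
      WLip m₀ m₁ A g → (∀ z, 0 ≤ g z) → WLip m₀ m₁ y F → WLip m₀ m₁ r R → Differentiable ℝ F →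
      (0 < ε + (1 - σ) → ContDiff ℝ 2 F) →
      (∀ z, D z + σ * ψ (δ • z.2) * fderiv ℝ F z (z.2, 0) - (ε + (1 - σ)) * laplXV F z -
        σ * collisionReg γ s b ψ ε δ g F z = R z) →
      (∀ (η N c : ℝ) (z : E3 × E3), 0 ≤ η → 0 ≤ N → |c| ≤ 1 →
        (∀ z, c * F z ≤ N * cmpWeight m₀ (2 * s) η z.2) →
        c * F z = N * cmpWeight m₀ (2 * s) η z.2 →
        c * D z ≤ C * ((1 + A) * y + r) * cmpWeight m₀ (2 * s) η z.2) ∧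
      ∀ (η N c : ℝ) (k z : E3 × E3), 0 ≤ η → 0 ≤ N → ‖k‖ < 1 → |c| * ‖k‖ ≤ 1 →
        (∀ z, c * (F (z + k) - F z) ≤ N * cmpWeight m₁ (2 * s) η z.2) →
        c * (F (z + k) - F z) = N * cmpWeight m₁ (2 * s) η z.2 →
        c * (D (z + k) - D z) ≤ C * ((1 + A) * y + r) * cmpWeight m₁ (2 * s) η z.2 := by
  have hs := h.s_pos
  have hγ := h.neg_three_lt
  have hm₁0 : 0 ≤ m₁ := by linarith
  have hm₀0 : 0 ≤ m₀ := by
    by_contra hc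
    nlinarith
  have hle : m₁ ≤ m₀ := by nlinarith
  obtain ⟨C1, hC1, hQ1⟩ := collision_touch h (m₀ := m₀) (m₁ := m₁) (m := m₀) ha ha1 hm₁ hm₀
    (by linarith) le_rfl hψ hΛ
  obtain ⟨C2, hC2, hQ2⟩ := collisionReg_diff_le h (m₀ := m₀) (m₁ := m₁) ha ha1 hm₁ hm₀ hψ hΛ
  obtain ⟨C3, hC3, hT⟩ := hψ.exists_lip_transport hΛ
  obtain ⟨L, hL, hmul⟩ := hψ.exists_multiplier hΛ
  set E : ℝ := (1 + Λ) ^ m₀ with hE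
  have hE0 : 0 < E := by positivity
  set K : ℝ := (Λ + 1) * (3 * (m₀ * (m₀ + 2))) with hK
  have hK0 : 0 ≤ K := by positivity
  refine ⟨1 + K + C1 * (2 * E) + C2 + C3 * 2 ^ m₁, by positivity, ?_⟩
  intro σ ε δ A y r g F R D hσ hσ1 hε hεΛ hδ hδΛ hg hg0 hF hR hFd hF2 heqn
  have hA := hg.nonneg
  have hy := hF.nonneg
  have hr := hR.nonneg
  have hν : 0 ≤ ε + (1 - σ) := by linarith
  -- the Laplacian of a combination of `F` and a translate
  have hlap : ∀ (m η N c c' : ℝ) (k z : E3 × E3), 2 * s ≤ m → m ≤ m₀ → 0 ≤ η → 0 ≤ N → N ≤ y →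
      (∀ z, c * F (z + k) + c' * F z ≤ N * cmpWeight m (2 * s) η z.2) →
      c * F (z + k) + c' * F z = N * cmpWeight m (2 * s) η z.2 →
      (ε + (1 - σ)) * (c * laplXV F (z + k) + c' * laplXV F z) ≤
        K * y * cmpWeight m (2 * s) η z.2 := by
    intro m η N c c' k z hsm hmm hη hN hNy hle' heq
    have hq := cmpWeight_pos (m := m) (κ := 2 * s) hη z.2
    rcases hν.eq_or_lt with h0 | hpos
    · rw [← h0, zero_mul]
      exact mul_nonneg (mul_nonneg hK0 hy) hq.le
    · have hc2 := hF2 hpos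
      have hw : ContDiff ℝ 2 fun z => c * F (z + k) + c' * F z :=
        (contDiff_const.mul (hc2.comp (by fun_prop))).add (contDiff_const.mul hc2)
      have h1 := laplXV_le_of_touch hw (by linarith) hsm hη hN hle' heq
      rw [laplXV_comb hc2] at h1
      have h2 : N * cmpWeight m (2 * s) η z.2 ≤ y * cmpWeight m (2 * s) η z.2 :=
        mul_le_mul_of_nonneg_right hNy hq.le
      have h3 : 3 * (m * (m + 2)) ≤ 3 * (m₀ * (m₀ + 2)) := by nlinarith
      calc (ε + (1 - σ)) * (c * laplXV F (z + k) + c' * laplXV F z)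
          ≤ (ε + (1 - σ)) * (3 * (m * (m + 2)) * (N * cmpWeight m (2 * s) η z.2)) :=
            mul_le_mul_of_nonneg_left h1 hν
        _ ≤ (Λ + 1) * (3 * (m₀ * (m₀ + 2)) * (y * cmpWeight m (2 * s) η z.2)) :=
            mul_le_mul (by linarith)
              (mul_le_mul h3 h2 (mul_nonneg hN hq.le) (by positivity))
              (mul_nonneg (mul_nonneg (by norm_num) (mul_nonneg (by linarith) (by linarith)))
                (mul_nonneg hN hq.le)) (by linarith)
        _ = _ := by rw [hK]; ring
  have hgrad : ∀ (m η N c c' : ℝ) (k z : E3 × E3) (e : E3),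
      (∀ z, c * F (z + k) + c' * F z ≤ N * cmpWeight m (2 * s) η z.2) →
      c * F (z + k) + c' * F z = N * cmpWeight m (2 * s) η z.2 →
      c * fderiv ℝ F (z + k) (e, 0) + c' * fderiv ℝ F z (e, 0) = 0 := by
    intro m η N c c' k z e hle' heq
    have h1 := fderiv_comb hFd c c' k z
    have h2 := fderiv_eq_zero_of_touch (q := fun v => N * cmpWeight m (2 * s) η v)
      h1.differentiableAt hle' heq e
    rw [h1.fderiv] at h2
    simpa using h2
  refine ⟨fun η N c z hη hN hc hle' heq => ?_, fun η N c k z hη hN hk hck hle' heq => ?_⟩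
  · have hq := cmpWeight_pos (m := m₀) (κ := 2 * s) hη z.2
    have hJ := jap_le_cmpWeight (m := m₀) (κ := 2 * s) hη z.2
    set q := cmpWeight m₀ (2 * s) η z.2 with hqdef
    have hcF : |c * F z| ≤ y * jap z.2 ^ (-m₀) := by
      rw [abs_mul]
      exact (mul_le_of_le_one_left (abs_nonneg _) hc).trans (hF.bound z)
    have hNy : N ≤ y := le_of_mul_cmpWeight_le (m := m₀) (κ := 2 * s) hη hy (v := z.2)
      (heq.symm.le.trans ((le_abs_self _).trans hcF))
    have h1 := hlap m₀ η N c 0 0 z (by linarith) le_rfl hη hN hNy (by simpa using hle')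
      (by simpa using heq)
    have h2 := hgrad m₀ η N c 0 0 z z.2 (by simpa using hle') (by simpa using heq)
    simp only [add_zero, zero_mul] at h1 h2
    have h3 : c * R z ≤ r * q := by
      refine (le_abs_self _).trans ?_
      rw [abs_mul]
      exact (mul_le_of_le_one_left (abs_nonneg _) hc).trans
        ((hR.bound z).trans (mul_le_mul_of_nonneg_left hJ hr))
    have hgeW := hψ.wLip_mollify hε hεΛ hm₁0 hle hg
    have hψ1 : ∀ v : E3, |ψ (δ • v)| ≤ L := fun v => (hψ.abs_le_one _).trans hL
    have hψl := (hmul δ 0 0 hδ hδΛ (by simp)).1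
    have h4 := hQ1 (fun w => mollify ψ ε g (z.1, w)) (fun w => c * F (z.1, w)) _ _ δ η N z.2
      hδ hδΛ hη hN (hgeW.vLip hm₀0 hm₁0 z.1) (fun w => hψ.mollify_nonneg hε hg0 _)
      (((hF.vLip hm₀0 hm₁0 z.1).const_mul c).mul_left hm₀0 hψ1 hψl) (fun w => hle' _) heq
    have e4 : c * collisionReg γ s b ψ ε δ g F z = ψ (δ • z.2) *
        collisionQ γ s b (fun w => mollify ψ ε g (z.1, w))
          (fun w => ψ (δ • w) * (c * F (z.1, w))) z.2 := by
      have e5 : (fun w => ψ (δ • w) * (c * F (z.1, w))) =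
          fun w => c * (ψ (δ • w) * F (z.1, w)) := by funext w; ring
      rw [e5, collisionQ_const_mul_right, collisionReg]; ring
    have h5 : σ * (c * collisionReg γ s b ψ ε δ g F z) ≤ C1 * (2 * E) * (A * y) * q := by
      have h6 : C1 * (2 * (E * A)) * N * q ≤ C1 * (2 * E) * (A * y) * q := by
        calc _ = C1 * (2 * E) * (A * N) * q := by ring
          _ ≤ _ := mul_le_mul_of_nonneg_right (mul_le_mul_of_nonneg_left
              (mul_le_mul_of_nonneg_left hNy hA) (by positivity)) hq.le
      have h7 : 0 ≤ C1 * (2 * E) * (A * y) * q :=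
        mul_nonneg (mul_nonneg (by positivity) (mul_nonneg hA hy)) hq.le
      rw [e4, ← mul_assoc]
      refine (mul_le_mul_of_nonneg_left (h4.trans h6) (mul_nonneg hσ (hψ.nonneg _))).trans
        (mul_le_of_le_one_left h7 (mul_le_one₀ hσ1 (hψ.nonneg _) (hψ.le_one _)))
    have e : c * D z = c * R z + (ε + (1 - σ)) * (c * laplXV F z) +
        σ * (c * collisionReg γ s b ψ ε δ g F z) := by
      linear_combination c * heqn z - σ * ψ (δ • z.2) * h2
    have hyq : 0 ≤ y * q := mul_nonneg hy hq.le
    have hrq : 0 ≤ r * q := mul_nonneg hr hq.le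
    have hAyq : 0 ≤ A * y * q := mul_nonneg (mul_nonneg hA hy) hq.le
    have hC32 : 0 ≤ C3 * 2 ^ m₁ := by positivity
    have hCE : 0 ≤ C1 * (2 * E) := by positivity
    have hrest : 0 ≤ (1 + C1 * (2 * E) + C2 + C3 * 2 ^ m₁) * (y * q) +
        (1 + K + C2 + C3 * 2 ^ m₁) * (A * y * q) +
        (K + C1 * (2 * E) + C2 + C3 * 2 ^ m₁) * (r * q) := by positivity
    rw [e]
    linarith
  · have hq := cmpWeight_pos (m := m₁) (κ := 2 * s) hη z.2
    have hJ := jap_le_cmpWeight (m := m₁) (κ := 2 * s) hη z.2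
    have hJ0 := jap_rpow_pos z.2 (-m₁)
    set J := jap z.2 ^ (-m₁) with hJdef
    set q := cmpWeight m₁ (2 * s) η z.2 with hqdef
    have hquot : ∀ (u : E3 × E3 → ℝ) (B : ℝ), WLip m₀ m₁ B u →
        |c * (u (z + k) - u z)| ≤ B * J := fun u B hu => by
      rw [abs_mul]
      have h1 := mul_le_mul_of_nonneg_left (hu.lip z k hk) (abs_nonneg c)
      have h2 := mul_le_mul_of_nonneg_right hck (mul_nonneg hu.nonneg hJ0.le)
      linarith
    have hNy : N ≤ y := le_of_mul_cmpWeight_le (m := m₁) (κ := 2 * s) hη hy (v := z.2)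
      (heq.symm.le.trans ((le_abs_self _).trans (hquot F y hF)))
    have ew : ∀ z, c * (F (z + k) - F z) = c * F (z + k) + (-c) * F z := fun z => by ring
    have h1 := hlap m₁ η N c (-c) k z (by linarith) hle hη hN hNy
      (fun z => by rw [← ew]; exact hle' z) (by rw [← ew]; exact heq)
    have h2 := hgrad m₁ η N c (-c) k z z.2
      (fun z => by rw [← ew]; exact hle' z) (by rw [← ew]; exact heq)
    have h3 : c * (R (z + k) - R z) ≤ r * q :=
      (le_abs_self _).trans ((hquot R r hR).trans (mul_le_mul_of_nonneg_left hJ hr))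
    have h4 := hQ2 g F A y ε δ η N c k z hε hεΛ hδ hδΛ hη hN hNy hg hg0 hF hk hck hle' heq
    have hAyq : 0 ≤ A * y * q := mul_nonneg (mul_nonneg hA hy) hq.le
    have h5 : σ * (c * (collisionReg γ s b ψ ε δ g F (z + k) - collisionReg γ s b ψ ε δ g F z)) ≤
        C2 * (A * y * q) := by
      refine (mul_le_mul_of_nonneg_left h4 hσ).trans ?_
      calc σ * (C2 * A * y * q) ≤ 1 * (C2 * A * y * q) :=
            mul_le_mul_of_nonneg_right hσ1 (by positivity)
        _ = _ := by ring
    -- the commutator of the difference quotient with the transport term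
    set T : E3 := ψ (δ • (z.2 + k.2)) • (z.2 + k.2) - ψ (δ • z.2) • z.2 with hTdef
    have hkn : ‖k.2‖ ≤ ‖k‖ := norm_snd_le k
    have h6 : -(σ * (c * fderiv ℝ F (z + k) (T, 0))) ≤ C3 * 2 ^ m₁ * (y * q) := by
      refine (neg_le_abs _).trans ?_
      have h7 : |fderiv ℝ F (z + k) (T, 0)| ≤ y * (2 ^ m₁ * J) * (C3 * ‖k‖) := by
        have h8 := (fderiv ℝ F (z + k)).le_opNorm (T, 0)
        have h9 : ‖((T, 0) : E3 × E3)‖ = ‖T‖ := by simp [Prod.norm_def]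
        rw [h9, Real.norm_eq_abs] at h8
        refine h8.trans (mul_le_mul ((hF.norm_fderiv_le hFd _).trans
          (mul_le_mul_of_nonneg_left ?_ hy))
          ((hT δ z.2 k.2 hδ hδΛ (by linarith)).trans (mul_le_mul_of_nonneg_left hkn hC3))
          (norm_nonneg _) (by positivity))
        exact jap_add_rpow_neg_le hm₁0 two_pos z.2 k.2 (by linarith)
      rw [abs_mul, abs_mul, abs_of_nonneg hσ]
      calc σ * (|c| * |fderiv ℝ F (z + k) (T, 0)|)
          ≤ 1 * (|c| * |fderiv ℝ F (z + k) (T, 0)|) :=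
            mul_le_mul_of_nonneg_right hσ1 (by positivity)
        _ ≤ 1 * (|c| * (y * (2 ^ m₁ * J) * (C3 * ‖k‖))) := by gcongr
        _ = (|c| * ‖k‖) * (y * (2 ^ m₁ * J) * C3) := by ring
        _ ≤ 1 * (y * (2 ^ m₁ * J) * C3) := mul_le_mul_of_nonneg_right hck (by positivity)
        _ = C3 * 2 ^ m₁ * (y * J) := by ring
        _ ≤ _ := by gcongr
    have e6 : ψ (δ • (z.2 + k.2)) * fderiv ℝ F (z + k) (z.2 + k.2, 0) =
        fderiv ℝ F (z + k) (T, 0) + ψ (δ • z.2) * fderiv ℝ F (z + k) (z.2, 0) := by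
      have e7 : ((T, 0) : E3 × E3) = ψ (δ • (z.2 + k.2)) • ((z.2 + k.2, 0) : E3 × E3) -
          ψ (δ • z.2) • ((z.2, 0) : E3 × E3) := by
        ext <;> simp [hTdef]
      rw [e7, map_sub, map_smul, map_smul, smul_eq_mul, smul_eq_mul]; ring
    have e8 := heqn (z + k)
    simp only [Prod.snd_add] at e8
    have e : c * (D (z + k) - D z) = c * (R (z + k) - R z) +
        (ε + (1 - σ)) * (c * laplXV F (z + k) + (-c) * laplXV F z) +
        σ * (c * (collisionReg γ s b ψ ε δ g F (z + k) - collisionReg γ s b ψ ε δ g F z)) -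
        σ * (c * fderiv ℝ F (z + k) (T, 0)) := by
      linear_combination c * e8 - c * heqn z - σ * ψ (δ • z.2) * h2 - σ * c * e6
    have hyq : 0 ≤ y * q := mul_nonneg hy hq.le
    have hrq : 0 ≤ r * q := mul_nonneg hr hq.le
    have hCE : 0 ≤ C1 * (2 * E) := by positivity
    have hC32 : 0 ≤ C3 * 2 ^ m₁ := by positivity
    have hrest : 0 ≤ (1 + C1 * (2 * E) + C2) * (y * q) +
        (1 + K + C1 * (2 * E) + C3 * 2 ^ m₁) * (A * y * q) +
        (K + C1 * (2 * E) + C2 + C3 * 2 ^ m₁) * (r * q) := by positivity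
    rw [e]
    linarith

end

/-! ### Propagation in time -/

lemma le_of_forall_cmpWeight {m κ x N : ℝ} {v : E3}
    (h : ∀ η > 0, x ≤ N * cmpWeight m κ η v) : x ≤ N * jap v ^ (-m) := by
  have h1 : Tendsto (fun η => N * cmpWeight m κ η v) (𝓝[>] 0) (𝓝 (N * jap v ^ (-m))) := by
    have h2 : Continuous fun η => N * cmpWeight m κ η v := by unfold cmpWeight; fun_prop
    have h3 := h2.tendsto 0
    simp only [cmpWeight, zero_mul, add_zero] at h3
    exact h3.mono_left nhdsWithin_le_nhds
  exact ge_of_tendsto h1 (eventually_mem_nhdsWithin.mono fun η hη => h η hη)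

/-- The maximum principle for `f` and for its difference quotients: differential inequalities at
touching points give a bound for all times. -/
theorem wLip_of_touch {m₀ m₁ κ T N0 Y : ℝ} {f : ℝ → E3 × E3 → ℝ} {Φ : ℝ → ℝ} (hκ : 0 < κ)
    (hcont : ContinuousOn (fun p : ℝ × (E3 × E3) => f p.1 p.2) (Icc 0 T ×ˢ univ))
    (hper : ∀ t ∈ Icc 0 T, PeriodicX (f t)) (hY : ∀ t ∈ Icc 0 T, WLip m₀ m₁ Y (f t))
    (hlip : ∀ z, LocallyLipschitzOn (Ioo 0 T) (fun t => f t z))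
    (hΦ : IntegrableOn Φ (Icc 0 T)) (hΦ0 : ∀ t, 0 ≤ Φ t) (h0 : WLip m₀ m₁ N0 (f 0))
    (hdiff : ∀ᵐ t ∂volume.restrict (Ioo 0 T), ∀ z, DifferentiableAt ℝ (fun τ => f τ z) t)
    (hA : ∀ᵐ t ∂volume.restrict (Ioo 0 T), ∀ (η N c : ℝ) (z : E3 × E3), 0 ≤ η → 0 ≤ N → |c| ≤ 1 →
        (∀ z, c * f t z ≤ N * cmpWeight m₀ κ η z.2) → c * f t z = N * cmpWeight m₀ κ η z.2 →
        c * deriv (fun τ => f τ z) t ≤ Φ t * cmpWeight m₀ κ η z.2)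
    (hB : ∀ᵐ t ∂volume.restrict (Ioo 0 T), ∀ (η N c : ℝ) (k z : E3 × E3), 0 ≤ η → 0 ≤ N →
        ‖k‖ < 1 → |c| * ‖k‖ ≤ 1 →
        (∀ z, c * (f t (z + k) - f t z) ≤ N * cmpWeight m₁ κ η z.2) →
        c * (f t (z + k) - f t z) = N * cmpWeight m₁ κ η z.2 →
        c * (deriv (fun τ => f τ (z + k)) t - deriv (fun τ => f τ z) t) ≤
          Φ t * cmpWeight m₁ κ η z.2) :
    ∀ t ∈ Ico 0 T, WLip m₀ m₁ (N0 + ∫ τ in (0 : ℝ)..t, Φ τ) (f t) := by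
  intro t ht
  have hN0 := h0.nonneg
  have key0 : ∀ c : ℝ, |c| ≤ 1 → ∀ z,
      c * f t z ≤ (N0 + ∫ τ in (0 : ℝ)..t, Φ τ) * jap z.2 ^ (-m₀) := by
    intro c hc z
    refine le_of_forall_cmpWeight (κ := κ) fun η hη => ?_
    have hle : ∀ t ∈ Icc 0 T, ∀ z, c * f t z ≤ Y * jap z.2 ^ (-m₀) := fun t ht z => by
      refine (le_abs_self _).trans ?_
      rw [abs_mul]
      exact (mul_le_of_le_one_left (abs_nonneg _) hc).trans ((hY t ht).bound z)
    refine max_principle (w := fun t z => c * f t z) continuous_cmpWeight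
      (fun v => cmpWeight_pos hη.le v) (continuousOn_const.mul hcont)
      (fun t ht i x v => by simp only [hper t ht i x v]) (fun κ' hκ' => ?_) (fun z => ?_)
      hΦ hΦ0 ?_ hN0 (fun z => ?_) t ht z
    · obtain ⟨R, hR⟩ := exists_le_cmpWeight (m := m₀) hκ hη Y hκ'
      exact ⟨R, fun t ht z hz => (hle t ht z).trans (hR z.2 hz)⟩
    · intro x hx
      obtain ⟨K, S, hS, hK⟩ := hlip z hx
      exact ⟨_, S, hS, (lipschitzWith_smul c).comp_lipschitzOnWith hK⟩
    · filter_upwards [hdiff, hA] with t hd hAt z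
      refine ⟨(hd z).const_mul c, fun N hN heq hle' => ?_⟩
      rw [deriv_const_mul _ (hd z)]
      exact hAt η N c z hη.le hN.le hc hle' heq
    · refine (le_abs_self _).trans ?_
      rw [abs_mul]
      exact (mul_le_of_le_one_left (abs_nonneg _) hc).trans
        ((h0.bound z).trans (mul_le_mul_of_nonneg_left (jap_le_cmpWeight hη.le _) hN0))
  have key1 : ∀ (c : ℝ) (k : E3 × E3), ‖k‖ < 1 → |c| * ‖k‖ ≤ 1 → ∀ z,
      c * (f t (z + k) - f t z) ≤ (N0 + ∫ τ in (0 : ℝ)..t, Φ τ) * jap z.2 ^ (-m₁) := by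
    intro c k hk hck z
    refine le_of_forall_cmpWeight (κ := κ) fun η hη => ?_
    have hle : ∀ (B : ℝ) (φ : E3 × E3 → ℝ), WLip m₀ m₁ B φ → ∀ z,
        c * (φ (z + k) - φ z) ≤ B * jap z.2 ^ (-m₁) := fun B φ hφ z => by
      refine (le_abs_self _).trans ?_
      rw [abs_mul]
      have h1 := mul_le_mul_of_nonneg_left (hφ.lip z k hk) (abs_nonneg c)
      have h2 := mul_le_mul_of_nonneg_right hck
        (mul_nonneg hφ.nonneg (jap_rpow_pos z.2 (-m₁)).le)
      linarith
    have hcont' : ContinuousOn (fun p : ℝ × (E3 × E3) => f p.1 (p.2 + k)) (Icc 0 T ×ˢ univ) := by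
      have h1 : Continuous fun p : ℝ × (E3 × E3) => (p.1, p.2 + k) := by fun_prop
      exact hcont.comp h1.continuousOn fun p hp => ⟨hp.1, mem_univ _⟩
    refine max_principle (w := fun t z => c * (f t (z + k) - f t z)) continuous_cmpWeight
      (fun v => cmpWeight_pos hη.le v) (continuousOn_const.mul (hcont'.sub hcont))
      (fun t ht i x v => ?_) (fun κ' hκ' => ?_) (fun z => ?_)
      hΦ hΦ0 ?_ hN0 (fun z => ?_) t ht z
    · have h1 := hper t ht i (x + k.1) (v + k.2)
      have h2 : ((x + EuclideanSpace.single i (1 : ℝ), v) : E3 × E3) + k =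
          (x + k.1 + EuclideanSpace.single i (1 : ℝ), v + k.2) := by
        ext1
        · exact add_right_comm _ _ _
        · rfl
      have h3 : ((x, v) : E3 × E3) + k = (x + k.1, v + k.2) := rfl
      simp only [hper t ht i x v, h2, h3, h1]
    · obtain ⟨R, hR⟩ := exists_le_cmpWeight (m := m₁) hκ hη Y hκ'
      exact ⟨R, fun t ht z hz => (hle Y _ (hY t ht) z).trans (hR z.2 hz)⟩
    · intro x hx
      obtain ⟨K, S, hS, hK⟩ := hlip z hx
      obtain ⟨K', S', hS', hK'⟩ := hlip (z + k) hx
      have h1 := (hK'.mono (inter_subset_right (s := S))).sub (hK.mono inter_subset_left)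
      exact ⟨_, S ∩ S', inter_mem hS hS', (lipschitzWith_smul c).comp_lipschitzOnWith h1⟩
    · filter_upwards [hdiff, hB] with t hd hBt z
      refine ⟨((hd _).sub (hd z)).const_mul c, fun N hN heq hle' => ?_⟩
      have h1 : HasDerivAt (fun τ => c * (f τ (z + k) - f τ z))
          (c * (deriv (fun τ => f τ (z + k)) t - deriv (fun τ => f τ z) t)) t :=
        ((hd _).hasDerivAt.sub (hd z).hasDerivAt).const_mul c
      rw [h1.deriv]
      exact hBt η N c k z hη.le hN.le hk hck hle' heq
    · exact (hle N0 _ h0 z).trans (mul_le_mul_of_nonneg_left (jap_le_cmpWeight hη.le _) hN0)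
  refine ⟨fun z => ?_, fun z k hk => ?_⟩
  · have h1 := key0 1 (by simp) z
    have h2 := key0 (-1) (by simp) z
    rw [abs_le]
    constructor <;> linarith
  · rcases eq_or_ne k 0 with rfl | hk0
    · simp
    · have hkp : 0 < ‖k‖ := norm_pos_iff.2 hk0
      have h1 := key1 ‖k‖⁻¹ k hk (by simp [hkp.ne']) z
      have h2 := key1 (-‖k‖⁻¹) k hk (by simp [hkp.ne']) z
      have e : ‖k‖⁻¹ * |f t (z + k) - f t z| ≤
          (N0 + ∫ τ in (0 : ℝ)..t, Φ τ) * jap z.2 ^ (-m₁) := by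
        rcases abs_choice (f t (z + k) - f t z) with h3 | h3 <;> rw [h3] <;> linarith
      rw [inv_mul_le_iff₀ hkp] at e
      linarith

/-! ### The spaces `L^∞([0,T]; X)` -/

section
variable {m₀ m₁ T : ℝ} {g f : ℝ → E3 × E3 → ℝ}

lemma MemX.wnorm_le {φ : E3 × E3 → ℝ} (h : MemX m₀ m₁ φ) (hm : 0 ≤ m₁) :
    wnorm m₀ m₁ φ ≤ ENNReal.ofReal (2 ^ m₁) * normX m₀ m₁ φ := by
  refine (h.wLip hm).wnorm_le.trans_eq ?_
  rw [ENNReal.ofReal_mul (by positivity), ENNReal.ofReal_toReal h.finite.ne]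

lemma MemX.wLip_wnorm {φ : E3 × E3 → ℝ} (h : MemX m₀ m₁ φ) (hm : 0 ≤ m₁) :
    WLip m₀ m₁ (wnorm m₀ m₁ φ).toReal φ :=
  wLip_of_wnorm h.contDiff.continuous
    ((h.wLip hm).wnorm_le.trans_lt ENNReal.ofReal_lt_top)

lemma MemY.ae_le (h : MemY m₀ m₁ T g) :
    ∀ᵐ t ∂volume.restrict (Icc 0 T), MemX m₀ m₁ (g t) ∧
      (normX m₀ m₁ (g t)).toReal ≤ (normY m₀ m₁ T g).toReal := by
  filter_upwards [h.memX, ENNReal.ae_le_essSup (fun t => normX m₀ m₁ (g t))] with t h1 h2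
  exact ⟨h1, ENNReal.toReal_mono h.finite.ne h2⟩

lemma MemY.ae_wLip (h : MemY m₀ m₁ T g) (hm : 0 ≤ m₁) :
    ∀ᵐ t ∂volume.restrict (Icc 0 T),
      WLip m₀ m₁ (2 ^ m₁ * (normY m₀ m₁ T g).toReal) (g t) := by
  filter_upwards [h.ae_le] with t ht
  exact (ht.1.wLip hm).mono (mul_le_mul_of_nonneg_left ht.2 (by positivity))

lemma MemY.integrableOn_wnorm (h : MemY m₀ m₁ T g) (hm : 0 ≤ m₁) :
    IntegrableOn (fun t => (wnorm m₀ m₁ (g t)).toReal) (Icc 0 T) := by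
  refine Integrable.of_bound (C := 2 ^ m₁ * (normY m₀ m₁ T g).toReal)
    (aemeasurable_wnorm h.aemeasurable).ennreal_toReal.aestronglyMeasurable ?_
  filter_upwards [h.ae_wLip hm] with t ht
  rw [Real.norm_of_nonneg ENNReal.toReal_nonneg]
  exact ENNReal.toReal_le_of_le_ofReal ht.nonneg ht.wnorm_le

lemma MemY.integrableOn_wnorm_mul (hg : MemY m₀ m₁ T g) (hf : MemY m₀ m₁ T f) (hm : 0 ≤ m₁) :
    IntegrableOn (fun t => (1 + (wnorm m₀ m₁ (g t)).toReal) * (wnorm m₀ m₁ (f t)).toReal)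
      (Icc 0 T) := by
  have h1 : IntegrableOn (fun t => 1 + (wnorm m₀ m₁ (g t)).toReal) (Icc 0 T) :=
    integrableOn_const (by simp) |>.add (hg.integrableOn_wnorm hm)
  refine h1.mul_bdd (c := 2 ^ m₁ * (normY m₀ m₁ T f).toReal)
    (hf.integrableOn_wnorm hm).aestronglyMeasurable ?_
  filter_upwards [hf.ae_wLip hm] with t ht
  rw [Real.norm_of_nonneg ENNReal.toReal_nonneg]
  exact ENNReal.toReal_le_of_le_ofReal ht.nonneg ht.wnorm_le

/-- The smallest constants of `g(t)` are controlled in `L¹` by the norms of `g(t)`. -/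
lemma MemY.integral_wnorm_le (h : MemY m₀ m₁ T g) (hm : 0 ≤ m₁) (hT : 0 ≤ T) :
    ∫ t in (0 : ℝ)..T, (1 + (wnorm m₀ m₁ (g t)).toReal) ≤
      2 ^ m₁ * (∫⁻ t in Icc 0 T, (1 + normX m₀ m₁ (g t))).toReal := by
  have h2 : (1 : ℝ) ≤ 2 ^ m₁ := Real.one_le_rpow one_le_two hm
  have hfin : ∫⁻ t in Icc 0 T, (1 + normX m₀ m₁ (g t)) ≠ ∞ := by
    have h1 : ∫⁻ t in Icc 0 T, (1 + normX m₀ m₁ (g t)) ≤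
        ∫⁻ _ in Icc 0 T, (1 + normY m₀ m₁ T g) := by
      refine lintegral_mono_ae ?_
      filter_upwards [ENNReal.ae_le_essSup (fun t => normX m₀ m₁ (g t))] with t ht
      exact add_le_add_right ht 1
    refine (h1.trans_lt ?_).ne
    rw [lintegral_const]
    exact ENNReal.mul_lt_top (ENNReal.add_lt_top.2 ⟨ENNReal.one_lt_top, h.finite⟩) (by simp)
  have h1 : IntegrableOn (fun t => 1 + (wnorm m₀ m₁ (g t)).toReal) (Icc 0 T) :=
    integrableOn_const (by simp) |>.add (h.integrableOn_wnorm hm)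
  rw [intervalIntegral.integral_of_le hT, ← integral_Icc_eq_integral_Ioc,
    integral_eq_lintegral_of_nonneg_ae (Eventually.of_forall fun t => by positivity)
      h1.aestronglyMeasurable]
  have h3 : ∫⁻ t in Icc 0 T, ENNReal.ofReal (1 + (wnorm m₀ m₁ (g t)).toReal) ≤
      ENNReal.ofReal (2 ^ m₁) * ∫⁻ t in Icc 0 T, (1 + normX m₀ m₁ (g t)) := by
    rw [← lintegral_const_mul' _ _ ENNReal.ofReal_ne_top]
    refine lintegral_mono_ae ?_
    filter_upwards [h.memX] with t ht
    rw [ENNReal.ofReal_add zero_le_one ENNReal.toReal_nonneg, mul_add, mul_one, ENNReal.ofReal_one]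
    refine add_le_add ?_ (ENNReal.ofReal_toReal_le.trans (ht.wnorm_le hm))
    rw [← ENNReal.ofReal_one]
    exact ENNReal.ofReal_le_ofReal h2
  refine (ENNReal.toReal_mono (ENNReal.mul_ne_top ENNReal.ofReal_ne_top hfin) h3).trans_eq ?_
  rw [ENNReal.toReal_mul, ENNReal.toReal_ofReal (by positivity)]

/-- A bound for a continuous function of time that holds at almost every time holds at every
time. -/
lemma le_of_ae_le_of_continuousOn {u : ℝ → ℝ} {B : ℝ} (hT : 0 < T)
    (hu : ContinuousOn u (Icc 0 T)) (h : ∀ᵐ t ∂volume.restrict (Icc 0 T), u t ≤ B) :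
    ∀ t ∈ Icc 0 T, u t ≤ B := by
  intro t ht
  have h1 : ∀ᵐ t, t ∈ Icc 0 T → u t ≤ B := (ae_restrict_iff' measurableSet_Icc).1 h
  have hd : Dense {t | t ∈ Icc 0 T → u t ≤ B} := Measure.dense_of_ae h1
  have h2 : t ∈ closure (Ioo 0 T ∩ {t | t ∈ Icc 0 T → u t ≤ B}) := by
    have h3 := closure_mono (hd.open_subset_closure_inter (isOpen_Ioo (a := (0 : ℝ)) (b := T)))
    rw [closure_closure, closure_Ioo hT.ne] at h3
    exact h3 ht
  refine ContinuousWithinAt.closure_le h2 ((hu t ht).mono ?_) continuousWithinAt_const ?_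
  · exact inter_subset_left.trans Ioo_subset_Icc_self
  · rintro x ⟨hx1, hx2⟩
    exact hx2 (Ioo_subset_Icc_self hx1)

lemma wLip_of_ae {Y : ℝ} (hT : 0 < T)
    (hcont : ContinuousOn (fun p : ℝ × (E3 × E3) => f p.1 p.2) (Icc 0 T ×ˢ univ))
    (h : ∀ᵐ t ∂volume.restrict (Icc 0 T), WLip m₀ m₁ Y (f t)) :
    ∀ t ∈ Icc 0 T, WLip m₀ m₁ Y (f t) := by
  have hc : ∀ z, ContinuousOn (fun t => f t z) (Icc 0 T) := fun z =>
    hcont.comp (by fun_prop : Continuous fun t : ℝ => (t, z)).continuousOn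
      fun t ht => ⟨ht, mem_univ _⟩
  refine fun t ht => ⟨fun z => ?_, fun z k hk => ?_⟩
  · exact le_of_ae_le_of_continuousOn hT (hc z).abs (h.mono fun t ht => ht.bound z) t ht
  · exact le_of_ae_le_of_continuousOn hT ((hc (z + k)).sub (hc z)).abs
      (h.mono fun t ht => ht.lip z k hk) t ht

lemma periodicX_of_ae (hT : 0 < T)
    (hcont : ContinuousOn (fun p : ℝ × (E3 × E3) => f p.1 p.2) (Icc 0 T ×ˢ univ))
    (h : ∀ᵐ t ∂volume.restrict (Icc 0 T), PeriodicX (f t)) :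
    ∀ t ∈ Icc 0 T, PeriodicX (f t) := by
  have hc : ∀ z, ContinuousOn (fun t => f t z) (Icc 0 T) := fun z =>
    hcont.comp (by fun_prop : Continuous fun t : ℝ => (t, z)).continuousOn
      fun t ht => ⟨ht, mem_univ _⟩
  intro t ht i x v
  have h1 := le_of_ae_le_of_continuousOn (B := 0) hT ((hc _).sub (hc (x, v))).abs
    (h.mono fun t ht => by rw [Pi.sub_apply, ht i x v, sub_self, abs_zero]) t ht
  exact sub_eq_zero.1 (abs_nonpos_iff.1 h1)

end

/-! ### The a priori estimate -/

section
variable {γ s : ℝ} {b : ℝ → ℝ} {β : ℝ} {ψ : E3 → ℝ} {Λ : ℝ}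

/-- Pointwise form of the estimate, with the constants of `g` and `f` in `WLip` at each time; it is
closed by Grönwall's inequality. -/
theorem exists_wLip_bound (h : KernelHyp γ s b β) {a m₀ m₁ : ℝ} (ha : 2 * s < a) (ha1 : a < 1)
    (hm₁ : 3 + γ + a < m₁) (hm₀ : m₁ + a ≤ (1 - a) * m₀) (hψ : IsCutoff ψ) (hΛ : 0 ≤ Λ) :
    ∃ C : ℝ, 0 ≤ C ∧ ∀ (σ ε δ T : ℝ) (fin : E3 × E3 → ℝ) (g R f : ℝ → E3 × E3 → ℝ),
      0 ≤ σ → σ ≤ 1 → 0 ≤ ε → ε ≤ Λ → 0 ≤ δ → δ ≤ Λ → 0 < T →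
      MemX m₀ m₁ fin → MemY m₀ m₁ T g →
      (∀ᵐ t ∂volume.restrict (Icc 0 T), ∀ z, 0 ≤ g t z) → MemY m₀ m₁ T R → MemY m₀ m₁ T f →
      IsSolution γ s b ψ σ ε δ T fin g R f →
      ∀ t ∈ Ico 0 T, WLip m₀ m₁
        ((2 ^ m₁ * (normX m₀ m₁ fin).toReal + C * (2 ^ m₁ * (normY m₀ m₁ T R).toReal) * T) *
          Real.exp (C * ∫ τ in (0 : ℝ)..T, (1 + (wnorm m₀ m₁ (g τ)).toReal))) (f t) := by
  have hs := h.s_pos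
  have hγ := h.neg_three_lt
  have hm₁0 : 0 ≤ m₁ := by linarith
  obtain ⟨C, hC, hmain⟩ := touch_bound h ha ha1 hm₁ hm₀ hψ hΛ
  refine ⟨C, hC, ?_⟩
  intro σ ε δ T fin g R f hσ hσ1 hε hεΛ hδ hδΛ hT hfin hg hg0 hR hf hsol
  set A : ℝ → ℝ := fun t => (wnorm m₀ m₁ (g t)).toReal with hAdef
  set y : ℝ → ℝ := fun t => (wnorm m₀ m₁ (f t)).toReal with hydef
  set r : ℝ := 2 ^ m₁ * (normY m₀ m₁ T R).toReal with hr
  set N0 : ℝ := 2 ^ m₁ * (normX m₀ m₁ fin).toReal with hN0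
  have hA0 : ∀ t, 0 ≤ A t := fun t => ENNReal.toReal_nonneg
  have hy0 : ∀ t, 0 ≤ y t := fun t => ENNReal.toReal_nonneg
  have hr0 : 0 ≤ r := by positivity
  set α : ℝ → ℝ := fun t => C * (1 + A t) with hα
  set Φ : ℝ → ℝ := fun t => α t * y t + C * r with hΦ
  have hα0 : ∀ t, 0 ≤ α t := fun t => mul_nonneg hC (by linarith [hA0 t])
  have hΦ0 : ∀ t, 0 ≤ Φ t := fun t =>
    add_nonneg (mul_nonneg (hα0 t) (hy0 t)) (mul_nonneg hC hr0)
  have iα : IntegrableOn α (Icc 0 T) :=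
    ((integrableOn_const (by simp)).add (hg.integrableOn_wnorm hm₁0)).const_mul C
  have iαy : IntegrableOn (fun t => α t * y t) (Icc 0 T) :=
    ((hg.integrableOn_wnorm_mul hf hm₁0).const_mul C).congr
      (Eventually.of_forall fun t => (mul_assoc C (1 + A t) (y t)).symm)
  have iΦ : IntegrableOn Φ (Icc 0 T) := iαy.add (integrableOn_const (by simp))
  have hsub : ∀ {p : ℝ → Prop}, (∀ᵐ t ∂volume.restrict (Icc 0 T), p t) →
      ∀ᵐ t ∂volume.restrict (Ioo 0 T), p t := fun hp =>
    ae_mono (Measure.restrict_mono Ioo_subset_Icc_self le_rfl) hp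
  have hC2 : ∀ᵐ t ∂volume.restrict (Ioo 0 T), 0 < ε + (1 - σ) → ContDiff ℝ 2 (f t) := by
    by_cases h0 : 0 < ε + (1 - σ)
    · filter_upwards [hsol.contDiff h0] with t ht _ using ht
    · exact Eventually.of_forall fun t ht => absurd ht h0
  have hpt := ((hsub hg.memX).and ((hsub hg0).and ((hsub hf.memX).and
    ((hsub (hR.ae_wLip hm₁0)).and (hC2.and hsol.equation))))).mono
    fun t ⟨h1, h2, h3, h4, h5, h6⟩ => hmain σ ε δ (A t) (y t) r (g t) (f t) (R t)
      (fun z => deriv (fun τ => f τ z) t) hσ hσ1 hε hεΛ hδ hδΛ (h1.wLip_wnorm hm₁0) h2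
      (h3.wLip_wnorm hm₁0) h4 (h3.contDiff.differentiable one_ne_zero) h5 fun z => (h6 z).2
  have hΦe : ∀ t q, C * ((1 + A t) * y t + r) * q = Φ t * q := fun t q => by
    simp only [hΦ, hα]; ring
  have hfin0 : f 0 = fin := funext hsol.initial
  have hall := wLip_of_ae hT hsol.continuousOn (hf.ae_wLip hm₁0)
  have hper := periodicX_of_ae hT hsol.continuousOn (hf.memX.mono fun t ht => ht.periodic)
  have hW := wLip_of_touch (m₀ := m₀) (m₁ := m₁) (κ := 2 * s) (N0 := N0) (Φ := Φ) (by linarith)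
    hsol.continuousOn hper hall hsol.lipschitz iΦ hΦ0 (by rw [hfin0]; exact hfin.wLip hm₁0)
    (hsol.equation.mono fun t ht z => (ht z).1)
    (hpt.mono fun t ht η N c z h1 h2 h3 h4 h5 =>
      (ht.1 η N c z h1 h2 h3 h4 h5).trans_eq (hΦe t _))
    (hpt.mono fun t ht η N c k z h1 h2 h3 h4 h5 h6 =>
      (ht.2 η N c k z h1 h2 h3 h4 h5 h6).trans_eq (hΦe t _))
  have hIΦ : ∀ t ∈ Icc 0 T, N0 + ∫ τ in (0 : ℝ)..t, Φ τ ≤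
      (N0 + C * r * T) + ∫ τ in (0 : ℝ)..t, α τ * y τ := by
    intro t ht
    have hαyt : IntervalIntegrable (fun t => α t * y t) volume 0 t :=
      (intervalIntegrable_iff_integrableOn_Icc_of_le ht.1).2
        (iαy.mono_set (Icc_subset_Icc_right ht.2))
    rw [intervalIntegral.integral_add hαyt (by simp), intervalIntegral.integral_const, sub_zero,
      smul_eq_mul]
    have := mul_le_mul_of_nonneg_right ht.2 (mul_nonneg hC hr0)
    linarith
  have hgr := gronwall_integral (A := N0 + C * r * T) iα hα0 iαy (by
    have hne : ∀ᵐ t ∂volume.restrict (Icc 0 T), t ≠ T :=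
      ae_restrict_of_ae (by simp [ae_iff])
    filter_upwards [hne, ae_restrict_mem measurableSet_Icc] with t h1 h2
    have h3 := hW t ⟨h2.1, lt_of_le_of_ne h2.2 h1⟩
    exact (ENNReal.toReal_le_of_le_ofReal h3.nonneg h3.wnorm_le).trans (hIΦ t h2))
  intro t ht
  have ht' : t ∈ Icc 0 T := Ico_subset_Icc_self ht
  refine (hW t ht).mono ((hIΦ t ht').trans ((hgr t ht').trans ?_))
  refine mul_le_mul_of_nonneg_left (Real.exp_le_exp.2 ?_) (by positivity)
  have h1 : ∫ τ in (0 : ℝ)..t, α τ ≤ ∫ τ in (0 : ℝ)..T, α τ := by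
    rw [intervalIntegral.integral_of_le ht.1, intervalIntegral.integral_of_le hT.le]
    exact setIntegral_mono_set (iα.mono_set Ioc_subset_Icc_self)
      (Eventually.of_forall fun t => hα0 t) (Ioc_subset_Ioc_right ht.2.le).eventuallyLE
  exact h1.trans_eq (intervalIntegral.integral_const_mul _ _)

end

end Boltzmann

end

theorem proposition5p2 (γ s m₁ : ℝ) (hγ : -3 < γ) (hγ' : γ ≤ 0) (hs : 0 < s) (hs' : s < 1 / 2)
    (hm₁ : 3 + γ + 2 * s < m₁) :
    ∃ M : ℝ, ∀ m₀ : ℝ, M ≤ m₀ →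
      ∀ b : ℝ → ℝ, Measurable b →
        (∃ β : ℝ, ∀ c ∈ Set.Icc (-1 : ℝ) 1, 0 < b c ∧ b c ≤ β) →
      ∀ ψ : Boltzmann.E3 → ℝ, Boltzmann.IsCutoff ψ →
      ∀ Λ : ℝ, 0 < Λ →
      ∃ C : ℝ, 0 < C ∧
        ∀ σ ∈ Set.Icc (0 : ℝ) 1, ∀ ε ∈ Set.Icc (0 : ℝ) Λ, ∀ δ ∈ Set.Icc (0 : ℝ) Λ,
        ∀ T : ℝ, 0 < T →
        ∀ (fin : Boltzmann.E3 × Boltzmann.E3 → ℝ)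
          (g R f : ℝ → Boltzmann.E3 × Boltzmann.E3 → ℝ),
          Boltzmann.MemX m₀ m₁ fin →
          Boltzmann.MemY m₀ m₁ T g →
          (∀ᵐ t ∂(volume.restrict (Set.Icc 0 T)), ∀ z, 0 ≤ g t z) →
          Boltzmann.MemY m₀ m₁ T R →
          Boltzmann.MemY m₀ m₁ T f →
          Boltzmann.IsSolution γ s b ψ σ ε δ T fin g R f →
          Boltzmann.normY m₀ m₁ T f ≤
            ENNReal.ofReal
                (C * Real.exp (C *
                  (∫⁻ t in Set.Icc 0 T, (1 + Boltzmann.normX m₀ m₁ (g t))).toReal)) *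
              (Boltzmann.normX m₀ m₁ fin +
                ENNReal.ofReal T * Boltzmann.normY m₀ m₁ T R) := by
  open Boltzmann Set in
  -- `a` is the Hölder exponent used in `Q`: it beats the angular singularity as `a > 2s`, and the
  -- weight `⟨v⟩^{-m₁}` still dominates as `a < m₁ - 3 - γ`.
  obtain ⟨a, ha, hal⟩ := exists_between (lt_min (by linarith : 2 * s < 1)
    (by linarith : 2 * s < m₁ - 3 - γ))
  have ha1 : a < 1 := hal.trans_le (min_le_left _ _)
  have ham : a < m₁ - 3 - γ := hal.trans_le (min_le_right _ _)
  have hm₁0 : 0 ≤ m₁ := by linarith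
  -- Interpolating between the size and the Lipschitz bound leaves the decay `⟨v⟩^{-(1-a)m₀}`, which
  -- has to beat `⟨v⟩^{-m₁-a}`.
  refine ⟨(m₁ + a) / (1 - a), fun m₀ hm₀ b hb ⟨β, hβ⟩ ψ hψ Λ hΛ => ?_⟩
  rw [div_le_iff₀' (by linarith)] at hm₀
  have h : KernelHyp γ s b β := ⟨hγ, hγ', hs, hs', hb, fun c hc => (hβ c hc).1.le,
    fun c hc => (hβ c hc).2⟩
  obtain ⟨C, hC, hmain⟩ := exists_wLip_bound h ha ha1 (by linarith) hm₀ hψ hΛ.le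
  have h2 : (1 : ℝ) ≤ 2 ^ m₁ := Real.one_le_rpow one_le_two hm₁0
  refine ⟨2 * 2 ^ m₁ * (1 + C), by positivity, ?_⟩
  intro σ hσ ε hε δ hδ T hT fin g R f hfin hg hg0 hR hf hsol
  set I := (∫⁻ t in Icc 0 T, (1 + normX m₀ m₁ (g t))).toReal with hI
  have hI0 : 0 ≤ I := ENNReal.toReal_nonneg
  set X := (normX m₀ m₁ fin).toReal with hX
  set Y := (normY m₀ m₁ T R).toReal with hY
  have hX0 : 0 ≤ X := ENNReal.toReal_nonneg
  have hY0 : 0 ≤ Y := ENNReal.toReal_nonneg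
  have hrhs : normX m₀ m₁ fin + ENNReal.ofReal T * normY m₀ m₁ T R = ENNReal.ofReal (X + T * Y) := by
    rw [ENNReal.ofReal_add hX0 (mul_nonneg hT.le hY0), ENNReal.ofReal_mul hT.le, hX, hY,
      ENNReal.ofReal_toReal hfin.finite.ne, ENNReal.ofReal_toReal hR.finite.ne]
  rw [hrhs, ← ENNReal.ofReal_mul (by positivity)]
  refine essSup_le_of_ae_le _ ?_
  have hne : ∀ᵐ t ∂volume.restrict (Icc 0 T), t ≠ T := ae_restrict_of_ae (by simp [ae_iff])
  filter_upwards [hne, ae_restrict_mem measurableSet_Icc, hf.memX] with t h1 h3 h4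
  have hW := hmain σ ε δ T fin g R f hσ.1 hσ.2 hε.1 hε.2 hδ.1 hδ.2 hT hfin hg hg0 hR hf hsol t
    ⟨h3.1, lt_of_le_of_ne h3.2 h1⟩
  refine (hW.normX_le (h4.contDiff.differentiable one_ne_zero)).trans (ENNReal.ofReal_le_ofReal ?_)
  have e1 : C * ∫ τ in (0 : ℝ)..T, (1 + (wnorm m₀ m₁ (g τ)).toReal) ≤
      2 * 2 ^ m₁ * (1 + C) * I := by
    refine (mul_le_mul_of_nonneg_left (hg.integral_wnorm_le hm₁0 hT.le) hC).trans ?_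
    rw [← mul_assoc]
    exact mul_le_mul_of_nonneg_right (by nlinarith) hI0
  have e2 : 2 ^ m₁ * X + C * (2 ^ m₁ * Y) * T ≤ 2 ^ m₁ * (1 + C) * (X + T * Y) := by
    have p1 : 0 ≤ 2 ^ m₁ * (C * X) := by positivity
    have p2 : 0 ≤ 2 ^ m₁ * (T * Y) := by positivity
    linarith
  calc 2 * ((2 ^ m₁ * X + C * (2 ^ m₁ * Y) * T) *
        Real.exp (C * ∫ τ in (0 : ℝ)..T, (1 + (wnorm m₀ m₁ (g τ)).toReal)))
      ≤ 2 * (2 ^ m₁ * (1 + C) * (X + T * Y) * Real.exp (2 * 2 ^ m₁ * (1 + C) * I)) := by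
        gcongr
    _ = _ := by ring
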